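/- Let $d\in\mathbb C$, $d\neq 0$. Let $\mathcal O_d$ be the strict $\mathbb C$-linear tensor category of oriented Kauffman diagrams: its objects are the words $X^w$ in two letters $X,X^*$ (the empty word being the unit object $I$); $\operatorname{Hom}(X^w,X^{w'})$ is the complex vector space with basis the isotopy classes of systems of disjoint oriented planar strings in a rectangle whose upper (lower) terminal points are labelled by the letters of $w$ ($w'$), where a string starts at an upper $X$ or a lower $X^*$ and ends at an upper $X^*$ or a lower $X$; composition is vertical concatenation, every closed loop (of either orientation) being replaced by the factor $d$; the tensor product is horizontal juxtaposition. Let $\epsilon_X:X\otimes X^*\to I$ and $\epsilon_{X^*}:X^*\otimes X\to I$ be the basic arcs. A fiber functor on $\mathcal O_d$ is a $\mathbb C$-linear (strong) monoidal functor $\Phi$ from $\mathcal O_d$ to finite-dimensional complex vector spaces; two fiber functors are naturally equivalent if there is a monoidal natural isomorphism between them. **Theorem 5.1.** (a) Fiber functors on $\mathcal O_d$ are completely classified, up to natural equivalence, by the similarity orbits ($B\sim T^{-1}BT$, $T\in GL(n,\mathbb C)$) in $$\{B\in GL(n,\mathbb C);\ \operatorname{trace}(B)=d=\operatorname{trace}(B^{-1})\},\qquad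 n=0,1,2,\dots$$ Precisely, there is a bijection from the equivalence classes of fiber functors onto the disjoint union over $n$ of these sets of orbits, under which the class of $\Phi$ corresponds to the orbit of $B\in GL(n,\mathbb C)$ if and only if there are bases $(v_i)_{i=1}^n$ of $\Phi(X)$ and $(w_j)_{j=1}^n$ of $\Phi(X^*)$ such that $\Phi(\epsilon_X)(v_i\otimes w_j)=\delta_{ij}$ and $\Phi(\epsilon_{X^*})(w_j\otimes v_i)=b_{ji}$. (For $n=0$ the set is empty, since $d\ne0$.) (b) Let $\Phi$ be a fiber functor, $(v_i)_{i=1}^n$ a basis of $\Phi(X)$, $(w_j)_{j=1}^n$ a basis of $\Phi(X^*)$, $a_{ij}=\Phi(\epsilon_X)(v_i\otimes w_j)$ and $b_{ji}=\Phi(\epsilon_{X^*})(w_j\otimes v_i)$. Then the matrices $A=(a_{ij})$ and $B=(b_{ji})$ are invertible; write $A^{-1}=(c_{ji})$ and $B^{-1}=(d_{ij})$. The Hopf algebra $H$ associated with $\Phi$ by Tannaka–Krein duality (the universal Hopf algebra coacting on all the spaces $\Phi(X^w)$, naturally and compatibly with tensor products, i.e. the coend of $\Phi$) exists. If $v_{ij},w_{kl}\in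 H$ denote the matrix coefficients, given by the coactions $v_j\mapsto\sum_i v_i\otimes v_{ij}$ and $w_l\mapsto\sum_k w_k\otimes w_{kl}$, then $H$ is generated as an algebra by these $2n^2$ elements with the defining relations $$\sum_{i,k}a_{ik}v_{ij}w_{kl}=a_{jl}1,\quad \sum_{j,i}c_{ji}w_{kj}v_{li}=c_{kl}1,\quad \sum_{i,k}b_{ik}w_{ij}v_{kl}=b_{jl}1,\quad \sum_{j,i}d_{ji}v_{kj}w_{li}=d_{kl}1,$$ and its comultiplication is given by $\Delta(v_{ij})=\sum_k v_{ik}\otimes v_{kj}$ and $\Delta(w_{kl})=\sum_i w_{ki}\otimes w_{il}$. -/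

import Mathlib

open CategoryTheory MonoidalCategory TensorProduct

namespace OrientedKauffman

/-- The two letters `X` and `X*`. -/
inductive Letter where
  | X
  | Xstar

/-- Terminal points of a diagram: `up i` is the `i`-th point (from the left, starting with `0`) on
the upper bounding line, `lo j` the `j`-th point on the lower one. -/
inductive Pt where
  | up (i : ℕ)
  | lo (j : ℕ)

/-- In type `(u, v)`, a string starts at `p`: the upper points labelled `X`, and the lower points
labelled `X*`. -/
def IsStart (u v : List Letter) : Pt → Prop
  | .up i => u[i]? = some .X
  | .lo j => v[j]? = some .Xstar

/-- In type `(u, v)`, a string ends at `p`: the upper points labelled `X*`, and the lower points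
labelled `X`. -/
def IsEnd (u v : List Letter) : Pt → Prop
  | .up i => u[i]? = some .Xstar
  | .lo j => v[j]? = some .X

/-- Position of a terminal point along the boundary of the rectangle, cut open in the middle of
its right edge: the upper line from right to left, then the lower line from left to right. -/
def Pt.key : Pt → ℤ
  | .up i => -(i + 1)
  | .lo j => j

/-- Oriented Kauffman diagrams of type `(u, v)`.  The isotopy class of a system of disjoint
oriented planar strings in a rectangle (without closed strings) is recorded by the relation
`arc p q`: a string runs from the terminal point `p` to the terminal point `q`.  The strings match
starting points with ending points, and no two strings cross. -/
@[ext]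
structure Diagram (u v : List Letter) where
  arc : Pt → Pt → Prop
  isStart : ∀ {p q}, arc p q → IsStart u v p
  isEnd : ∀ {p q}, arc p q → IsEnd u v q
  exists_out : ∀ {p}, IsStart u v p → ∃ q, arc p q
  exists_in : ∀ {q}, IsEnd u v q → ∃ p, arc p q
  out_unique : ∀ {p q q'}, arc p q → arc p q' → q = q'
  in_unique : ∀ {p p' q}, arc p q → arc p' q → p = p'
  noncrossing : ∀ {p q p' q'}, (arc p q ∨ arc q p) → (arc p' q' ∨ arc q' p') →
    p.key < p'.key → p'.key < q.key → ¬ q.key < q'.key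

/-- Put the upper terminal points on the horizontal line number `a` and the lower ones on the
line number `b`. -/
def emb (a b : ℕ) : Pt → ℕ × ℕ
  | .up i => (a, i)
  | .lo j => (b, j)

/-- The strings `r`, drawn between the lines `a` and `b`. -/
def place (a b : ℕ) (r : Pt → Pt → Prop) : ℕ × ℕ → ℕ × ℕ → Prop :=
  Relation.Map r (emb a b) (emb a b)

/-- The concatenated picture: the strings of `D` between the lines `0` and `1`, and below them
the strings of `E` between the lines `1` and `2`. -/
def stack {u v w : List Letter} (D : Diagram u v) (E : Diagram v w) : ℕ × ℕ → ℕ × ℕ → Prop :=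
  place 0 1 D.arc ⊔ place 1 2 E.arc

/-- The closed loops of an oriented picture, each given as its set of points. -/
def loopSet {α : Type*} (r : α → α → Prop) : Set (Set α) :=
  {c | ∃ x, Relation.TransGen r x x ∧
    c = {y | Relation.TransGen r x y ∧ Relation.TransGen r y x}}

/-- The number of closed loops that arise when `D` and `E` are concatenated. -/
noncomputable def loops {u v w : List Letter} (D : Diagram u v) (E : Diagram v w) : ℕ :=
  (loopSet (stack D E)).ncard

section Relations
open Relation

variable {α β : Type*}

theorem exists_terminal {r : α → α → Prop} (hl : ∀ a b c, r a c → r b c → a = b)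
    (hf : {y | ∃ x, r x y}.Finite) {x : α} (hx : ∀ y, ¬ r y x) :
    ∃ y, ReflTransGen r x y ∧ ∀ z, ¬ r y z := by
  by_contra! h
  choose! f hf' using h
  let s : ℕ → α := fun n => f^[n] x
  have hs : ∀ n, ReflTransGen r x (s n) := by
    intro n
    induction n with
    | zero => exact .refl
    | succ n ih =>
      have : s (n+1) = f (s n) := Function.iterate_succ_apply' f n x
      rw [this]; exact ih.tail (hf' _ ih)
  have hs' : ∀ n, r (s n) (s (n+1)) := by
    intro n
    have : s (n+1) = f (s n) := Function.iterate_succ_apply' f n x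
    rw [this]; exact hf' _ (hs n)
  have key : ∀ n k, s n ≠ s (n+k+1) := by
    intro n
    induction n with
    | zero =>
      intro k e
      have h1 := hs' (0+k)
      rw [← e] at h1
      exact hx _ h1
    | succ n ih =>
      intro k e
      have h1 := hs' (n+1+k)
      rw [← e] at h1
      apply ih k
      rw [hl _ _ _ (hs' n) h1]
      congr 1; omega
  have inj : Function.Injective fun n => s (n+1) := by
    intro a b hab
    rcases lt_trichotomy a b with h | h | h
    · exact absurd (hab.trans (by congr 1; omega)) (key (a+1) (b-a-1))
    · exact h
    · exact absurd (hab.symm.trans (by congr 1; omega)) (key (b+1) (a-b-1))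
  exact Set.infinite_of_injective_forall_mem (s := {y | ∃ x, r x y}) inj
    (fun n => ⟨s n, hs' n⟩) hf

theorem transGen_map {r : α → α → Prop} {f : α → β} (hf : Function.Injective f) {x y : β} :
    TransGen (Relation.Map r f f) x y ↔ ∃ a b, TransGen r a b ∧ f a = x ∧ f b = y := by
  constructor
  · intro h
    induction h with
    | single h =>
      obtain ⟨a, b, h, rfl, rfl⟩ := h
      exact ⟨a, b, .single h, rfl, rfl⟩
    | tail _ h ih =>
      obtain ⟨a, b, h, rfl, rfl⟩ := h
      obtain ⟨c, d, h', rfl, e⟩ := ih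
      cases hf e
      exact ⟨_, _, h'.tail h, rfl, rfl⟩
  · rintro ⟨a, b, h, rfl, rfl⟩
    exact h.lift f fun a b h => ⟨a, b, h, rfl, rfl⟩

theorem ncard_loopSet_map {r : α → α → Prop} {f : α → β} (hf : Function.Injective f) :
    (loopSet (Relation.Map r f f)).ncard = (loopSet r).ncard := by
  have : loopSet (Relation.Map r f f) = (fun c => f '' c) '' loopSet r := by
    ext c
    constructor
    · rintro ⟨x, hx, rfl⟩
      obtain ⟨a, b, h, rfl, e⟩ := (transGen_map hf).1 hx
      cases hf e
      refine ⟨_, ⟨a, h, rfl⟩, ?_⟩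
      ext y
      simp only [transGen_map hf, Set.mem_image, Set.mem_ofPred_eq]
      constructor
      · rintro ⟨b, ⟨h1, h2⟩, rfl⟩
        exact ⟨⟨_, _, h1, rfl, rfl⟩, ⟨_, _, h2, rfl, rfl⟩⟩
      · rintro ⟨⟨a1, b1, h1, e1, rfl⟩, ⟨a2, b2, h2, e2, e3⟩⟩
        cases hf e1; cases hf e2; cases hf e3
        exact ⟨_, ⟨h1, h2⟩, rfl⟩
    · rintro ⟨_, ⟨a, h, rfl⟩, rfl⟩
      refine ⟨f a, (transGen_map hf).2 ⟨_, _, h, rfl, rfl⟩, ?_⟩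
      ext y
      simp only [transGen_map hf, Set.mem_image, Set.mem_ofPred_eq]
      constructor
      · rintro ⟨b, ⟨h1, h2⟩, rfl⟩
        exact ⟨⟨_, _, h1, rfl, rfl⟩, ⟨_, _, h2, rfl, rfl⟩⟩
      · rintro ⟨⟨a1, b1, h1, e1, rfl⟩, ⟨a2, b2, h2, e2, e3⟩⟩
        cases hf e1; cases hf e2; cases hf e3
        exact ⟨_, ⟨h1, h2⟩, rfl⟩
  rw [this, Set.ncard_image_of_injective _ hf.image_injective]

/-- Contract the paths of `R` through the hidden points `N`. -/
def hide (R : α → α → Prop) (N : Set α) (x y : α) : Prop := x ∉ N ∧ y ∉ N ∧ TransGen R x y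

theorem transGen_hide_aux {R S : α → α → Prop} {N : Set α}
    (hS : ∀ x y, S x y → x ∉ N ∧ y ∉ N) {x y : α} (hx : x ∉ N) (h : TransGen (R ⊔ S) x y) :
    (y ∉ N ∧ TransGen (hide R N ⊔ S) x y) ∨
    (∃ z, z ∉ N ∧ ReflTransGen (hide R N ⊔ S) x z ∧ TransGen R z y) := by
  have step : ∀ z y y', z ∉ N → ReflTransGen (hide R N ⊔ S) x z → ReflTransGen R z y →
      (R ⊔ S) y y' → (y' ∉ N ∧ TransGen (hide R N ⊔ S) x y') ∨
        (∃ z, z ∉ N ∧ ReflTransGen (hide R N ⊔ S) x z ∧ TransGen R z y') := by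
    intro z y y' hz h1 h2 h3
    rcases h3 with h3 | h3
    · exact .inr ⟨z, hz, h1, TransGen.tail' h2 h3⟩
    · refine .inl ⟨(hS _ _ h3).2, ?_⟩
      have : ReflTransGen (hide R N ⊔ S) z y := by
        rcases reflTransGen_iff_eq_or_transGen.1 h2 with rfl | h2
        · exact .refl
        · exact .single (.inl ⟨hz, (hS _ _ h3).1, h2⟩)
      exact TransGen.tail' (h1.trans this) (.inr h3)
  induction h with
  | single h => exact step x x _ hx .refl .refl h
  | @tail y y' _ h ih =>
    rcases ih with ⟨h1, h2⟩ | ⟨z, h1, h2, h3⟩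
    · exact step y y y' h1 h2.to_reflTransGen .refl h
    · exact step z y y' h1 h2 h3.to_reflTransGen h

theorem transGen_hide {R S : α → α → Prop} {N : Set α}
    (hS : ∀ x y, S x y → x ∉ N ∧ y ∉ N) {x y : α} (hx : x ∉ N) (hy : y ∉ N) :
    TransGen (hide R N ⊔ S) x y ↔ TransGen (R ⊔ S) x y := by
  constructor
  · intro h
    have hh : ∀ a b, (hide R N ⊔ S) a b → TransGen (R ⊔ S) a b := by
      rintro a b (h | h)
      · exact TransGen.mono le_sup_left _ _ h.2.2
      · exact .single (.inr h)
    induction h with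
    | single h => exact hh _ _ h
    | tail h h' ih =>
      rename_i b c
      have hb : b ∉ N := by
        rcases h' with h' | h'
        · exact h'.1
        · exact (hS _ _ h').1
      exact (ih hb).trans (hh _ _ h')
  · intro h
    rcases transGen_hide_aux hS hx h with h | ⟨z, h1, h2, h3⟩
    · exact h.2
    · exact TransGen.tail' h2 (.inl ⟨h1, hy, h3⟩)

theorem transGen_hide_not_mem {R S : α → α → Prop} {N : Set α}
    (hS : ∀ x y, S x y → x ∉ N ∧ y ∉ N) {x y : α} (h : TransGen (hide R N ⊔ S) x y) :
    x ∉ N ∧ y ∉ N := by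
  have hh : ∀ a b, (hide R N ⊔ S) a b → a ∉ N ∧ b ∉ N := by
    rintro a b (h | h)
    · exact ⟨h.1, h.2.1⟩
    · exact hS _ _ h
  induction h with
  | single h => exact hh _ _ h
  | tail _ h ih => exact ⟨ih.1, (hh _ _ h).2⟩

theorem finite_loopSet {r : α → α → Prop} (hf : {y | ∃ x, r x y}.Finite) : (loopSet r).Finite := by
  refine hf.finite_subsets.subset ?_
  rintro _ ⟨x, _, rfl⟩ y ⟨h, _⟩
  cases h with
  | single h => exact ⟨_, h⟩
  | tail _ h => exact ⟨_, h⟩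

theorem ncard_loopSet_hide {R S : α → α → Prop} {N : Set α}
    (hS : ∀ x y, S x y → x ∉ N ∧ y ∉ N) (hR : ∀ x y z, R x y → R x z → y = z)
    (hN : ∀ x, TransGen R x x → x ∈ N) (hf : {y | ∃ x, (R ⊔ S) x y}.Finite) :
    (loopSet (R ⊔ S)).ncard = (loopSet R).ncard + (loopSet (hide R N ⊔ S)).ncard := by
  -- points on a cycle of `R`
  have cyc : ∀ x, TransGen R x x → ∀ y, TransGen (R ⊔ S) x y → TransGen R x y ∧ TransGen R y x := by
    intro x hx y h
    have step : ∀ y z, TransGen R x y → TransGen R y x → (R ⊔ S) y z →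
        TransGen R x z ∧ TransGen R z x := by
      intro y z h1 h2 h3
      have hyN : y ∈ N := hN y (h2.trans h1)
      have h3 : R y z := by
        rcases h3 with h3 | h3
        · exact h3
        · exact absurd hyN (hS _ _ h3).1
      refine ⟨h1.tail h3, ?_⟩
      obtain ⟨z', h4, h5⟩ := TransGen.head'_iff.1 h2
      cases hR _ _ _ h3 h4
      exact TransGen.trans_right h5 hx
    induction h with
    | single h => exact step x _ hx hx h
    | tail _ h ih => exact step _ _ ih.1 ih.2 h
  have up : ∀ {x y}, TransGen R x y → TransGen (R ⊔ S) x y := TransGen.mono le_sup_left _ _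
  have onlyR : ∀ x, TransGen (R ⊔ S) x x →
      {y | TransGen (R ⊔ S) x y ∧ TransGen (R ⊔ S) y x} ⊆ N → TransGen R x x := by
    intro x hx hsub
    have : ∀ y, TransGen (R ⊔ S) x y → TransGen (R ⊔ S) y x → TransGen R x y := by
      intro y h
      induction h with
      | single h =>
        intro _
        rcases h with h | h
        · exact .single h
        · exact absurd (hsub ⟨hx, hx⟩) (hS _ _ h).1
      | tail h h' ih =>
        intro h2
        have h3 := TransGen.head h' h2
        rcases h' with h' | h'
        · exact (ih h3).tail h'
        · exact absurd (hsub ⟨h, h3⟩) (hS _ _ h').1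
    exact this x hx hx
  set L := loopSet (R ⊔ S) with hL
  have hLf : L.Finite := finite_loopSet hf
  have e1 : {c ∈ L | c ⊆ N} = loopSet R := by
    ext c
    constructor
    · rintro ⟨⟨x, hx, rfl⟩, hsub⟩
      have hx' := onlyR x hx hsub
      refine ⟨x, hx', ?_⟩
      ext y
      exact ⟨fun h => cyc x hx' y h.1, fun h => ⟨up h.1, up h.2⟩⟩
    · rintro ⟨x, hx, rfl⟩
      refine ⟨⟨x, up hx, ?_⟩, ?_⟩
      · ext y
        exact ⟨fun h => ⟨up h.1, up h.2⟩, fun h => cyc x hx y h.1⟩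
      · rintro y ⟨h1, h2⟩
        exact hN y (h2.trans h1)
  have e2 : (fun c => c \ N) '' {c ∈ L | ¬ c ⊆ N} = loopSet (hide R N ⊔ S) := by
    ext c
    constructor
    · rintro ⟨_, ⟨⟨x, hx, rfl⟩, hsub⟩, rfl⟩
      obtain ⟨p, ⟨hp1, hp2⟩, hpN⟩ := Set.not_subset.1 hsub
      refine ⟨p, (transGen_hide hS hpN hpN).2 (hp2.trans hp1), ?_⟩
      ext y
      constructor
      · rintro ⟨⟨h1, h2⟩, hy⟩
        exact ⟨(transGen_hide hS hpN hy).2 (hp2.trans h1),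
          (transGen_hide hS hy hpN).2 (h2.trans hp1)⟩
      · rintro ⟨h1, h2⟩
        have hy := (transGen_hide_not_mem hS h1).2
        exact ⟨⟨hp1.trans ((transGen_hide hS hpN hy).1 h1),
          ((transGen_hide hS hy hpN).1 h2).trans hp2⟩, hy⟩
    · rintro ⟨p, hp, rfl⟩
      have hpN := (transGen_hide_not_mem hS hp).1
      have hp' := (transGen_hide hS hpN hpN).1 hp
      refine ⟨_, ⟨⟨p, hp', rfl⟩, fun h => hpN (h ⟨hp', hp'⟩)⟩, ?_⟩
      ext y
      constructor
      · rintro ⟨⟨h1, h2⟩, hy⟩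
        exact ⟨(transGen_hide hS hpN hy).2 h1, (transGen_hide hS hy hpN).2 h2⟩
      · rintro ⟨h1, h2⟩
        have hy := (transGen_hide_not_mem hS h1).2
        exact ⟨⟨(transGen_hide hS hpN hy).1 h1, (transGen_hide hS hy hpN).1 h2⟩, hy⟩
  have inj : Set.InjOn (fun c => c \ N) {c ∈ L | ¬ c ⊆ N} := by
    rintro _ ⟨⟨x, hx, rfl⟩, hsub⟩ _ ⟨⟨x', hx', rfl⟩, hsub'⟩ he
    obtain ⟨p, ⟨hp1, hp2⟩, hpN⟩ := Set.not_subset.1 hsub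
    have hp : p ∈ {y | TransGen (R ⊔ S) x' y ∧ TransGen (R ⊔ S) y x'} \ N := by
      have : p ∈ {y | TransGen (R ⊔ S) x y ∧ TransGen (R ⊔ S) y x} \ N := ⟨⟨hp1, hp2⟩, hpN⟩
      exact (congrArg (fun c => p ∈ c) he).mp this
    obtain ⟨⟨hp3, hp4⟩, -⟩ := hp
    ext y
    constructor
    · rintro ⟨h1, h2⟩
      exact ⟨(hp3.trans hp2).trans h1, (h2.trans hp1).trans hp4⟩
    · rintro ⟨h1, h2⟩
      exact ⟨(hp1.trans hp4).trans h1, (h2.trans hp3).trans hp2⟩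
  rw [← e1, ← e2, inj.ncard_image, ← Set.ncard_union_eq ?_ (hLf.subset fun c h => h.1)
    (hLf.subset fun c h => h.1)]
  · congr 1
    ext c
    simp only [Set.mem_union, Set.mem_ofPred_eq]
    tauto
  · rw [Set.disjoint_left]
    rintro c h1 h2
    exact h2.2 h1.2

end Relations

section Composition
open Relation

variable {u v w : List Letter}

theorem emb_injective {a b : ℕ} (h : a ≠ b) : Function.Injective (emb a b) := by
  rintro (i | i) (j | j) e <;> simp_all [emb]

theorem not_start_end {p : Pt} (h : IsStart u v p) (h' : IsEnd u v p) : False := by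
  cases p <;> simp_all [IsStart, IsEnd]

theorem not_start_start {p q : Pt} (e : emb 0 1 p = emb 1 2 q) (h : IsStart u v p)
    (h' : IsStart v w q) : False := by
  cases p <;> cases q <;> simp_all [IsStart, emb]

theorem not_end_end {p q : Pt} (e : emb 0 1 p = emb 1 2 q) (h : IsEnd u v p)
    (h' : IsEnd v w q) : False := by
  cases p <;> cases q <;> simp_all [IsEnd, emb]

theorem stack_out {D : Diagram u v} {E : Diagram v w} {x y z : ℕ × ℕ}
    (h : stack D E x y) (h' : stack D E x z) : y = z := by
  rcases h with ⟨p, q, h, rfl, rfl⟩ | ⟨p, q, h, rfl, rfl⟩ <;>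
  rcases h' with ⟨p', q', h', e, rfl⟩ | ⟨p', q', h', e, rfl⟩
  · cases emb_injective (by decide) e
    rw [D.out_unique h h']
  · exact (not_start_start e.symm (D.isStart h) (E.isStart h')).elim
  · exact (not_start_start e (D.isStart h') (E.isStart h)).elim
  · cases emb_injective (by decide) e
    rw [E.out_unique h h']

theorem stack_in {D : Diagram u v} {E : Diagram v w} {x y z : ℕ × ℕ}
    (h : stack D E x z) (h' : stack D E y z) : x = y := by
  rcases h with ⟨p, q, h, rfl, rfl⟩ | ⟨p, q, h, rfl, rfl⟩ <;>
  rcases h' with ⟨p', q', h', rfl, e⟩ | ⟨p', q', h', rfl, e⟩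
  · cases emb_injective (by decide) e
    rw [D.in_unique h h']
  · exact (not_end_end e.symm (D.isEnd h) (E.isEnd h')).elim
  · exact (not_end_end e (D.isEnd h') (E.isEnd h)).elim
  · cases emb_injective (by decide) e
    rw [E.in_unique h h']

/-- Outer starting points have no incoming string, and an outgoing one. -/
theorem stack_start {D : Diagram u v} {E : Diagram v w} {p : Pt} (hp : IsStart u w p) :
    (∃ y, stack D E (emb 0 2 p) y) ∧ ∀ y, ¬ stack D E y (emb 0 2 p) := by
  constructor
  · cases p with
    | up i =>
      obtain ⟨q, hq⟩ := D.exists_out (p := .up i) hp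
      exact ⟨_, .inl ⟨_, q, hq, rfl, rfl⟩⟩
    | lo i =>
      obtain ⟨q, hq⟩ := E.exists_out (p := .lo i) hp
      exact ⟨_, .inr ⟨_, q, hq, rfl, rfl⟩⟩
  · rintro y (⟨a, b, h, -, e⟩ | ⟨a, b, h, -, e⟩)
    · have := D.isEnd h
      cases p <;> cases b <;> simp_all [IsStart, IsEnd, emb]
    · have := E.isEnd h
      cases p <;> cases b <;> simp_all [IsStart, IsEnd, emb]

theorem stack_end {D : Diagram u v} {E : Diagram v w} {p : Pt} (hp : IsEnd u w p) :
    (∃ y, stack D E y (emb 0 2 p)) ∧ ∀ y, ¬ stack D E (emb 0 2 p) y := by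
  constructor
  · cases p with
    | up i =>
      obtain ⟨q, hq⟩ := D.exists_in (q := .up i) hp
      exact ⟨_, .inl ⟨q, _, hq, rfl, rfl⟩⟩
    | lo i =>
      obtain ⟨q, hq⟩ := E.exists_in (q := .lo i) hp
      exact ⟨_, .inr ⟨q, _, hq, rfl, rfl⟩⟩
  · rintro y (⟨a, b, h, e, -⟩ | ⟨a, b, h, e, -⟩)
    · have := D.isStart h
      cases p <;> cases a <;> simp_all [IsStart, IsEnd, emb]
    · have := E.isStart h
      cases p <;> cases a <;> simp_all [IsStart, IsEnd, emb]

/-- The source of a string is an outer starting point, or an inner point with incoming string. -/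
theorem stack_source {D : Diagram u v} {E : Diagram v w} {x y : ℕ × ℕ} (h : stack D E x y) :
    (∃ p, IsStart u w p ∧ emb 0 2 p = x) ∨ (x.1 = 1 ∧ ∃ z, stack D E z x) := by
  rcases h with ⟨p, q, h, rfl, rfl⟩ | ⟨p, q, h, rfl, rfl⟩
  · cases p with
    | up i => exact .inl ⟨.up i, D.isStart h, rfl⟩
    | lo i =>
      obtain ⟨z, hz⟩ := E.exists_in (q := .up i) (D.isStart h)
      exact .inr ⟨rfl, _, .inr ⟨z, _, hz, rfl, rfl⟩⟩
  · cases p with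
    | lo i => exact .inl ⟨.lo i, E.isStart h, rfl⟩
    | up i =>
      obtain ⟨z, hz⟩ := D.exists_in (q := .lo i) (E.isStart h)
      exact .inr ⟨rfl, _, .inl ⟨z, _, hz, rfl, rfl⟩⟩

theorem stack_target {D : Diagram u v} {E : Diagram v w} {x y : ℕ × ℕ} (h : stack D E x y) :
    (∃ p, IsEnd u w p ∧ emb 0 2 p = y) ∨ (y.1 = 1 ∧ ∃ z, stack D E y z) := by
  rcases h with ⟨p, q, h, rfl, rfl⟩ | ⟨p, q, h, rfl, rfl⟩
  · cases q with
    | up i => exact .inl ⟨.up i, D.isEnd h, rfl⟩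
    | lo i =>
      obtain ⟨z, hz⟩ := E.exists_out (p := .up i) (D.isEnd h)
      exact .inr ⟨rfl, _, .inr ⟨_, z, hz, rfl, rfl⟩⟩
  · cases q with
    | lo i => exact .inl ⟨.lo i, E.isEnd h, rfl⟩
    | up i =>
      obtain ⟨z, hz⟩ := D.exists_out (p := .lo i) (E.isEnd h)
      exact .inr ⟨rfl, _, .inl ⟨_, z, hz, rfl, rfl⟩⟩

theorem place_finite (a b : ℕ) (D : Diagram u v) : {y | ∃ x, place a b D.arc x y}.Finite := by
  refine Set.Finite.subset (((Set.finite_Iio u.length).image fun i => (a, i)).union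
    ((Set.finite_Iio v.length).image fun i => (b, i))) ?_
  rintro _ ⟨_, p, q, h, rfl, rfl⟩
  have := D.isEnd h
  cases q with
  | up i => exact .inl ⟨i, (List.getElem?_eq_some_iff.1 this).1, rfl⟩
  | lo i => exact .inr ⟨i, (List.getElem?_eq_some_iff.1 this).1, rfl⟩

theorem stack_finite (D : Diagram u v) (E : Diagram v w) : {y | ∃ x, stack D E x y}.Finite := by
  refine ((place_finite 0 1 D).union (place_finite 1 2 E)).subset ?_
  rintro y ⟨x, h | h⟩
  · exact .inl ⟨x, h⟩
  · exact .inr ⟨x, h⟩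

theorem stack_swap_finite (D : Diagram u v) (E : Diagram v w) :
    {y | ∃ x, stack D E y x}.Finite := by
  have : {y | ∃ p, IsStart u w p ∧ emb 0 2 p = y}.Finite := by
    refine Set.Finite.subset (((Set.finite_Iio u.length).image fun i => (0, i)).union
      ((Set.finite_Iio w.length).image fun i => (2, i))) ?_
    rintro _ ⟨p, h, rfl⟩
    cases p with
    | up i => exact .inl ⟨i, (List.getElem?_eq_some_iff.1 h).1, rfl⟩
    | lo i => exact .inr ⟨i, (List.getElem?_eq_some_iff.1 h).1, rfl⟩
  refine (this.union (stack_finite D E)).subset ?_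
  rintro y ⟨x, h⟩
  rcases stack_source h with h | ⟨-, h⟩
  · exact .inl h
  · exact .inr h

/-- `p` lies on the line of `x`, strictly to the left of `x`. -/
def LeftOf (p x : ℕ × ℕ) : Prop := p.1 = x.1 ∧ p.2 < x.2

open Classical in
/-- `LeftOf` as a number modulo 2. -/
noncomputable def side (p x : ℕ × ℕ) : ZMod 2 := if LeftOf p x then 1 else 0

theorem side_add (p q r s x y z t : ℕ × ℕ) : side p x + side q y = side r z + side s t ↔
    ((LeftOf p x ↔ LeftOf q y) ↔ (LeftOf r z ↔ LeftOf s t)) := by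
  unfold side
  by_cases h1 : LeftOf p x <;> by_cases h2 : LeftOf q y <;> by_cases h3 : LeftOf r z <;>
    by_cases h4 : LeftOf s t <;> simp only [h1, h2, h3, h4, if_true, if_false] <;> decide

theorem parity_of_noncrossing {a b : ℕ} (hab : a ≠ b) {p q p' q' : Pt}
    (h1 : p ≠ p') (h2 : p ≠ q') (h3 : q ≠ p') (h4 : q ≠ q')
    (h : ∀ s t s' t', (s = p ∧ t = q ∨ s = q ∧ t = p) → (s' = p' ∧ t' = q' ∨ s' = q' ∧ t' = p') →
      (s.key < s'.key → s'.key < t.key → ¬ t.key < t'.key) ∧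
      (s'.key < s.key → s.key < t'.key → ¬ t'.key < t.key)) :
    side (emb a b p) (emb a b p') + side (emb a b q) (emb a b p') =
      side (emb a b p) (emb a b q') + side (emb a b q) (emb a b q') := by
  have g1 := h p q p' q' (by simp) (by simp)
  have g2 := h p q q' p' (by simp) (by simp)
  have g3 := h q p p' q' (by simp) (by simp)
  have g4 := h q p q' p' (by simp) (by simp)
  clear h
  have hba := hab.symm
  rw [side_add]
  cases p <;> cases q <;> cases p' <;> cases q' <;>
    simp only [Pt.key, emb, LeftOf, hab, hba, true_and, false_and, ne_eq, Pt.up.injEq,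
      Pt.lo.injEq, reduceCtorEq, not_false_eq_true, iff_false, false_iff, iff_self, iff_true, true_iff] at * <;> omega

theorem noncrossing_of_parity {a b : ℕ} (hab : a ≠ b) {p q p' q' : Pt}
    (h : side (emb a b p) (emb a b p') + side (emb a b q) (emb a b p') =
      side (emb a b p) (emb a b q') + side (emb a b q) (emb a b q'))
    (h1 : p.key < p'.key) (h2 : p'.key < q.key) : ¬ q.key < q'.key := by
  intro h3
  have hba := hab.symm
  rw [side_add] at h
  cases p <;> cases q <;> cases p' <;> cases q' <;>
    simp only [Pt.key, emb, LeftOf, hab, hba, true_and, false_and, iff_false, false_iff, iff_self, iff_true, true_iff] at * <;> omega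


theorem arc_parity {a b : ℕ} (C : Diagram u v) (hab : a ≠ b) (γ : Finset (ℕ × ℕ))
    (hγ : ∀ x y, place a b C.arc x y → (x ∈ γ ↔ y ∈ γ))
    (hs : ∀ x ∈ γ, x.1 = a ∨ x.1 = b → ∃ y, place a b C.arc x y ∨ place a b C.arc y x)
    {x y : ℕ × ℕ} (hxy : place a b C.arc x y) (hx : x ∉ γ) :
    ∑ z ∈ γ, side z x = ∑ z ∈ γ, side z y := by
  have two : ∀ t : ZMod 2, t + t = 0 := by decide
  have heq : ∀ s t : ZMod 2, s + t = 0 → s = t := by decide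
  have hy : y ∉ γ := fun h => hx ((hγ _ _ hxy).2 h)
  apply heq
  rw [← Finset.sum_add_distrib]
  classical
  rw [← Finset.sum_filter_add_sum_filter_not γ (fun z => z.1 = a ∨ z.1 = b)]
  have z2 : ∑ z ∈ γ with ¬ (z.1 = a ∨ z.1 = b), (side z x + side z y) = 0 := by
    apply Finset.sum_eq_zero
    intro z hz
    have hz := (Finset.mem_filter.1 hz).2
    obtain ⟨p, q, -, rfl, rfl⟩ := hxy
    push Not at hz
    have h1 : ∀ p, ¬ LeftOf z (emb a b p) := by
      rintro (i | i) ⟨h, -⟩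
      · exact hz.1 h
      · exact hz.2 h
    simp [side, h1]
  rw [z2, add_zero]
  have hm : ∀ z ∈ γ.filter (fun z => z.1 = a ∨ z.1 = b),
      ∃ z', place a b C.arc z z' ∨ place a b C.arc z' z := by
    intro z hz
    exact hs z (Finset.mem_filter.1 hz).1 (Finset.mem_filter.1 hz).2
  choose m hm using hm
  have hline : ∀ z z', place a b C.arc z z' →
      (z.1 = a ∨ z.1 = b) ∧ (z'.1 = a ∨ z'.1 = b) := by
    rintro _ _ ⟨p, q, -, rfl, rfl⟩
    cases p <;> cases q <;> simp [emb]
  have huniq : ∀ z z' z'', (place a b C.arc z z' ∨ place a b C.arc z' z) →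
      (place a b C.arc z z'' ∨ place a b C.arc z'' z) → z' = z'' := by
    rintro z z' z'' (⟨p, q, h, rfl, rfl⟩ | ⟨p, q, h, rfl, rfl⟩)
      (⟨p', q', h', e, rfl⟩ | ⟨p', q', h', rfl, e⟩) <;> cases emb_injective hab e
    · rw [C.out_unique h h']
    · exact (not_start_end (C.isStart h) (C.isEnd h')).elim
    · exact (not_start_end (C.isStart h') (C.isEnd h)).elim
    · rw [C.in_unique h h']
  refine Finset.sum_involution m ?_ ?_ ?_ ?_
  · intro z hz
    have hzγ := (Finset.mem_filter.1 hz).1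
    have hmγ : m z hz ∈ γ := by
      rcases hm z hz with h | h
      · exact (hγ _ _ h).1 hzγ
      · exact (hγ _ _ h).2 hzγ
    have hmz := hm z hz
    generalize m z hz = z' at hmz hmγ
    have goal : side z x + side z' x = side z y + side z' y := by
      obtain ⟨p', q', h', rfl, rfl⟩ := hxy
      obtain ⟨p, q, h, rfl, rfl⟩ : ∃ p q, (C.arc p q ∨ C.arc q p) ∧ emb a b p = z ∧
          emb a b q = z' := by
        rcases hmz with ⟨p, q, h, rfl, rfl⟩ | ⟨p, q, h, rfl, rfl⟩
        · exact ⟨p, q, .inl h, rfl, rfl⟩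
        · exact ⟨q, p, .inr h, rfl, rfl⟩
      refine parity_of_noncrossing hab ?_ ?_ ?_ ?_ ?_
      · rintro rfl; exact hx hzγ
      · rintro rfl; exact hy hzγ
      · rintro rfl; exact hx hmγ
      · rintro rfl; exact hy hmγ
      · intro s t s' t' h1 h2
        have h1 : C.arc s t ∨ C.arc t s := by
          rcases h1 with ⟨rfl, rfl⟩ | ⟨rfl, rfl⟩
          · exact h
          · exact h.symm
        have h2 : C.arc s' t' ∨ C.arc t' s' := by
          rcases h2 with ⟨rfl, rfl⟩ | ⟨rfl, rfl⟩
          · exact .inl h'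
          · exact .inr h'
        exact ⟨C.noncrossing h1 h2, C.noncrossing h2 h1⟩
    have := two (side z y + side z' y)
    rw [add_add_add_comm, goal, ← add_add_add_comm, add_add_add_comm]
    rw [add_add_add_comm] at this
    first | exact this | (rw [← this]; ring)
  · intro z hz _ he
    have := hm z hz
    rw [he, or_self] at this
    obtain ⟨p, q, h, rfl, e⟩ := this
    cases emb_injective hab e
    exact not_start_end (C.isStart h) (C.isEnd h)
  · intro z hz
    rw [Finset.mem_filter]
    have hzγ := (Finset.mem_filter.1 hz).1
    rcases hm z hz with h | h
    · exact ⟨(hγ _ _ h).1 hzγ, (hline _ _ h).2⟩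
    · exact ⟨(hγ _ _ h).2 hzγ, (hline _ _ h).1⟩
  · intro z hz
    exact huniq (m z hz) _ _ (hm _ _) (hm z hz).symm

theorem path_parity {D : Diagram u v} {E : Diagram v w} {p q p' q' : Pt}
    (hp : IsStart u w p) (hq : IsEnd u w q) (hp' : IsStart u w p')
    (h : TransGen (stack D E) (emb 0 2 p) (emb 0 2 q))
    (h' : TransGen (stack D E) (emb 0 2 p') (emb 0 2 q')) (hne : p ≠ p') :
    side (emb 0 2 p) (emb 0 2 p') + side (emb 0 2 q) (emb 0 2 p') =
      side (emb 0 2 p) (emb 0 2 q') + side (emb 0 2 q) (emb 0 2 q') := by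
  have ru : Relator.RightUnique (stack D E) := fun _ _ _ h h' => stack_out h h'
  set i := emb 0 2 p with hi
  set j := emb 0 2 q with hj
  have hfin : {y | ReflTransGen (stack D E) i y ∧ ReflTransGen (stack D E) y j}.Finite := by
    refine ((stack_finite D E).insert i).subset ?_
    rintro y ⟨h, -⟩
    rcases ReflTransGen.cases_tail h with rfl | ⟨z, -, h⟩
    · exact Set.mem_insert _ _
    · exact .inr ⟨z, h⟩
  set γ := hfin.toFinset with hγdef
  have mem : ∀ y, y ∈ γ ↔ ReflTransGen (stack D E) i y ∧ ReflTransGen (stack D E) y j := by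
    intro y; simp [hγdef]
  have hinv : ∀ x y, stack D E x y → (x ∈ γ ↔ y ∈ γ) := by
    intro x y hxy
    rw [mem, mem]
    constructor
    · rintro ⟨h1, h2⟩
      refine ⟨h1.tail hxy, ?_⟩
      rcases ReflTransGen.cases_head h2 with rfl | ⟨z, h3, h4⟩
      · exact ((stack_end hq).2 _ hxy).elim
      · rwa [stack_out hxy h3]
    · rintro ⟨h1, h2⟩
      refine ⟨?_, h2.head hxy⟩
      rcases ReflTransGen.cases_tail h1 with rfl | ⟨z, h3, h4⟩
      · exact ((stack_start hp).2 _ hxy).elim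
      · rwa [stack_in hxy h4]
  have hstart : ∀ s, IsStart u w s → emb 0 2 s ∈ γ → s = p := by
    intro s hs hm
    rcases ReflTransGen.cases_tail ((mem _).1 hm).1 with e | ⟨z, -, h4⟩
    · exact emb_injective (by decide) e
    · exact ((stack_start hs).2 _ h4).elim
  have hend : ∀ s, IsEnd u w s → emb 0 2 s ∈ γ → s = q := by
    intro s hs hm
    rcases ReflTransGen.cases_head ((mem _).1 hm).2 with e | ⟨z, h4, -⟩
    · exact emb_injective (by decide) e
    · exact ((stack_end hs).2 _ h4).elim
  have hnb : ∀ x ∈ γ, (∃ y, stack D E x y) ∨ (∃ y, stack D E y x) := by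
    intro x hx
    rcases ReflTransGen.cases_tail ((mem _).1 hx).1 with rfl | ⟨z, -, h4⟩
    · exact .inl (stack_start hp).1
    · exact .inr ⟨z, h4⟩
  -- the colouring is constant along strings off the path
  have step : ∀ x y, stack D E x y → x ∉ γ → ∑ z ∈ γ, side z x = ∑ z ∈ γ, side z y := by
    rintro x y (hxy | hxy) hx
    · refine arc_parity D (by decide) γ (fun x y h => hinv x y (.inl h)) ?_ hxy hx
      intro z hz hl
      have hz' : (∃ y, place 0 1 D.arc z y ∨ place 0 1 D.arc y z) ∨
          (∃ y, place 1 2 E.arc z y ∨ place 1 2 E.arc y z) := by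
        rcases hnb z hz with ⟨y, h | h⟩ | ⟨y, h | h⟩
        · exact .inl ⟨y, .inl h⟩
        · exact .inr ⟨y, .inl h⟩
        · exact .inl ⟨y, .inr h⟩
        · exact .inr ⟨y, .inr h⟩
      rcases hz' with h | ⟨y, ⟨a, b, h, rfl, rfl⟩ | ⟨a, b, h, rfl, rfl⟩⟩
      · exact h
      · cases a with
        | lo k => simp [emb] at hl
        | up k =>
          obtain ⟨t, ht⟩ := D.exists_in (q := .lo k) (E.isStart h)
          exact ⟨_, .inr ⟨t, _, ht, rfl, rfl⟩⟩
      · cases b with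
        | lo k => simp [emb] at hl
        | up k =>
          obtain ⟨t, ht⟩ := D.exists_out (p := .lo k) (E.isEnd h)
          exact ⟨_, .inl ⟨_, t, ht, rfl, rfl⟩⟩
    · refine arc_parity E (by decide) γ (fun x y h => hinv x y (.inr h)) ?_ hxy hx
      intro z hz hl
      have hz' : (∃ y, place 0 1 D.arc z y ∨ place 0 1 D.arc y z) ∨
          (∃ y, place 1 2 E.arc z y ∨ place 1 2 E.arc y z) := by
        rcases hnb z hz with ⟨y, h | h⟩ | ⟨y, h | h⟩
        · exact .inl ⟨y, .inl h⟩
        · exact .inr ⟨y, .inl h⟩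
        · exact .inl ⟨y, .inr h⟩
        · exact .inr ⟨y, .inr h⟩
      rcases hz' with ⟨y, ⟨a, b, h, rfl, rfl⟩ | ⟨a, b, h, rfl, rfl⟩⟩ | h
      · cases a with
        | up k => simp [emb] at hl
        | lo k =>
          obtain ⟨t, ht⟩ := E.exists_in (q := .up k) (D.isStart h)
          exact ⟨_, .inr ⟨t, _, ht, rfl, rfl⟩⟩
      · cases b with
        | up k => simp [emb] at hl
        | lo k =>
          obtain ⟨t, ht⟩ := E.exists_out (p := .up k) (D.isEnd h)
          exact ⟨_, .inl ⟨_, t, ht, rfl, rfl⟩⟩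
      · exact h
  have hp'γ : emb 0 2 p' ∉ γ := fun hm => hne (hstart p' hp' hm).symm
  have walk : ∀ y, TransGen (stack D E) (emb 0 2 p') y →
      y ∉ γ ∧ ∑ z ∈ γ, side z (emb 0 2 p') = ∑ z ∈ γ, side z y := by
    intro y hy
    induction hy with
    | single h => exact ⟨fun hm => hp'γ ((hinv _ _ h).2 hm), step _ _ h hp'γ⟩
    | tail _ h ih => exact ⟨fun hm => ih.1 ((hinv _ _ h).2 hm), ih.2.trans (step _ _ h ih.1)⟩
  have hpq : i ≠ j := by
    intro e
    cases emb_injective (by decide) e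
    exact not_start_end hp hq
  have sum_outer : ∀ s, ∑ z ∈ γ, side z (emb 0 2 s) = side i (emb 0 2 s) + side j (emb 0 2 s) := by
    intro s
    classical
    rw [← Finset.sum_pair (f := fun z => side z (emb 0 2 s)) hpq]
    symm
    apply Finset.sum_subset
    · intro z hz
      rw [Finset.mem_insert, Finset.mem_singleton] at hz
      rw [mem]
      rcases hz with rfl | rfl
      · exact ⟨.refl, h.to_reflTransGen⟩
      · exact ⟨h.to_reflTransGen, .refl⟩
    · intro z hz hz'
      have hl : z.1 = 1 := by
        rcases hnb z hz with ⟨y, hy⟩ | ⟨y, hy⟩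
        · rcases stack_source hy with ⟨t, ht, rfl⟩ | h
          · cases hstart t ht hz
            simp [hi] at hz'
          · exact h.1
        · rcases stack_target hy with ⟨t, ht, rfl⟩ | h
          · cases hend t ht hz
            simp [hj] at hz'
          · exact h.1
      have : ¬ LeftOf z (emb 0 2 s) := by
        rintro ⟨h, -⟩
        rw [hl] at h
        cases s <;> simp [emb] at h
      simp [side, this]
  rw [← sum_outer, ← sum_outer]
  exact (walk _ h').2

theorem isStart_of_path {D : Diagram u v} {E : Diagram v w} {p q : Pt}
    (h : TransGen (stack D E) (emb 0 2 p) (emb 0 2 q)) : IsStart u w p := by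
  obtain ⟨y, h, -⟩ := TransGen.head'_iff.1 h
  rcases stack_source h with ⟨t, ht, e⟩ | ⟨h, -⟩
  · cases emb_injective (by decide) e
    exact ht
  · cases p <;> simp [emb] at h

theorem isEnd_of_path {D : Diagram u v} {E : Diagram v w} {p q : Pt}
    (h : TransGen (stack D E) (emb 0 2 p) (emb 0 2 q)) : IsEnd u w q := by
  obtain ⟨y, -, h⟩ := TransGen.tail'_iff.1 h
  rcases stack_target h with ⟨t, ht, e⟩ | ⟨h, -⟩
  · cases emb_injective (by decide) e
    exact ht
  · cases q <;> simp [emb] at h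

/-- Composition of diagrams: concatenate and follow the strings through the middle line, dropping
the closed loops. -/
def Diagram.comp (D : Diagram u v) (E : Diagram v w) : Diagram u w where
  arc p q := TransGen (stack D E) (emb 0 2 p) (emb 0 2 q)
  isStart := isStart_of_path
  isEnd := isEnd_of_path
  exists_out {p} hp := by
    obtain ⟨y, h, hy⟩ := exists_terminal (r := stack D E) (fun _ _ _ => stack_in)
      (stack_finite D E) (stack_start hp).2
    rcases reflTransGen_iff_eq_or_transGen.1 h with rfl | h
    · obtain ⟨z, hz⟩ := (stack_start (D := D) (E := E) hp).1
      exact (hy _ hz).elim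
    · obtain ⟨x, -, h'⟩ := TransGen.tail'_iff.1 h
      rcases stack_target h' with ⟨t, ht, rfl⟩ | ⟨-, z, hz⟩
      · exact ⟨t, h⟩
      · exact (hy _ hz).elim
  exists_in {p} hp := by
    obtain ⟨y, h, hy⟩ := exists_terminal (r := Function.swap (stack D E)) (fun _ _ _ => stack_out)
      (stack_swap_finite D E) (stack_end hp).2
    rcases reflTransGen_iff_eq_or_transGen.1 h with rfl | h
    · obtain ⟨z, hz⟩ := (stack_end (D := D) (E := E) hp).1
      exact (hy _ hz).elim
    · rw [transGen_swap] at h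
      obtain ⟨x, h', -⟩ := TransGen.head'_iff.1 h
      rcases stack_source h' with ⟨t, ht, rfl⟩ | ⟨-, z, hz⟩
      · exact ⟨t, h⟩
      · exact (hy _ hz).elim
  out_unique {p q q'} h h' := by
    have ru : Relator.RightUnique (stack D E) := fun _ _ _ h h' => stack_out h h'
    rcases ReflTransGen.total_of_right_unique ru h.to_reflTransGen h'.to_reflTransGen with g | g <;>
    rcases ReflTransGen.cases_head g with e | ⟨z, hz, -⟩
    · exact emb_injective (by decide) e
    · exact ((stack_end (isEnd_of_path h)).2 _ hz).elim
    · exact (emb_injective (by decide) e).symm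
    · exact ((stack_end (isEnd_of_path h')).2 _ hz).elim
  in_unique {p p' q} h h' := by
    have ru : Relator.RightUnique (Function.swap (stack D E)) := fun _ _ _ h h' => stack_in h h'
    rcases ReflTransGen.total_of_right_unique ru
      (reflTransGen_swap.2 h.to_reflTransGen) (reflTransGen_swap.2 h'.to_reflTransGen) with g | g <;>
    rcases ReflTransGen.cases_head g with e | ⟨z, hz, -⟩
    · exact emb_injective (by decide) e
    · exact ((stack_start (isStart_of_path h)).2 _ hz).elim
    · exact (emb_injective (by decide) e).symm
    · exact ((stack_start (isStart_of_path h')).2 _ hz).elim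
  noncrossing {p q p' q'} h h' h1 h2 h3 := by
    have key : ∀ {s t s' t' : Pt}, TransGen (stack D E) (emb 0 2 s) (emb 0 2 t) →
        TransGen (stack D E) (emb 0 2 s') (emb 0 2 t') → s ≠ s' →
        side (emb 0 2 s) (emb 0 2 s') + side (emb 0 2 t) (emb 0 2 s') =
          side (emb 0 2 s) (emb 0 2 t') + side (emb 0 2 t) (emb 0 2 t') := fun g g' hne =>
      path_parity (isStart_of_path g) (isEnd_of_path g) (isStart_of_path g') g g' hne
    refine noncrossing_of_parity (a := 0) (b := 2) (by decide) ?_ h1 h2 h3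
    rcases h with h | h <;> rcases h' with h' | h'
    · exact key h h' (by rintro rfl; omega)
    · exact (key h h' (by rintro rfl; omega)).symm
    · rw [add_comm, key h h' (by rintro rfl; omega), add_comm]
    · rw [add_comm, ← key h h' (by rintro rfl; omega), add_comm]

theorem Diagram.eq_of_le {D D' : Diagram u v} (h : ∀ p q, D.arc p q → D'.arc p q) : D = D' := by
  ext p q
  refine ⟨h p q, fun h' => ?_⟩
  obtain ⟨r, hr⟩ := D.exists_out (D'.isStart h')
  rwa [D'.out_unique h' (h _ _ hr)]

/-- The identity diagram: vertical strings. -/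
def Diagram.id (u : List Letter) : Diagram u u where
  arc p q := ∃ i, (u[i]? = some .X ∧ p = .up i ∧ q = .lo i) ∨
    (u[i]? = some .Xstar ∧ p = .lo i ∧ q = .up i)
  isStart := by
    rintro p q ⟨i, ⟨h, rfl, rfl⟩ | ⟨h, rfl, rfl⟩⟩ <;> exact h
  isEnd := by
    rintro p q ⟨i, ⟨h, rfl, rfl⟩ | ⟨h, rfl, rfl⟩⟩ <;> exact h
  exists_out := by
    rintro (i | i) h
    · exact ⟨_, i, .inl ⟨h, rfl, rfl⟩⟩
    · exact ⟨_, i, .inr ⟨h, rfl, rfl⟩⟩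
  exists_in := by
    rintro (i | i) h
    · exact ⟨_, i, .inr ⟨h, rfl, rfl⟩⟩
    · exact ⟨_, i, .inl ⟨h, rfl, rfl⟩⟩
  out_unique := by
    rintro p q q' ⟨i, ⟨h, rfl, rfl⟩ | ⟨h, rfl, rfl⟩⟩ ⟨j, ⟨h', e, rfl⟩ | ⟨h', e, rfl⟩⟩ <;>
      cases e <;> rfl
  in_unique := by
    rintro p q q' ⟨i, ⟨h, rfl, rfl⟩ | ⟨h, rfl, rfl⟩⟩ ⟨j, ⟨h', rfl, e⟩ | ⟨h', rfl, e⟩⟩ <;>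
      cases e <;> rfl
  noncrossing := by
    rintro p q p' q' (⟨i, ⟨h, rfl, rfl⟩ | ⟨h, rfl, rfl⟩⟩ | ⟨i, ⟨h, rfl, rfl⟩ | ⟨h, rfl, rfl⟩⟩)
      (⟨j, ⟨h', rfl, rfl⟩ | ⟨h', rfl, rfl⟩⟩ | ⟨j, ⟨h', rfl, rfl⟩ | ⟨h', rfl, rfl⟩⟩) <;>
      simp only [Pt.key] <;> omega

/-- A closed loop of a concatenation does not meet the outer lines, and alternates. -/
theorem cycle_mid {D : Diagram u v} {E : Diagram v w} {x : ℕ × ℕ}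
    (h : TransGen (stack D E) x x) : x.1 = 1 := by
  obtain ⟨y, h1, -⟩ := TransGen.head'_iff.1 h
  obtain ⟨z, -, h2⟩ := TransGen.tail'_iff.1 h
  rcases stack_source h1 with ⟨p, hp, rfl⟩ | h1
  · exact ((stack_start hp).2 _ h2).elim
  · exact h1.1

theorem cycle_next {D : Diagram u v} {E : Diagram v w} {x : ℕ × ℕ}
    (h : TransGen (stack D E) x x) : ∃ y, stack D E x y ∧ TransGen (stack D E) y y := by
  obtain ⟨y, h1, h2⟩ := TransGen.head'_iff.1 h
  exact ⟨y, h1, TransGen.tail' h2 h1⟩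

/-- Every closed loop has a string of the upper diagram, turning back to the middle line. -/
theorem cycle_upper {D : Diagram u v} {E : Diagram v w} {x : ℕ × ℕ}
    (h : TransGen (stack D E) x x) : ∃ i j, D.arc (.lo i) (.lo j) := by
  have aux : ∀ {x y}, TransGen (stack D E) x x → TransGen (stack D E) y y →
      place 0 1 D.arc x y → ∃ i j, D.arc (.lo i) (.lo j) := by
    rintro _ _ hx hy ⟨p, q, h, rfl, rfl⟩
    have h1 := cycle_mid hx
    have h2 := cycle_mid hy
    cases p <;> cases q <;> simp [emb] at h1 h2
    exact ⟨_, _, h⟩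
  obtain ⟨y, hy, hyc⟩ := cycle_next h
  rcases hy with hy | hy
  · exact aux h hyc hy
  · obtain ⟨z, hz, hzc⟩ := cycle_next hyc
    rcases hz with hz | hz
    · exact aux hyc hzc hz
    · obtain ⟨p, q, h1, -, rfl⟩ := hy
      obtain ⟨p', q', h2, e, -⟩ := hz
      cases emb_injective (by decide) e
      exact (not_start_end (E.isStart h2) (E.isEnd h1)).elim

theorem cycle_lower {D : Diagram u v} {E : Diagram v w} {x : ℕ × ℕ}
    (h : TransGen (stack D E) x x) : ∃ i j, E.arc (.up i) (.up j) := by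
  have aux : ∀ {x y}, TransGen (stack D E) x x → TransGen (stack D E) y y →
      place 1 2 E.arc x y → ∃ i j, E.arc (.up i) (.up j) := by
    rintro _ _ hx hy ⟨p, q, h, rfl, rfl⟩
    have h1 := cycle_mid hx
    have h2 := cycle_mid hy
    cases p <;> cases q <;> simp [emb] at h1 h2
    exact ⟨_, _, h⟩
  obtain ⟨y, hy, hyc⟩ := cycle_next h
  rcases hy with hy | hy
  · obtain ⟨z, hz, hzc⟩ := cycle_next hyc
    rcases hz with hz | hz
    · obtain ⟨p, q, h1, -, rfl⟩ := hy
      obtain ⟨p', q', h2, e, -⟩ := hz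
      cases emb_injective (by decide) e
      exact (not_start_end (D.isStart h2) (D.isEnd h1)).elim
    · exact aux hyc hzc hz
  · exact aux h hyc hy

theorem loops_id_left (D : Diagram u v) : loops (Diagram.id u) D = 0 := by
  have : loopSet (stack (Diagram.id u) D) = ∅ := by
    rw [Set.eq_empty_iff_forall_notMem]
    rintro c ⟨x, hx, -⟩
    obtain ⟨i, j, k, h⟩ := cycle_upper hx
    simp at h
  simp [loops, this]

theorem loops_id_right (D : Diagram u v) : loops D (Diagram.id v) = 0 := by
  have : loopSet (stack D (Diagram.id v)) = ∅ := by
    rw [Set.eq_empty_iff_forall_notMem]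
    rintro c ⟨x, hx, -⟩
    obtain ⟨i, j, k, h⟩ := cycle_lower hx
    simp at h
  simp [loops, this]

theorem id_comp (D : Diagram u v) : (Diagram.id u).comp D = D := by
  symm
  apply Diagram.eq_of_le
  intro p q h
  have h1 : stack (Diagram.id u) D (emb 1 2 p) (emb 1 2 q) := .inr ⟨p, q, h, rfl, rfl⟩
  have hp : ReflTransGen (stack (Diagram.id u) D) (emb 0 2 p) (emb 1 2 p) := by
    cases p with
    | lo i => exact .refl
    | up i => exact .single (.inl ⟨.up i, .lo i, ⟨i, .inl ⟨D.isStart h, rfl, rfl⟩⟩, rfl, rfl⟩)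
  have hq : ReflTransGen (stack (Diagram.id u) D) (emb 1 2 q) (emb 0 2 q) := by
    cases q with
    | lo i => exact .refl
    | up i => exact .single (.inl ⟨.lo i, .up i, ⟨i, .inr ⟨D.isEnd h, rfl, rfl⟩⟩, rfl, rfl⟩)
  exact (TransGen.tail' hp h1).trans_left hq

theorem comp_id (D : Diagram u v) : D.comp (Diagram.id v) = D := by
  symm
  apply Diagram.eq_of_le
  intro p q h
  have h1 : stack D (Diagram.id v) (emb 0 1 p) (emb 0 1 q) := .inl ⟨p, q, h, rfl, rfl⟩
  have hp : ReflTransGen (stack D (Diagram.id v)) (emb 0 2 p) (emb 0 1 p) := by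
    cases p with
    | up i => exact .refl
    | lo i => exact .single (.inr ⟨.lo i, .up i, ⟨i, .inr ⟨D.isStart h, rfl, rfl⟩⟩, rfl, rfl⟩)
  have hq : ReflTransGen (stack D (Diagram.id v)) (emb 0 1 q) (emb 0 2 q) := by
    cases q with
    | up i => exact .refl
    | lo i => exact .single (.inr ⟨.up i, .lo i, ⟨i, .inl ⟨D.isEnd h, rfl, rfl⟩⟩, rfl, rfl⟩)
  exact (TransGen.tail' hp h1).trans_left hq

end Composition

section Associativity
open Relation

variable {u v w t : List Letter}

/-- Renumbering of the horizontal lines. -/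
def lineMap (f : ℕ → ℕ) : ℕ × ℕ → ℕ × ℕ := Prod.map f id

theorem lineMap_injective {f : ℕ → ℕ} (hf : Function.Injective f) :
    Function.Injective (lineMap f) := hf.prodMap Function.injective_id

theorem emb_lineMap (f : ℕ → ℕ) (a b : ℕ) (p : Pt) : lineMap f (emb a b p) = emb (f a) (f b) p := by
  cases p <;> rfl

theorem map_sup {α β : Type*} (r s : α → α → Prop) (f : α → β) :
    Relation.Map (r ⊔ s) f f = Relation.Map r f f ⊔ Relation.Map s f f := by
  ext x y
  constructor
  · rintro ⟨a, b, h | h, rfl, rfl⟩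
    · exact .inl ⟨a, b, h, rfl, rfl⟩
    · exact .inr ⟨a, b, h, rfl, rfl⟩
  · rintro (⟨a, b, h, rfl, rfl⟩ | ⟨a, b, h, rfl, rfl⟩)
    · exact ⟨a, b, .inl h, rfl, rfl⟩
    · exact ⟨a, b, .inr h, rfl, rfl⟩

theorem map_place (f : ℕ → ℕ) (a b : ℕ) (r : Pt → Pt → Prop) :
    Relation.Map (place a b r) (lineMap f) (lineMap f) = place (f a) (f b) r := by
  ext x y
  constructor
  · rintro ⟨_, _, ⟨p, q, h, rfl, rfl⟩, rfl, rfl⟩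
    exact ⟨p, q, h, (emb_lineMap f a b p).symm, (emb_lineMap f a b q).symm⟩
  · rintro ⟨p, q, h, rfl, rfl⟩
    exact ⟨_, _, ⟨p, q, h, rfl, rfl⟩, emb_lineMap f a b p, emb_lineMap f a b q⟩

theorem transGen_map_apply {α β : Type*} {r : α → α → Prop} {f : α → β}
    (hf : Function.Injective f) {x y : α} :
    TransGen (Relation.Map r f f) (f x) (f y) ↔ TransGen r x y := by
  rw [transGen_map hf]
  constructor
  · rintro ⟨a, b, h, e1, e2⟩
    cases hf e1; cases hf e2
    exact h
  · intro h
    exact ⟨_, _, h, rfl, rfl⟩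

/-- Three diagrams on top of each other. -/
def stack₃ (D : Diagram u v) (E : Diagram v w) (G : Diagram w t) : ℕ × ℕ → ℕ × ℕ → Prop :=
  place 0 1 D.arc ⊔ place 1 2 E.arc ⊔ place 2 3 G.arc

theorem stack₃_finite (D : Diagram u v) (E : Diagram v w) (G : Diagram w t) :
    {y | ∃ x, stack₃ D E G x y}.Finite := by
  refine (((place_finite 0 1 D).union (place_finite 1 2 E)).union (place_finite 2 3 G)).subset ?_
  rintro y ⟨x, (h | h) | h⟩
  · exact .inl (.inl ⟨x, h⟩)
  · exact .inl (.inr ⟨x, h⟩)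
  · exact .inr ⟨x, h⟩

theorem place_not_mem {a b c : ℕ} (ha : a ≠ c) (hb : b ≠ c) {r : Pt → Pt → Prop} (x y : ℕ × ℕ)
    (h : place a b r x y) : x ∉ {z : ℕ × ℕ | z.1 = c} ∧ y ∉ {z : ℕ × ℕ | z.1 = c} := by
  obtain ⟨p, q, -, rfl, rfl⟩ := h
  cases p <;> cases q <;> exact ⟨‹_›, ‹_›⟩

theorem hide_stack (D : Diagram u v) (E : Diagram v w) :
    hide (stack D E) {z | z.1 = 1} = place 0 2 (D.comp E).arc := by
  ext x y
  constructor
  · rintro ⟨hx, hy, h⟩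
    obtain ⟨x', h1, -⟩ := TransGen.head'_iff.1 h
    obtain ⟨y', -, h2⟩ := TransGen.tail'_iff.1 h
    rcases stack_source h1 with ⟨p, -, rfl⟩ | h1
    · rcases stack_target h2 with ⟨q, -, rfl⟩ | h2
      · exact ⟨p, q, h, rfl, rfl⟩
      · exact (hy h2.1).elim
    · exact (hx h1.1).elim
  · rintro ⟨p, q, h, rfl, rfl⟩
    refine ⟨?_, ?_, h⟩
    · cases p <;> simp [emb]
    · cases q <;> simp [emb]

theorem hide_stack_succ (D : Diagram u v) (E : Diagram v w) :
    hide (place 1 2 D.arc ⊔ place 2 3 E.arc) {z | z.1 = 2} = place 1 3 (D.comp E).arc := by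
  have e : place 1 2 D.arc ⊔ place 2 3 E.arc =
      Relation.Map (stack D E) (lineMap (· + 1)) (lineMap (· + 1)) := by
    rw [stack, map_sup, map_place, map_place]
  have e' : place 1 3 (D.comp E).arc =
      Relation.Map (hide (stack D E) {z | z.1 = 1}) (lineMap (· + 1)) (lineMap (· + 1)) := by
    rw [hide_stack, map_place]
  have inj : Function.Injective (lineMap (· + 1)) := lineMap_injective (add_left_injective 1)
  rw [e, e']
  ext x y
  constructor
  · rintro ⟨hx, hy, h⟩
    obtain ⟨a, b, hab, rfl, rfl⟩ := (transGen_map inj).1 h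
    refine ⟨a, b, ⟨?_, ?_, hab⟩, rfl, rfl⟩
    · intro h; exact hx (congrArg (· + 1) h)
    · intro h; exact hy (congrArg (· + 1) h)
  · rintro ⟨a, b, ⟨hx, hy, h⟩, rfl, rfl⟩
    refine ⟨?_, ?_, (transGen_map_apply inj).2 h⟩
    · intro h; exact hx (Nat.succ_injective h)
    · intro h; exact hy (Nat.succ_injective h)

/-- The line numbers `0, 1, 2` become `0, 2, 3`. -/
def skipOne (n : ℕ) : ℕ := if n = 0 then 0 else n + 1

/-- The line numbers `0, 1, 2` become `0, 1, 3`. -/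
def skipTwo (n : ℕ) : ℕ := if n ≤ 1 then n else n + 1

theorem skipOne_injective : Function.Injective skipOne := by
  intro a b h
  unfold skipOne at h
  split_ifs at h <;> omega

theorem skipTwo_injective : Function.Injective skipTwo := by
  intro a b h
  unfold skipTwo at h
  split_ifs at h <;> omega

theorem map_skipOne (D : Diagram u v) (E : Diagram v w) (G : Diagram w t) :
    Relation.Map (stack (D.comp E) G) (lineMap skipOne) (lineMap skipOne) =
      hide (stack D E) {z | z.1 = 1} ⊔ place 2 3 G.arc := by
  rw [hide_stack, stack, map_sup, map_place, map_place]
  rfl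

theorem map_skipTwo (D : Diagram u v) (E : Diagram v w) (G : Diagram w t) :
    Relation.Map (stack D (E.comp G)) (lineMap skipTwo) (lineMap skipTwo) =
      hide (place 1 2 E.arc ⊔ place 2 3 G.arc) {z | z.1 = 2} ⊔ place 0 1 D.arc := by
  rw [hide_stack_succ, stack, map_sup, map_place, map_place, sup_comm]
  rfl

theorem stack₃_eq (D : Diagram u v) (E : Diagram v w) (G : Diagram w t) :
    stack₃ D E G = (place 1 2 E.arc ⊔ place 2 3 G.arc) ⊔ place 0 1 D.arc := by
  rw [stack₃, sup_assoc, sup_comm]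

theorem emb_not_mem {c : ℕ} (h0 : c ≠ 0) (h3 : c ≠ 3) (p : Pt) :
    emb 0 3 p ∉ {z : ℕ × ℕ | z.1 = c} := by
  cases p
  · exact h0.symm
  · exact h3.symm

theorem comp_assoc (D : Diagram u v) (E : Diagram v w) (G : Diagram w t) :
    (D.comp E).comp G = D.comp (E.comp G) := by
  ext p q
  have h1 : ((D.comp E).comp G).arc p q ↔ TransGen (stack₃ D E G) (emb 0 3 p) (emb 0 3 q) := by
    have : stack₃ D E G = stack D E ⊔ place 2 3 G.arc := rfl
    rw [this, ← transGen_hide (N := {z | z.1 = 1}) (place_not_mem (by decide) (by decide))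
      (emb_not_mem (by decide) (by decide) p) (emb_not_mem (by decide) (by decide) q),
      ← map_skipOne]
    have e := transGen_map_apply (r := stack (D.comp E) G) (lineMap_injective skipOne_injective)
      (x := emb 0 2 p) (y := emb 0 2 q)
    rw [emb_lineMap, emb_lineMap] at e
    exact e.symm
  have h2 : (D.comp (E.comp G)).arc p q ↔ TransGen (stack₃ D E G) (emb 0 3 p) (emb 0 3 q) := by
    rw [stack₃_eq, ← transGen_hide (N := {z | z.1 = 2}) (place_not_mem (by decide) (by decide))
      (emb_not_mem (by decide) (by decide) p) (emb_not_mem (by decide) (by decide) q),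
      ← map_skipTwo]
    have e := transGen_map_apply (r := stack D (E.comp G)) (lineMap_injective skipTwo_injective)
      (x := emb 0 2 p) (y := emb 0 2 q)
    rw [emb_lineMap, emb_lineMap] at e
    exact e.symm
  rw [h1, h2]

theorem loops_assoc (D : Diagram u v) (E : Diagram v w) (G : Diagram w t) :
    loops D E + loops (D.comp E) G = loops E G + loops D (E.comp G) := by
  have h1 : (loopSet (stack₃ D E G)).ncard = loops D E + loops (D.comp E) G := by
    have : stack₃ D E G = stack D E ⊔ place 2 3 G.arc := rfl
    rw [this, ncard_loopSet_hide (R := stack D E) (N := {z | z.1 = 1}) (place_not_mem (by decide) (by decide))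
      (fun _ _ _ => stack_out) (fun _ => cycle_mid) (stack₃_finite D E G), ← map_skipOne,
      ncard_loopSet_map (lineMap_injective skipOne_injective)]
    rfl
  have inj : Function.Injective (lineMap (· + 1)) := lineMap_injective (add_left_injective 1)
  have e : place 1 2 E.arc ⊔ place 2 3 G.arc =
      Relation.Map (stack E G) (lineMap (· + 1)) (lineMap (· + 1)) := by
    rw [stack, map_sup, map_place, map_place]
  have h2 : (loopSet (stack₃ D E G)).ncard = loops E G + loops D (E.comp G) := by
    rw [stack₃_eq, ncard_loopSet_hide (N := {z | z.1 = 2})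
      (place_not_mem (by decide) (by decide)) ?_ ?_ (stack₃_eq D E G ▸ stack₃_finite D E G),
      ← map_skipTwo, ncard_loopSet_map (lineMap_injective skipTwo_injective), e,
      ncard_loopSet_map inj]
    · rfl
    · rw [e]
      rintro x y z ⟨a, b, h, rfl, rfl⟩ ⟨a', b', h', e, rfl⟩
      cases inj e
      rw [stack_out h h']
    · rw [e]
      intro x hx
      obtain ⟨a, b, h, rfl, e⟩ := (transGen_map inj).1 hx
      cases inj e
      exact congrArg (· + 1) (cycle_mid h)
  rw [← h1, ← h2]

end Associativity

section Juxtaposition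
open Relation

variable {u v w u' v' w' u'' v'' : List Letter}

/-- Shift a terminal point to the right, by `m` on the upper line and by `n` on the lower line. -/
def Pt.shift (m n : ℕ) : Pt → Pt
  | .up i => .up (m + i)
  | .lo j => .lo (n + j)

theorem Pt.shift_injective (m n : ℕ) : Function.Injective (Pt.shift m n) := by
  rintro (i | i) (j | j) h <;> simp_all [Pt.shift]

theorem getElem?_shift (i : ℕ) : (u ++ v)[u.length + i]? = v[i]? := by
  rw [List.getElem?_append_right (Nat.le_add_right _ _), Nat.add_sub_cancel_left]

theorem isStart_shift {p : Pt} :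
    IsStart (u ++ u') (v ++ v') (p.shift u.length v.length) ↔ IsStart u' v' p := by
  cases p <;> simp [IsStart, Pt.shift, getElem?_shift]

theorem isEnd_shift {p : Pt} :
    IsEnd (u ++ u') (v ++ v') (p.shift u.length v.length) ↔ IsEnd u' v' p := by
  cases p <;> simp [IsEnd, Pt.shift, getElem?_shift]

/-- The terminal points of the left diagram in a juxtaposition. -/
def Pt.Inside (m n : ℕ) : Pt → Prop
  | .up i => i < m
  | .lo j => j < n

theorem not_inside_shift {m n : ℕ} {p : Pt} : ¬ (p.shift m n).Inside m n := by
  cases p <;> simp [Pt.shift, Pt.Inside]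

theorem IsStart.inside {p : Pt} (h : IsStart u v p) : p.Inside u.length v.length := by
  cases p <;> exact (List.getElem?_eq_some_iff.1 h).1

theorem IsEnd.inside {p : Pt} (h : IsEnd u v p) : p.Inside u.length v.length := by
  cases p <;> exact (List.getElem?_eq_some_iff.1 h).1

theorem isStart_append {p : Pt} (h : p.Inside u.length v.length) :
    IsStart (u ++ u') (v ++ v') p ↔ IsStart u v p := by
  cases p <;> simp only [IsStart, Pt.Inside] at * <;> rw [List.getElem?_append_left h]

theorem isEnd_append {p : Pt} (h : p.Inside u.length v.length) :
    IsEnd (u ++ u') (v ++ v') p ↔ IsEnd u v p := by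
  cases p <;> simp only [IsEnd, Pt.Inside] at * <;> rw [List.getElem?_append_left h]

theorem inside_or_shift (m n : ℕ) (p : Pt) : p.Inside m n ∨ ∃ q, p = Pt.shift m n q := by
  rcases p with i | j
  · rcases lt_or_ge i m with h | h
    · exact .inl h
    · exact .inr ⟨.up (i - m), by simp [Pt.shift, h]⟩
  · rcases lt_or_ge j n with h | h
    · exact .inl h
    · exact .inr ⟨.lo (j - n), by simp [Pt.shift, h]⟩

/-- Horizontal juxtaposition of diagrams, `D` to the left of `E`. -/
def Diagram.juxta (D : Diagram u v) (E : Diagram u' v') : Diagram (u ++ u') (v ++ v') where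
  arc := D.arc ⊔ Relation.Map E.arc (Pt.shift u.length v.length) (Pt.shift u.length v.length)
  isStart := by
    rintro p q (h | ⟨p, q, h, rfl, rfl⟩)
    · exact (isStart_append (D.isStart h).inside).2 (D.isStart h)
    · exact isStart_shift.2 (E.isStart h)
  isEnd := by
    rintro p q (h | ⟨p, q, h, rfl, rfl⟩)
    · exact (isEnd_append (D.isEnd h).inside).2 (D.isEnd h)
    · exact isEnd_shift.2 (E.isEnd h)
  exists_out := by
    intro p hp
    rcases inside_or_shift u.length v.length p with h | ⟨p, rfl⟩
    · obtain ⟨q, hq⟩ := D.exists_out ((isStart_append h).1 hp)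
      exact ⟨q, .inl hq⟩
    · obtain ⟨q, hq⟩ := E.exists_out (isStart_shift.1 hp)
      exact ⟨_, .inr ⟨p, q, hq, rfl, rfl⟩⟩
  exists_in := by
    intro p hp
    rcases inside_or_shift u.length v.length p with h | ⟨p, rfl⟩
    · obtain ⟨q, hq⟩ := D.exists_in ((isEnd_append h).1 hp)
      exact ⟨q, .inl hq⟩
    · obtain ⟨q, hq⟩ := E.exists_in (isEnd_shift.1 hp)
      exact ⟨_, .inr ⟨q, p, hq, rfl, rfl⟩⟩
  out_unique := by
    rintro p q q' (h | ⟨p, q, h, rfl, rfl⟩) (h' | ⟨p', q', h', e, rfl⟩)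
    · exact D.out_unique h h'
    · subst e; exact (not_inside_shift (D.isStart h).inside).elim
    · exact (not_inside_shift (D.isStart h').inside).elim
    · cases Pt.shift_injective _ _ e
      rw [E.out_unique h h']
  in_unique := by
    rintro p p' q (h | ⟨p, q, h, rfl, rfl⟩) (h' | ⟨p', q', h', rfl, e⟩)
    · exact D.in_unique h h'
    · subst e; exact (not_inside_shift (D.isEnd h).inside).elim
    · exact (not_inside_shift (D.isEnd h').inside).elim
    · cases Pt.shift_injective _ _ e
      rw [E.in_unique h h']
  noncrossing := by
    have out : ∀ {p q : Pt}, p.Inside u.length v.length →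
        p.key < (q.shift u.length v.length).key → 0 ≤ q.key := by
      rintro (i | i) (j | j) h h' <;> simp only [Pt.Inside, Pt.key, Pt.shift] at * <;> omega
    have out' : ∀ {p q : Pt}, p.Inside u.length v.length →
        (q.shift u.length v.length).key < p.key → q.key < 0 := by
      rintro (i | i) (j | j) h h' <;> simp only [Pt.Inside, Pt.key, Pt.shift] at * <;> omega
    have mono : ∀ {p q : Pt}, (p.shift u.length v.length).key < (q.shift u.length v.length).key →
        p.key < q.key := by
      rintro (i | i) (j | j) h <;> simp only [Pt.key, Pt.shift] at * <;> omega
    have far : ∀ {p q : Pt}, p.Inside u.length v.length → 0 ≤ q.key →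
        p.key < (q.shift u.length v.length).key := by
      rintro (i | i) (j | j) h h' <;> simp only [Pt.Inside, Pt.key, Pt.shift] at * <;> omega
    have far' : ∀ {p q : Pt}, p.Inside u.length v.length → q.key < 0 →
        (q.shift u.length v.length).key < p.key := by
      rintro (i | i) (j | j) h h' <;> simp only [Pt.Inside, Pt.key, Pt.shift] at * <;> omega
    have cD : ∀ {p q}, D.arc p q ∨ D.arc q p →
        p.Inside u.length v.length ∧ q.Inside u.length v.length := by
      rintro p q (h | h)
      · exact ⟨(D.isStart h).inside, (D.isEnd h).inside⟩
      · exact ⟨(D.isEnd h).inside, (D.isStart h).inside⟩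
    have split : ∀ {p q}, ((D.arc ⊔ Relation.Map E.arc (Pt.shift u.length v.length)
          (Pt.shift u.length v.length)) p q ∨
        (D.arc ⊔ Relation.Map E.arc (Pt.shift u.length v.length)
          (Pt.shift u.length v.length)) q p) → (D.arc p q ∨ D.arc q p) ∨
        ∃ p' q', (E.arc p' q' ∨ E.arc q' p') ∧ p = p'.shift u.length v.length ∧
          q = q'.shift u.length v.length := by
      rintro p q ((h | ⟨p, q, h, rfl, rfl⟩) | (h | ⟨p, q, h, rfl, rfl⟩))
      · exact .inl (.inl h)
      · exact .inr ⟨p, q, .inl h, rfl, rfl⟩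
      · exact .inl (.inr h)
      · exact .inr ⟨q, p, .inr h, rfl, rfl⟩
    intro p q p' q' h h' h1 h2 h3
    rcases split h with h | ⟨p, q, g, rfl, rfl⟩ <;>
    rcases split h' with h' | ⟨p', q', g', rfl, rfl⟩
    · exact D.noncrossing h h' h1 h2 h3
    · have g1 := out (cD h).1 h1
      have g2 := far (cD h).2 g1
      omega
    · have g1 := out' (cD h').1 h1
      have g2 := out (cD h').1 h2
      have g3 := far (cD h').2 g2
      omega
    · exact E.noncrossing g g' (mono h1) (mono h2) (mono h3)

theorem juxta_id : (Diagram.id u).juxta (Diagram.id v) = Diagram.id (u ++ v) := by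
  apply Diagram.eq_of_le
  rintro p q (⟨i, ⟨h, rfl, rfl⟩ | ⟨h, rfl, rfl⟩⟩ |
    ⟨_, _, ⟨i, ⟨h, rfl, rfl⟩ | ⟨h, rfl, rfl⟩⟩, rfl, rfl⟩)
  · exact ⟨i, .inl ⟨by rw [List.getElem?_append_left (List.getElem?_eq_some_iff.1 h).1, h], rfl, rfl⟩⟩
  · exact ⟨i, .inr ⟨by rw [List.getElem?_append_left (List.getElem?_eq_some_iff.1 h).1, h], rfl, rfl⟩⟩
  · exact ⟨u.length + i, .inl ⟨by rw [getElem?_shift, h], rfl, rfl⟩⟩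
  · exact ⟨u.length + i, .inr ⟨by rw [getElem?_shift, h], rfl, rfl⟩⟩

/-- Shift the points on the lines `0, 1, 2` to the right by the given amounts. -/
def shiftLines (a b c : ℕ) (x : ℕ × ℕ) : ℕ × ℕ :=
  (x.1, (if x.1 = 0 then a else if x.1 = 1 then b else c) + x.2)

theorem shiftLines_injective (a b c : ℕ) : Function.Injective (shiftLines a b c) := by
  rintro ⟨i, j⟩ ⟨i', j'⟩ h
  simp only [shiftLines, Prod.mk.injEq] at h
  obtain ⟨rfl, h⟩ := h
  simpa using h

theorem stack_juxta (D : Diagram u v) (E : Diagram v w) (D' : Diagram u' v') (E' : Diagram v' w') :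
    stack (D.juxta D') (E.juxta E') = stack D E ⊔
      Relation.Map (stack D' E') (shiftLines u.length v.length w.length)
        (shiftLines u.length v.length w.length) := by
  have e1 : ∀ p, emb 0 1 (Pt.shift u.length v.length p) =
      shiftLines u.length v.length w.length (emb 0 1 p) := by
    rintro (i | i) <;> simp [emb, Pt.shift, shiftLines]
  have e2 : ∀ p, emb 1 2 (Pt.shift v.length w.length p) =
      shiftLines u.length v.length w.length (emb 1 2 p) := by
    rintro (i | i) <;> simp [emb, Pt.shift, shiftLines]
  ext x y
  constructor
  · rintro (⟨p, q, h | ⟨p, q, h, rfl, rfl⟩, rfl, rfl⟩ | ⟨p, q, h | ⟨p, q, h, rfl, rfl⟩, rfl, rfl⟩)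
    · exact .inl (.inl ⟨p, q, h, rfl, rfl⟩)
    · exact .inr ⟨_, _, .inl ⟨p, q, h, rfl, rfl⟩, (e1 p).symm, (e1 q).symm⟩
    · exact .inl (.inr ⟨p, q, h, rfl, rfl⟩)
    · exact .inr ⟨_, _, .inr ⟨p, q, h, rfl, rfl⟩, (e2 p).symm, (e2 q).symm⟩
  · rintro ((⟨p, q, h, rfl, rfl⟩ | ⟨p, q, h, rfl, rfl⟩) |
      ⟨_, _, ⟨p, q, h, rfl, rfl⟩ | ⟨p, q, h, rfl, rfl⟩, rfl, rfl⟩)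
    · exact .inl ⟨p, q, .inl h, rfl, rfl⟩
    · exact .inr ⟨p, q, .inl h, rfl, rfl⟩
    · exact .inl ⟨_, _, .inr ⟨p, q, h, rfl, rfl⟩, e1 p, e1 q⟩
    · exact .inr ⟨_, _, .inr ⟨p, q, h, rfl, rfl⟩, e2 p, e2 q⟩

theorem juxta_comp_juxta (D : Diagram u v) (E : Diagram v w) (D' : Diagram u' v')
    (E' : Diagram v' w') :
    (D.juxta D').comp (E.juxta E') = (D.comp E).juxta (D'.comp E') := by
  symm
  apply Diagram.eq_of_le
  have e1 : ∀ p, emb 0 2 (Pt.shift u.length w.length p) =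
      shiftLines u.length v.length w.length (emb 0 2 p) := by
    rintro (i | i) <;> simp [emb, Pt.shift, shiftLines]
  rintro p q (h | ⟨p, q, h, rfl, rfl⟩)
  · change TransGen _ _ _
    rw [stack_juxta]
    exact TransGen.mono le_sup_left _ _ h
  · change TransGen _ _ _
    rw [stack_juxta, e1, e1]
    exact TransGen.mono le_sup_right _ _ ((transGen_map_apply (shiftLines_injective _ _ _)).2 h)

theorem loops_juxta (D : Diagram u v) (E : Diagram v w) (D' : Diagram u' v') (E' : Diagram v' w') :
    loops (D.juxta D') (E.juxta E') = loops D E + loops D' E' := by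
  set N : Set (ℕ × ℕ) := {x | x.2 < if x.1 = 0 then u.length else if x.1 = 1 then v.length
    else w.length} with hN
  have hsrc : ∀ x y, stack D E x y → x ∈ N := by
    rintro _ _ (⟨p, q, h, rfl, rfl⟩ | ⟨p, q, h, rfl, rfl⟩)
    · have := (D.isStart h).inside
      cases p <;> simpa [hN, emb, Pt.Inside] using this
    · have := (E.isStart h).inside
      cases p <;> simpa [hN, emb, Pt.Inside] using this
  have hout : ∀ x, shiftLines u.length v.length w.length x ∉ N := by
    intro x
    simp [hN, shiftLines]
  have hhide : hide (stack D E) N = ⊥ := by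
    ext x y
    constructor
    · rintro ⟨hx, -, h⟩
      obtain ⟨x', h1, -⟩ := TransGen.head'_iff.1 h
      exact hx (hsrc _ _ h1)
    · exact fun h => h.elim
  rw [loops, stack_juxta, ncard_loopSet_hide (N := N), hhide, bot_sup_eq,
    ncard_loopSet_map (shiftLines_injective _ _ _)]
  · rfl
  · rintro _ _ ⟨a, b, -, rfl, rfl⟩
    exact ⟨hout a, hout b⟩
  · exact fun _ _ _ => stack_out
  · intro x hx
    obtain ⟨x', h1, -⟩ := TransGen.head'_iff.1 hx
    exact hsrc _ _ h1
  · rw [← stack_juxta]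
    exact stack_finite _ _

theorem juxta_assoc_arc (D : Diagram u v) (E : Diagram u' v') (G : Diagram u'' v'') :
    ((D.juxta E).juxta G).arc = (D.juxta (E.juxta G)).arc := by
  have e : ∀ p, Pt.shift (u ++ u').length (v ++ v').length p =
      Pt.shift u.length v.length (Pt.shift u'.length v'.length p) := by
    rintro (i | i) <;> simp [Pt.shift, add_assoc]
  ext p q
  constructor
  · rintro ((h | ⟨p, q, h, rfl, rfl⟩) | ⟨p, q, h, rfl, rfl⟩)
    · exact .inl h
    · exact .inr ⟨p, q, .inl h, rfl, rfl⟩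
    · exact .inr ⟨_, _, .inr ⟨p, q, h, rfl, rfl⟩, (e p).symm, (e q).symm⟩
  · rintro (h | ⟨_, _, h | ⟨p, q, h, rfl, rfl⟩, rfl, rfl⟩)
    · exact .inl (.inl h)
    · exact .inl (.inr ⟨_, _, h, rfl, rfl⟩)
    · exact .inr ⟨p, q, h, e p, e q⟩

theorem id_nil_juxta_arc (D : Diagram u v) : ((Diagram.id []).juxta D).arc = D.arc := by
  have e : ∀ p, Pt.shift 0 0 p = p := by
    rintro (i | i) <;> simp [Pt.shift]
  ext p q
  constructor
  · rintro (⟨i, ⟨h, -⟩ | ⟨h, -⟩⟩ | ⟨p, q, h, rfl, rfl⟩)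
    · simp at h
    · simp at h
    · exact (e p).symm ▸ (e q).symm ▸ h
  · intro h
    exact .inr ⟨p, q, h, e p, e q⟩

theorem juxta_id_nil_arc (D : Diagram u v) : (D.juxta (Diagram.id [])).arc = D.arc := by
  ext p q
  constructor
  · rintro (h | ⟨_, _, ⟨i, ⟨h, -⟩ | ⟨h, -⟩⟩, rfl, rfl⟩)
    · exact h
    · simp at h
    · simp at h
  · exact .inl

end Juxtaposition

section Category

/-- Objects of the category of oriented Kauffman diagrams with loop value `d`: the words `X^w` in
the letters `X` and `X*`. -/
structure Obj (d : ℂ) where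
  word : List Letter

variable {u v w u' v' w' : List Letter}

/-- Composition of linear combinations of diagrams; each closed loop contributes a factor `d`. -/
noncomputable def compHom (d : ℂ) :
    (Diagram u v →₀ ℂ) →ₗ[ℂ] (Diagram v w →₀ ℂ) →ₗ[ℂ] (Diagram u w →₀ ℂ) :=
  Finsupp.linearCombination ℂ fun D => Finsupp.linearCombination ℂ fun E =>
    Finsupp.single (D.comp E) (d ^ loops D E)

/-- Tensor product of linear combinations of diagrams. -/
noncomputable def juxtaHom :
    (Diagram u v →₀ ℂ) →ₗ[ℂ] (Diagram u' v' →₀ ℂ) →ₗ[ℂ] (Diagram (u ++ u') (v ++ v') →₀ ℂ) :=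
  Finsupp.linearCombination ℂ fun D => Finsupp.linearCombination ℂ fun E =>
    Finsupp.single (D.juxta E) 1

theorem compHom_single (d : ℂ) (D : Diagram u v) (E : Diagram v w) (a b : ℂ) :
    compHom d (Finsupp.single D a) (Finsupp.single E b) =
      Finsupp.single (D.comp E) (a * b * d ^ loops D E) := by
  simp only [compHom, Finsupp.linearCombination_single, LinearMap.smul_apply, Finsupp.smul_single,
    smul_eq_mul, mul_assoc]

theorem juxtaHom_single (D : Diagram u v) (E : Diagram u' v') (a b : ℂ) :
    juxtaHom (Finsupp.single D a) (Finsupp.single E b) = Finsupp.single (D.juxta E) (a * b) := by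
  simp only [juxtaHom, Finsupp.linearCombination_single, LinearMap.smul_apply, Finsupp.smul_single,
    smul_eq_mul, mul_one]

/-- The category of oriented Kauffman diagrams: morphisms are formal complex linear combinations
of diagrams. -/
noncomputable instance (d : ℂ) : Category (Obj d) where
  Hom X Y := Diagram X.word Y.word →₀ ℂ
  id X := Finsupp.single (Diagram.id X.word) 1
  comp f g := compHom d f g
  id_comp {X Y} f := by
    induction f using Finsupp.induction_linear with
    | zero => exact map_zero _
    | add f g hf hg => rw [map_add, hf, hg]
    | single D a => rw [compHom_single, id_comp, loops_id_left]; simp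
  comp_id {X Y} f := by
    induction f using Finsupp.induction_linear with
    | zero => rw [map_zero]; rfl
    | add f g hf hg => rw [map_add, LinearMap.add_apply, hf, hg]
    | single D a => rw [compHom_single, comp_id, loops_id_right]; simp
  assoc {X Y Z W} f g h := by
    induction f using Finsupp.induction_linear with
    | zero => simp only [map_zero, LinearMap.zero_apply]
    | add f f' hf hf' => simp only [map_add, LinearMap.add_apply, hf, hf']
    | single D a =>
      induction g using Finsupp.induction_linear with
      | zero => simp only [map_zero, LinearMap.zero_apply]
      | add f f' hf hf' => simp only [map_add, LinearMap.add_apply, hf, hf']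
      | single E b =>
        induction h using Finsupp.induction_linear with
        | zero => simp only [map_zero]
        | add f f' hf hf' => simp only [map_add, hf, hf']
        | single G c =>
          simp only [compHom_single, comp_assoc]
          congr 1
          have := congrArg (fun n => d ^ n) (loops_assoc D E G)
          simp only [pow_add] at this
          linear_combination (a * b * c) * this

variable {d : ℂ}

/-- A linear combination of diagrams, as a morphism. -/
def ofFinsupp {X Y : Obj d} (f : Diagram X.word Y.word →₀ ℂ) : X ⟶ Y := f

noncomputable instance : Preadditive (Obj d) where
  homGroup X Y := inferInstanceAs (AddCommGroup (Diagram X.word Y.word →₀ ℂ))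
  add_comp X Y Z f f' g := by
    change compHom d (_ + _) _ = _
    rw [map_add]; rfl
  comp_add X Y Z f g g' := by
    change compHom d _ (_ + _) = _
    rw [map_add]; rfl

noncomputable instance : Linear ℂ (Obj d) where
  homModule X Y := inferInstanceAs (Module ℂ (Diagram X.word Y.word →₀ ℂ))
  smul_comp X Y Z r f g := by
    change compHom d (r • _) _ = _
    rw [map_smul]; rfl
  comp_smul X Y Z f r g := by
    change compHom d _ (r • _) = _
    rw [map_smul]; rfl

/-- The diagram `D`, as a morphism. -/
noncomputable def Diagram.hom {X Y : Obj d} (D : Diagram X.word Y.word) : X ⟶ Y :=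
  Finsupp.single D (1 : ℂ)

theorem hom_induction {X Y : Obj d} {P : (X ⟶ Y) → Prop} (f : X ⟶ Y) (h0 : P 0)
    (hadd : ∀ f g, P f → P g → P (f + g)) (hsmul : ∀ (c : ℂ) f, P f → P (c • f))
    (h1 : ∀ D : Diagram X.word Y.word, P D.hom) : P f := by
  refine Finsupp.induction_linear (motive := P) f h0 hadd fun D a => ?_
  have : (Finsupp.single D a : Diagram X.word Y.word →₀ ℂ) = a • Finsupp.single D 1 := by simp
  rw [this]
  exact hsmul a _ (h1 D)

theorem hom_comp_hom {X Y Z : Obj d} (D : Diagram X.word Y.word) (E : Diagram Y.word Z.word) :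
    (D.hom : X ⟶ Y) ≫ (E.hom : Y ⟶ Z) = d ^ loops D E • ((D.comp E).hom : X ⟶ Z) := by
  refine (compHom_single d D E 1 1).trans ?_
  rw [one_mul, one_mul]
  change _ = d ^ loops D E • (Finsupp.single (D.comp E) (1 : ℂ))
  simp

theorem hom_comp_eqToHom {X Y X' Y' : Obj d} (hX : X = X') (hY : Y = Y')
    {D : Diagram X.word Y.word} {D' : Diagram X'.word Y'.word} (h : D.arc = D'.arc) :
    (D.hom : X ⟶ Y) ≫ eqToHom hY = eqToHom hX ≫ (D'.hom : X' ⟶ Y') := by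
  subst hX hY
  have : D = D' := Diagram.ext h
  rw [this, eqToHom_refl, eqToHom_refl, Category.comp_id, Category.id_comp]

theorem obj_tensor_assoc (X Y Z : Obj d) :
    (⟨(X.word ++ Y.word) ++ Z.word⟩ : Obj d) = ⟨X.word ++ (Y.word ++ Z.word)⟩ := by
  rw [List.append_assoc]

theorem obj_tensor_nil (X : Obj d) : (⟨X.word ++ []⟩ : Obj d) = X := by
  rw [List.append_nil]

noncomputable instance : MonoidalCategoryStruct (Obj d) where
  tensorObj X Y := ⟨X.word ++ Y.word⟩
  tensorUnit := ⟨[]⟩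
  tensorHom f g := juxtaHom f g
  whiskerLeft X _ _ f := juxtaHom (Finsupp.single (Diagram.id X.word) 1) f
  whiskerRight f Y := juxtaHom f (Finsupp.single (Diagram.id Y.word) 1)
  associator X Y Z := eqToIso (obj_tensor_assoc X Y Z)
  leftUnitor X := Iso.refl X
  rightUnitor X := eqToIso (obj_tensor_nil X)

theorem add_tensorHom {X Y X' Y' : Obj d} (f f' : X ⟶ Y) (g : X' ⟶ Y') :
    (f + f') ⊗ₘ g = f ⊗ₘ g + f' ⊗ₘ g := by
  change juxtaHom (_ + _) _ = _
  rw [map_add]; rfl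

theorem tensorHom_add {X Y X' Y' : Obj d} (f : X ⟶ Y) (g g' : X' ⟶ Y') :
    f ⊗ₘ (g + g') = f ⊗ₘ g + f ⊗ₘ g' := by
  change juxtaHom _ (_ + _) = _
  rw [map_add]; rfl

theorem smul_tensorHom {X Y X' Y' : Obj d} (c : ℂ) (f : X ⟶ Y) (g : X' ⟶ Y') :
    (c • f) ⊗ₘ g = c • (f ⊗ₘ g) := by
  change juxtaHom (c • _) _ = _
  rw [map_smul]; rfl

theorem tensorHom_smul {X Y X' Y' : Obj d} (c : ℂ) (f : X ⟶ Y) (g : X' ⟶ Y') :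
    f ⊗ₘ (c • g) = c • (f ⊗ₘ g) := by
  change juxtaHom _ (c • _) = _
  rw [map_smul]; rfl

theorem zero_tensorHom {X Y X' Y' : Obj d} (g : X' ⟶ Y') : (0 : X ⟶ Y) ⊗ₘ g = 0 := by
  change juxtaHom 0 _ = _
  rw [map_zero]
  rfl

theorem tensorHom_zero {X Y X' Y' : Obj d} (f : X ⟶ Y) : f ⊗ₘ (0 : X' ⟶ Y') = 0 := by
  change juxtaHom _ 0 = _
  rw [map_zero]

theorem hom_tensorHom_hom {X Y X' Y' : Obj d} (D : Diagram X.word Y.word)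
    (E : Diagram X'.word Y'.word) :
    (D.hom : X ⟶ Y) ⊗ₘ (E.hom : X' ⟶ Y') = ((D.juxta E).hom : X ⊗ X' ⟶ Y ⊗ Y') := by
  refine (juxtaHom_single D E 1 1).trans ?_
  rw [one_mul]; rfl

theorem id_tensorHom_id' (X Y : Obj d) : 𝟙 X ⊗ₘ 𝟙 Y = 𝟙 (X ⊗ Y) := by
  refine (hom_tensorHom_hom (X := X) (Y := X) (X' := Y) (Y' := Y) _ _).trans ?_
  rw [juxta_id]; rfl

theorem tensorHom_eqToHom {X Y X' Y' : Obj d} (h : X = Y) (h' : X' = Y') :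
    eqToHom h ⊗ₘ eqToHom h' = eqToHom (congrArg₂ tensorObj h h') := by
  subst h h'
  exact id_tensorHom_id' _ _

noncomputable instance : MonoidalCategory (Obj d) := MonoidalCategory.ofTensorHom
  (id_tensorHom_id := id_tensorHom_id')
  (id_tensorHom := fun _ _ _ _ => rfl)
  (tensorHom_id := fun _ _ => rfl)
  (tensorHom_comp_tensorHom := by
    intro X₁ Y₁ Z₁ X₂ Y₂ Z₂ f₁ f₂ g₁ g₂
    induction f₁ using hom_induction with
    | h0 => simp only [zero_tensorHom, Limits.zero_comp]
    | hadd f g hf hg => simp only [add_tensorHom, Preadditive.add_comp, hf, hg]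
    | hsmul c f hf => simp only [smul_tensorHom, Linear.smul_comp, hf]
    | h1 D₁ =>
    induction f₂ using hom_induction with
    | h0 => simp only [tensorHom_zero, Limits.zero_comp]
    | hadd f g hf hg => simp only [tensorHom_add, Preadditive.add_comp, hf, hg]
    | hsmul c f hf => simp only [tensorHom_smul, Linear.smul_comp, hf]
    | h1 D₂ =>
    induction g₁ using hom_induction with
    | h0 => simp only [zero_tensorHom, Limits.comp_zero]
    | hadd f g hf hg => simp only [add_tensorHom, Preadditive.comp_add, hf, hg]
    | hsmul c f hf => simp only [smul_tensorHom, Linear.comp_smul, hf]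
    | h1 E₁ =>
    induction g₂ using hom_induction with
    | h0 => simp only [tensorHom_zero, Limits.comp_zero]
    | hadd f g hf hg => simp only [tensorHom_add, Preadditive.comp_add, hf, hg]
    | hsmul c f hf => simp only [tensorHom_smul, Linear.comp_smul, hf]
    | h1 E₂ =>
    rw [hom_comp_hom, hom_comp_hom, smul_tensorHom, tensorHom_smul, hom_tensorHom_hom,
      hom_tensorHom_hom, hom_tensorHom_hom, smul_smul, ← pow_add, ← loops_juxta,
      ← juxta_comp_juxta]
    exact hom_comp_hom (X := X₁ ⊗ X₂) (Y := Y₁ ⊗ Y₂) (Z := Z₁ ⊗ Z₂) _ _)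
  (associator_naturality := by
    intro X₁ X₂ X₃ Y₁ Y₂ Y₃ f₁ f₂ f₃
    induction f₁ using hom_induction with
    | h0 => simp only [zero_tensorHom, Limits.zero_comp, Limits.comp_zero]
    | hadd f g hf hg => simp only [add_tensorHom, Preadditive.add_comp, Preadditive.comp_add, hf, hg]
    | hsmul c f hf => simp only [smul_tensorHom, Linear.smul_comp, Linear.comp_smul, hf]
    | h1 D₁ =>
    induction f₂ using hom_induction with
    | h0 => simp only [zero_tensorHom, tensorHom_zero, Limits.zero_comp, Limits.comp_zero]
    | hadd f g hf hg =>
      simp only [add_tensorHom, tensorHom_add, Preadditive.add_comp, Preadditive.comp_add, hf, hg]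
    | hsmul c f hf =>
      simp only [smul_tensorHom, tensorHom_smul, Linear.smul_comp, Linear.comp_smul, hf]
    | h1 D₂ =>
    induction f₃ using hom_induction with
    | h0 => simp only [tensorHom_zero, Limits.zero_comp, Limits.comp_zero]
    | hadd f g hf hg => simp only [tensorHom_add, Preadditive.add_comp, Preadditive.comp_add, hf, hg]
    | hsmul c f hf => simp only [tensorHom_smul, Linear.smul_comp, Linear.comp_smul, hf]
    | h1 D₃ =>
    rw [hom_tensorHom_hom, hom_tensorHom_hom, hom_tensorHom_hom, hom_tensorHom_hom]
    exact hom_comp_eqToHom (obj_tensor_assoc X₁ X₂ X₃) (obj_tensor_assoc Y₁ Y₂ Y₃)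
      (juxta_assoc_arc D₁ D₂ D₃))
  (leftUnitor_naturality := by
    intro X Y f
    induction f using hom_induction with
    | h0 => simp only [tensorHom_zero, Limits.zero_comp, Limits.comp_zero]
    | hadd f g hf hg => simp only [tensorHom_add, Preadditive.add_comp, Preadditive.comp_add, hf, hg]
    | hsmul c f hf => simp only [tensorHom_smul, Linear.smul_comp, Linear.comp_smul, hf]
    | h1 D =>
    have e : (𝟙 (𝟙_ (Obj d)) : 𝟙_ (Obj d) ⟶ 𝟙_ (Obj d)) = (Diagram.id []).hom := rfl
    rw [e, hom_tensorHom_hom]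
    exact hom_comp_eqToHom (X := (𝟙_ (Obj d)) ⊗ X) (Y := (𝟙_ (Obj d)) ⊗ Y) rfl rfl
      (id_nil_juxta_arc D))
  (rightUnitor_naturality := by
    intro X Y f
    induction f using hom_induction with
    | h0 => simp only [zero_tensorHom, Limits.zero_comp, Limits.comp_zero]
    | hadd f g hf hg => simp only [add_tensorHom, Preadditive.add_comp, Preadditive.comp_add, hf, hg]
    | hsmul c f hf => simp only [smul_tensorHom, Linear.smul_comp, Linear.comp_smul, hf]
    | h1 D =>
    have e : (𝟙 (𝟙_ (Obj d)) : 𝟙_ (Obj d) ⟶ 𝟙_ (Obj d)) = (Diagram.id []).hom := rfl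
    rw [e, hom_tensorHom_hom]
    exact hom_comp_eqToHom (obj_tensor_nil X) (obj_tensor_nil Y) (juxta_id_nil_arc D))
  (pentagon := by
    intro W X Y Z
    change (eqToHom (obj_tensor_assoc W X Y) ⊗ₘ eqToHom (rfl : Z = Z)) ≫
      eqToHom (obj_tensor_assoc W (X ⊗ Y) Z) ≫
        (eqToHom (rfl : W = W) ⊗ₘ eqToHom (obj_tensor_assoc X Y Z)) =
      eqToHom (obj_tensor_assoc (W ⊗ X) Y Z) ≫ eqToHom (obj_tensor_assoc W X (Y ⊗ Z))
    rw [tensorHom_eqToHom, tensorHom_eqToHom]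
    exact ((congrArg _ (eqToHom_trans _ _)).trans (eqToHom_trans _ _)).trans
      (eqToHom_trans _ _).symm)
  (triangle := by
    intro X Y
    change eqToHom (obj_tensor_assoc X (𝟙_ (Obj d)) Y) ≫
        (eqToHom (rfl : X = X) ⊗ₘ eqToHom (rfl : Y = Y)) =
      eqToHom (obj_tensor_nil X) ⊗ₘ eqToHom (rfl : Y = Y)
    rw [tensorHom_eqToHom, tensorHom_eqToHom]
    exact eqToHom_trans _ _)

end Category

section FiberFunctors

variable {d : ℂ}

/-- The one-letter word `X`. -/
abbrev Obj.X (d : ℂ) : Obj d := ⟨[.X]⟩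

/-- The one-letter word `X*`. -/
abbrev Obj.Xstar (d : ℂ) : Obj d := ⟨[.Xstar]⟩

/-- The basic arc of type `(X X*, ∅)`: one string, from the first to the second upper point. -/
def arcX : Diagram [.X, .Xstar] [] where
  arc p q := p = .up 0 ∧ q = .up 1
  isStart := by rintro p q ⟨rfl, rfl⟩; rfl
  isEnd := by rintro p q ⟨rfl, rfl⟩; rfl
  exists_out := by
    rintro (i | i) h
    · rcases i with _ | _ | i <;> simp_all [IsStart]
    · simp [IsStart] at h
  exists_in := by
    rintro (i | i) h
    · rcases i with _ | _ | i <;> simp_all [IsEnd]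
    · simp [IsEnd] at h
  out_unique := by rintro p q q' ⟨rfl, rfl⟩ ⟨_, rfl⟩; rfl
  in_unique := by rintro p p' q ⟨rfl, rfl⟩ ⟨rfl, _⟩; rfl
  noncrossing := by
    rintro p q p' q' (⟨rfl, rfl⟩ | ⟨rfl, rfl⟩) (⟨rfl, rfl⟩ | ⟨rfl, rfl⟩) <;> simp [Pt.key]

/-- The basic arc of type `(X* X, ∅)`: one string, from the second to the first upper point. -/
def arcXstar : Diagram [.Xstar, .X] [] where
  arc p q := p = .up 1 ∧ q = .up 0
  isStart := by rintro p q ⟨rfl, rfl⟩; rfl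
  isEnd := by rintro p q ⟨rfl, rfl⟩; rfl
  exists_out := by
    rintro (i | i) h
    · rcases i with _ | _ | i <;> simp_all [IsStart]
    · simp [IsStart] at h
  exists_in := by
    rintro (i | i) h
    · rcases i with _ | _ | i <;> simp_all [IsEnd]
    · simp [IsEnd] at h
  out_unique := by rintro p q q' ⟨rfl, rfl⟩ ⟨_, rfl⟩; rfl
  in_unique := by rintro p p' q ⟨rfl, rfl⟩ ⟨rfl, _⟩; rfl
  noncrossing := by
    rintro p q p' q' (⟨rfl, rfl⟩ | ⟨rfl, rfl⟩) (⟨rfl, rfl⟩ | ⟨rfl, rfl⟩) <;> simp [Pt.key]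

/-- The morphism `ε_X : X ⊗ X* ⟶ I`. -/
noncomputable def epsX (d : ℂ) : Obj.X d ⊗ Obj.Xstar d ⟶ 𝟙_ (Obj d) :=
  Diagram.hom (X := Obj.X d ⊗ Obj.Xstar d) (Y := 𝟙_ (Obj d)) arcX

/-- The morphism `ε_{X*} : X* ⊗ X ⟶ I`. -/
noncomputable def epsXstar (d : ℂ) : Obj.Xstar d ⊗ Obj.X d ⟶ 𝟙_ (Obj d) :=
  Diagram.hom (X := Obj.Xstar d ⊗ Obj.X d) (Y := 𝟙_ (Obj d)) arcXstar

/-- Fiber functors: linear (strong) monoidal functors from the category of oriented Kauffman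
diagrams to the category of finite-dimensional complex vector spaces. -/
structure FiberFunctor (d : ℂ) where
  functor : Obj d ⥤ FGModuleCat.{0} ℂ
  additive : functor.Additive
  linear : functor.Linear ℂ
  monoidal : functor.Monoidal

namespace FiberFunctor

attribute [instance] FiberFunctor.additive FiberFunctor.linear FiberFunctor.monoidal

/-- Natural equivalence of fiber functors: existence of a monoidal natural isomorphism. -/
def Equivalent (Φ Ψ : FiberFunctor d) : Prop :=
  ∃ α : Φ.functor ≅ Ψ.functor, NatTrans.IsMonoidal α.hom

instance setoid (d : ℂ) : Setoid (FiberFunctor d) where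
  r := Equivalent
  iseqv :=
    { refl := fun Φ => ⟨Iso.refl _, inferInstanceAs (NatTrans.IsMonoidal (𝟙 Φ.functor))⟩
      symm := by
        rintro Φ Ψ ⟨α, hα⟩
        exact ⟨α.symm, inferInstanceAs (NatTrans.IsMonoidal α.inv)⟩
      trans := by
        rintro Φ Ψ Θ ⟨α, hα⟩ ⟨β, hβ⟩
        exact ⟨α ≪≫ β, inferInstanceAs (NatTrans.IsMonoidal (α.hom ≫ β.hom))⟩ }

variable (Φ : FiberFunctor d)

/-- The vector space `Φ(Y)`. -/
abbrev space (Y : Obj d) : Type := Φ.functor.obj Y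

/-- The linear map `Φ(f)`. -/
noncomputable def lin {Y Z : Obj d} (f : Y ⟶ Z) : Φ.space Y →ₗ[ℂ] Φ.space Z :=
  (Φ.functor.map f).hom.hom

/-- The structure map `Φ(Y) ⊗ Φ(Z) → Φ(Y ⊗ Z)`. -/
noncomputable def mu (Y Z : Obj d) : Φ.space Y ⊗[ℂ] Φ.space Z →ₗ[ℂ] Φ.space (Y ⊗ Z) :=
  (Functor.LaxMonoidal.μ Φ.functor Y Z).hom.hom

/-- The structure map `ℂ → Φ(I)`. -/
noncomputable def unit : ℂ →ₗ[ℂ] Φ.space (𝟙_ (Obj d)) :=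
  (Functor.LaxMonoidal.ε Φ.functor).hom.hom

/-- The structure map `Φ(I) → ℂ`, inverse to `unit`. -/
noncomputable def unitInv : Φ.space (𝟙_ (Obj d)) →ₗ[ℂ] ℂ :=
  (Functor.OplaxMonoidal.η Φ.functor).hom.hom

/-- The bilinear form `Φ(ε_X)` on `Φ(X) × Φ(X*)`. -/
noncomputable def formX (x : Φ.space (Obj.X d)) (y : Φ.space (Obj.Xstar d)) : ℂ :=
  Φ.unitInv (Φ.lin (epsX d) (Φ.mu _ _ (x ⊗ₜ[ℂ] y)))

/-- The bilinear form `Φ(ε_{X*})` on `Φ(X*) × Φ(X)`. -/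
noncomputable def formXstar (y : Φ.space (Obj.Xstar d)) (x : Φ.space (Obj.X d)) : ℂ :=
  Φ.unitInv (Φ.lin (epsXstar d) (Φ.mu _ _ (y ⊗ₜ[ℂ] x)))

/-- In suitable bases of `Φ(X)` and `Φ(X*)`, the form `Φ(ε_X)` has matrix `1` and the form
`Φ(ε_{X*})` has matrix `B`. -/
def HasMatrix {n : ℕ} (B : Matrix (Fin n) (Fin n) ℂ) : Prop :=
  ∃ (v : Module.Basis (Fin n) ℂ (Φ.space (Obj.X d)))
    (w : Module.Basis (Fin n) ℂ (Φ.space (Obj.Xstar d))),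
    (∀ i j, Φ.formX (v i) (w j) = (1 : Matrix (Fin n) (Fin n) ℂ) i j) ∧
      ∀ j i, Φ.formXstar (w j) (v i) = B j i

/-- Naturality of a family of linear maps `Φ(Y) → Φ(Y) ⊗ N`. -/
def IsNatural {N : Type} [AddCommGroup N] [Module ℂ N]
    (θ : ∀ Y, Φ.space Y →ₗ[ℂ] Φ.space Y ⊗[ℂ] N) : Prop :=
  ∀ (Y Z : Obj d) (f : Y ⟶ Z), θ Z ∘ₗ Φ.lin f = (Φ.lin f).rTensor N ∘ₗ θ Y

/-- The Hopf algebra associated with a fiber functor by Tannaka-Krein duality: a Hopf algebra `H`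
that coacts on all the spaces `Φ(Y)`, compatibly with morphisms and tensor products, and
universally so (that is, `H` is the coend of `Φ`). -/
structure TannakaHopfAlgebra where
  H : Type
  [ring : Ring H]
  [hopf : HopfAlgebra ℂ H]
  /-- the coactions -/
  coact : ∀ Y, Φ.space Y →ₗ[ℂ] Φ.space Y ⊗[ℂ] H
  natural : Φ.IsNatural coact
  coassoc : ∀ Y, TensorProduct.assoc ℂ (Φ.space Y) H H ∘ₗ (coact Y).rTensor H ∘ₗ coact Y =
    (Coalgebra.comul (R := ℂ) (A := H)).lTensor (Φ.space Y) ∘ₗ coact Y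
  counit_coact : ∀ Y, (Coalgebra.counit (R := ℂ) (A := H)).lTensor (Φ.space Y) ∘ₗ coact Y =
    (TensorProduct.rid ℂ (Φ.space Y)).symm
  coact_unit : coact (𝟙_ (Obj d)) (Φ.unit 1) = Φ.unit 1 ⊗ₜ[ℂ] (1 : H)
  coact_tensor : ∀ Y Z, coact (Y ⊗ Z) ∘ₗ Φ.mu Y Z =
    TensorProduct.map (Φ.mu Y Z) (LinearMap.mul' ℂ H) ∘ₗ
      TensorProduct.tensorTensorTensorComm ℂ (Φ.space Y) H (Φ.space Z) H ∘ₗ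
        TensorProduct.map (coact Y) (coact Z)
  universal : ∀ (N : Type) [AddCommGroup N] [Module ℂ N]
    (θ : ∀ Y, Φ.space Y →ₗ[ℂ] Φ.space Y ⊗[ℂ] N), Φ.IsNatural θ →
      ∃! f : H →ₗ[ℂ] N, ∀ Y, θ Y = f.lTensor (Φ.space Y) ∘ₗ coact Y

attribute [instance] TannakaHopfAlgebra.ring TannakaHopfAlgebra.hopf

end FiberFunctor

/-- Invertible complex matrices `B` of size `n` with `trace B = d = trace B⁻¹`. -/
def TraceMatrix (n : ℕ) (d : ℂ) : Type :=
  {B : GL (Fin n) ℂ // Matrix.trace (B : Matrix (Fin n) (Fin n) ℂ) = d ∧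
    d = Matrix.trace ((B⁻¹ : GL (Fin n) ℂ) : Matrix (Fin n) (Fin n) ℂ)}

/-- Similarity: `B' = T⁻¹ B T`. -/
instance TraceMatrix.setoid (n : ℕ) (d : ℂ) : Setoid (TraceMatrix n d) where
  r B B' := ∃ T : GL (Fin n) ℂ, B'.1 = T⁻¹ * B.1 * T
  iseqv :=
    { refl := fun B => ⟨1, by simp⟩
      symm := by
        rintro B B' ⟨T, h⟩
        exact ⟨T⁻¹, by rw [h]; group⟩
      trans := by
        rintro B B' B'' ⟨T, h⟩ ⟨S, h'⟩
        exact ⟨T * S, by rw [h', h]; group⟩ }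

/-- Similarity orbits of such matrices. -/
abbrev SimilarityOrbit (n : ℕ) (d : ℂ) : Type := Quotient (TraceMatrix.setoid n d)

/-- The `2n²` generators `v_{ij}` and `w_{kl}`. -/
inductive Gen (n : ℕ) where
  | v (i j : Fin n)
  | w (k l : Fin n)

/-- The generator `v_{ij}` of the free algebra. -/
noncomputable def genV {n : ℕ} (i j : Fin n) : FreeAlgebra ℂ (Gen n) := FreeAlgebra.ι ℂ (.v i j)

/-- The generator `w_{kl}` of the free algebra. -/
noncomputable def genW {n : ℕ} (k l : Fin n) : FreeAlgebra ℂ (Gen n) := FreeAlgebra.ι ℂ (.w k l)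

/-- The defining relations attached to invertible matrices `A` and `B`. -/
inductive HopfRel {n : ℕ} (A B : Matrix (Fin n) (Fin n) ℂ) :
    FreeAlgebra ℂ (Gen n) → FreeAlgebra ℂ (Gen n) → Prop
  | relA (j l : Fin n) :
      HopfRel A B (∑ i, ∑ k, A i k • (genV i j * genW k l)) (A j l • 1)
  | relAinv (k l : Fin n) :
      HopfRel A B (∑ j, ∑ i, A⁻¹ j i • (genW k j * genV l i)) (A⁻¹ k l • 1)
  | relB (j l : Fin n) :
      HopfRel A B (∑ i, ∑ k, B i k • (genW i j * genV k l)) (B j l • 1)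
  | relBinv (k l : Fin n) :
      HopfRel A B (∑ j, ∑ i, B⁻¹ j i • (genV k j * genW l i)) (B⁻¹ k l • 1)

end FiberFunctors

end OrientedKauffman

/-!
# Fiber functors on oriented Kauffman diagrams, and their Hopf algebras

Every morphism of the category is a linear combination of composites of basic arcs between vertical
strings (`generated`).  Lower points are bent around to the upper line (`cupD_comp_bend`), and a
diagram without lower points has an arc between two adjacent upper points (`exists_adjacent`), which
splits off (`capD_comp_removeCap`).  In bases of `Φ(X)` and `Φ(X*)`, and the bases of tensor products
built from them, a fiber functor is therefore determined by the matrices of the upper and of the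
lower arcs.  Straightening a string that was bent twice shows that the matrices of the lower arcs
are inverse to those of the upper arcs (`cupMatrix_mul_capMatrix`), so that the matrices `A` and `B`
of the two upper arcs determine everything (`matrix_eq`).

**Classification.**  Straightening also shows that the form of the arc on `X X*` is non-degenerate
(`eq_zero_of_form`), so there are dual bases of `Φ(X)` and `Φ(X*)`, for which `A = 1`.  Closed loops
of the two orientations are then evaluated to the traces of `B` and of `B⁻¹` (`exists_traceMatrix`).
Dual bases are determined by the basis of `Φ(X)`, whose change conjugates `B` (`HasMatrix.conj`,
`HasMatrix.similar`).  Conversely, a matrix `B` both of whose traces are `d` comes from a fiber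
functor (`modelFiberFunctor`).  It maps a word of length `r` to the tensors of rank `r`, and a
diagram to the product over its strings of matrix entries of powers of the transpose `C` of `B`; the
exponent of a string is its rotation number `expo`.  When two strings are joined, their exponents
add up because strings do not cross (`expo_join`), and a closed loop contributes the trace of `C` or
of `C⁻¹` (`sum_weight_capD`).  By generation, composition has to be checked only for compositions
with a basic arc between vertical strings (`homMat_comp`).

**The Hopf algebra.**  The algebra `RingQuot (HopfRel A B)` is the universal algebra with a pair of
matrices of size `n` that preserves the two forms and the dual tensors (`IsCompatible`, `relLift`).
Products of such matrices with commuting entries, and inverses over the opposite algebra, are again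
of this kind, which gives the comultiplication and the antipode (`IsCompatible.mul`,
`IsCompatible.op_inv`).  The tensor products of the matrices of generators commute with the matrices
of all morphisms, as they do for the basic arcs; this is a natural coaction on all the spaces
(`isNaturalMatrix_wordMatrix`).  It is universal: the entries of the tensor products of the matrices
of free generators are exactly the monomials, a basis of the free algebra, so any family of maps
`Φ(Y) → Φ(Y) ⊗ N` is induced by a unique linear map from the free algebra to `N`
(`exists_linearMap_wordMatrix`).  Naturality of the family for the basic arcs between vertical
strings says that this map kills all the two-sided multiples of the defining relations
(`exists_linearMap_relGen`).  Any other universal coaction that is compatible with tensor products is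
isomorphic to this one, by a map that respects products and matrix entries (`exists_algEquiv`).
-/

/-! ### Elementary diagrams and generation of the morphisms -/

namespace OrientedKauffman

section Elementary
open Relation

variable {u v w : List Letter}

/-- The other letter. -/
def Letter.dual : Letter → Letter
  | .X => .Xstar
  | .Xstar => .X

/-- The position of `X` in the word `[a, a.dual]`. -/
def Letter.posX : Letter → ℕ
  | .X => 0
  | .Xstar => 1

/-- The position of `X*` in the word `[a, a.dual]`. -/
def Letter.posXstar : Letter → ℕ
  | .X => 1
  | .Xstar => 0

/-- The basic arc joining the two upper points of type `(a a*, ∅)`. -/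
def capArc : ∀ a : Letter, Diagram [a, a.dual] []
  | .X => arcX
  | .Xstar => arcXstar

theorem capArc_arc {a : Letter} {x y : Pt} :
    (capArc a).arc x y ↔ x = .up a.posX ∧ y = .up a.posXstar := by
  cases a <;> rfl

/-- The basic arc joining the two lower points of type `(∅, a a*)`. -/
def cupArc (a : Letter) : Diagram [] [a, a.dual] where
  arc x y := x = .lo a.posXstar ∧ y = .lo a.posX
  isStart := by rintro p q ⟨rfl, rfl⟩; cases a <;> rfl
  isEnd := by rintro p q ⟨rfl, rfl⟩; cases a <;> rfl
  exists_out := by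
    rintro (i | i) h
    · simp [IsStart] at h
    · rcases i with _ | _ | i <;> cases a <;>
        simp_all [IsStart, Letter.posX, Letter.posXstar, Letter.dual]
  exists_in := by
    rintro (i | i) h
    · simp [IsEnd] at h
    · rcases i with _ | _ | i <;> cases a <;>
        simp_all [IsEnd, Letter.posX, Letter.posXstar, Letter.dual]
  out_unique := by rintro p q q' ⟨rfl, rfl⟩ ⟨_, rfl⟩; rfl
  in_unique := by rintro p p' q ⟨rfl, rfl⟩ ⟨rfl, _⟩; rfl
  noncrossing := by
    rintro p q p' q' (⟨rfl, rfl⟩ | ⟨rfl, rfl⟩) (⟨rfl, rfl⟩ | ⟨rfl, rfl⟩) <;>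
      simp only [Pt.key] <;> omega

/-- The basic upper arc at the letters `a a*` of `p a a* q`, next to vertical strings. -/
def capD (a : Letter) (p q : List Letter) : Diagram (p ++ a :: a.dual :: q) (p ++ q) :=
  (Diagram.id p).juxta ((capArc a).juxta (Diagram.id q))

/-- The basic lower arc at the letters `a a*` of `p a a* q`, next to vertical strings. -/
def cupD (a : Letter) (p q : List Letter) : Diagram (p ++ q) (p ++ a :: a.dual :: q) :=
  (Diagram.id p).juxta ((cupArc a).juxta (Diagram.id q))

/-- The increasing enumeration of the numbers different from `k` and `k + 1`. -/
def del (k i : ℕ) : ℕ := if i < k then i else i + 2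

/-- Apply `del k` to the lower points. -/
def Pt.skipLo (k : ℕ) : Pt → Pt
  | .up i => .up i
  | .lo j => .lo (del k j)

/-- Apply `del k` to the upper points. -/
def Pt.skipUp (k : ℕ) : Pt → Pt
  | .up i => .up (del k i)
  | .lo j => .lo j

theorem getElem?_del (p q : List Letter) (a b : Letter) (i : ℕ) :
    (p ++ a :: b :: q)[del p.length i]? = (p ++ q)[i]? := by
  unfold del
  split_ifs with h
  · rw [List.getElem?_append_left h, List.getElem?_append_left h]
  · obtain ⟨j, rfl⟩ := Nat.exists_eq_add_of_le (not_lt.1 h)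
    rw [add_assoc, getElem?_shift, getElem?_shift]
    rfl

theorem eq_or_exists_del (a : Letter) (k m : ℕ) :
    m = k + a.posX ∨ m = k + a.posXstar ∨ ∃ i, m = del k i := by
  rcases lt_or_ge m k with h | h
  · exact .inr (.inr ⟨m, by simp [del, h]⟩)
  · rcases lt_or_ge m (k + 2) with h' | h'
    · cases a <;> simp only [Letter.posX, Letter.posXstar] <;> omega
    · exact .inr (.inr ⟨m - 2, by rw [del, if_neg] <;> omega⟩)

theorem del_ne_posX (a : Letter) (k i : ℕ) : del k i ≠ k + a.posX := by
  unfold del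
  cases a <;> simp only [Letter.posX] <;> split_ifs <;> omega

theorem del_ne_posXstar (a : Letter) (k i : ℕ) : del k i ≠ k + a.posXstar := by
  unfold del
  cases a <;> simp only [Letter.posXstar] <;> split_ifs <;> omega

theorem del_strictMono (k : ℕ) : StrictMono (del k) := by
  intro i j h
  unfold del
  split_ifs <;> omega

theorem Pt.skipLo_injective (k : ℕ) : Function.Injective (Pt.skipLo k) := by
  rintro (i | i) (j | j) h <;> simp only [skipLo, Pt.up.injEq, Pt.lo.injEq, reduceCtorEq] at h ⊢
  · exact h
  · exact (del_strictMono k).injective h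

theorem isStart_skipLo {a b : Letter} {p q : List Letter} {x : Pt} :
    IsStart u (p ++ a :: b :: q) (x.skipLo p.length) ↔ IsStart u (p ++ q) x := by
  cases x <;> simp only [IsStart, Pt.skipLo, getElem?_del]

theorem isEnd_skipLo {a b : Letter} {p q : List Letter} {x : Pt} :
    IsEnd u (p ++ a :: b :: q) (x.skipLo p.length) ↔ IsEnd u (p ++ q) x := by
  cases x <;> simp only [IsEnd, Pt.skipLo, getElem?_del]

theorem isStart_skipUp {a b : Letter} {p q : List Letter} {x : Pt} :
    IsStart (p ++ a :: b :: q) v (x.skipUp p.length) ↔ IsStart (p ++ q) v x := by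
  cases x <;> simp only [IsStart, Pt.skipUp, getElem?_del]

theorem isEnd_skipUp {a b : Letter} {p q : List Letter} {x : Pt} :
    IsEnd (p ++ a :: b :: q) v (x.skipUp p.length) ↔ IsEnd (p ++ q) v x := by
  cases x <;> simp only [IsEnd, Pt.skipUp, getElem?_del]

variable {a : Letter} {p q : List Letter} {i j : ℕ}

theorem capD_mid : (capD a p q).arc (.up (p.length + a.posX)) (.up (p.length + a.posXstar)) :=
  .inr ⟨.up a.posX, .up a.posXstar, .inl (capArc_arc.2 ⟨rfl, rfl⟩), rfl, rfl⟩

theorem cupD_mid : (cupD a p q).arc (.lo (p.length + a.posXstar)) (.lo (p.length + a.posX)) :=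
  .inr ⟨.lo a.posXstar, .lo a.posX, .inl ⟨rfl, rfl⟩, rfl, rfl⟩

theorem capD_X (h : (p ++ q)[i]? = some .X) :
    (capD a p q).arc (.up (del p.length i)) (.lo i) := by
  unfold del
  split_ifs with hi
  · exact .inl ⟨i, .inl ⟨by rwa [List.getElem?_append_left hi] at h, rfl, rfl⟩⟩
  · obtain ⟨j, rfl⟩ := Nat.exists_eq_add_of_le (not_lt.1 hi)
    rw [getElem?_shift] at h
    refine .inr ⟨.up (2 + j), .lo j, .inr ⟨.up j, .lo j, ⟨j, .inl ⟨h, rfl, rfl⟩⟩, rfl, ?_⟩, ?_, rfl⟩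
    · simp [Pt.shift]
    · simp [Pt.shift]; omega

theorem capD_Xstar (h : (p ++ q)[i]? = some .Xstar) :
    (capD a p q).arc (.lo i) (.up (del p.length i)) := by
  unfold del
  split_ifs with hi
  · exact .inl ⟨i, .inr ⟨by rwa [List.getElem?_append_left hi] at h, rfl, rfl⟩⟩
  · obtain ⟨j, rfl⟩ := Nat.exists_eq_add_of_le (not_lt.1 hi)
    rw [getElem?_shift] at h
    refine .inr ⟨.lo j, .up (2 + j), .inr ⟨.lo j, .up j, ⟨j, .inr ⟨h, rfl, rfl⟩⟩, ?_, rfl⟩, rfl, ?_⟩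
    · simp [Pt.shift]
    · simp [Pt.shift]; omega

theorem cupD_X (h : (p ++ q)[i]? = some .X) :
    (cupD a p q).arc (.up i) (.lo (del p.length i)) := by
  unfold del
  split_ifs with hi
  · exact .inl ⟨i, .inl ⟨by rwa [List.getElem?_append_left hi] at h, rfl, rfl⟩⟩
  · obtain ⟨j, rfl⟩ := Nat.exists_eq_add_of_le (not_lt.1 hi)
    rw [getElem?_shift] at h
    refine .inr ⟨.up j, .lo (2 + j), .inr ⟨.up j, .lo j, ⟨j, .inl ⟨h, rfl, rfl⟩⟩, ?_, rfl⟩, rfl, ?_⟩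
    · simp [Pt.shift]
    · simp [Pt.shift]; omega

theorem cupD_Xstar (h : (p ++ q)[i]? = some .Xstar) :
    (cupD a p q).arc (.lo (del p.length i)) (.up i) := by
  unfold del
  split_ifs with hi
  · exact .inl ⟨i, .inr ⟨by rwa [List.getElem?_append_left hi] at h, rfl, rfl⟩⟩
  · obtain ⟨j, rfl⟩ := Nat.exists_eq_add_of_le (not_lt.1 hi)
    rw [getElem?_shift] at h
    refine .inr ⟨.lo (2 + j), .up j, .inr ⟨.lo j, .up j, ⟨j, .inr ⟨h, rfl, rfl⟩⟩, rfl, ?_⟩, ?_, rfl⟩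
    · simp [Pt.shift]
    · simp [Pt.shift]; omega

theorem not_capD_lo_lo : ¬ (capD a p q).arc (.lo i) (.lo j) := by
  intro h
  exact Pt.noConfusion ((capD a p q).out_unique h (capD_Xstar ((capD a p q).isStart h)))

theorem not_cupD_up_up : ¬ (cupD a p q).arc (.up i) (.up j) := by
  intro h
  exact Pt.noConfusion ((cupD a p q).out_unique h (cupD_X ((cupD a p q).isStart h)))

theorem capD_up_up (h : (capD a p q).arc (.up i) (.up j)) :
    i = p.length + a.posX ∧ j = p.length + a.posXstar := by
  rcases eq_or_exists_del a p.length i with rfl | rfl | ⟨m, rfl⟩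
  · cases (capD a p q).out_unique h capD_mid
    exact ⟨rfl, rfl⟩
  · exact (not_start_end ((capD a p q).isStart h) ((capD a p q).isEnd capD_mid)).elim
  · have := (capD a p q).isStart h
    rw [IsStart, getElem?_del] at this
    exact Pt.noConfusion ((capD a p q).out_unique h (capD_X this))

theorem getElem?_posX : (p ++ a :: a.dual :: q)[p.length + a.posX]? = some .X :=
  (capD a p q).isStart capD_mid

theorem getElem?_posXstar : (p ++ a :: a.dual :: q)[p.length + a.posXstar]? = some .Xstar :=
  (capD a p q).isEnd capD_mid

theorem eq_or_exists_skipLo (a : Letter) (k : ℕ) (x : Pt) :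
    x = .lo (k + a.posX) ∨ x = .lo (k + a.posXstar) ∨ ∃ y : Pt, x = y.skipLo k := by
  cases x with
  | up i => exact .inr (.inr ⟨.up i, rfl⟩)
  | lo i =>
    rcases eq_or_exists_del a k i with rfl | rfl | ⟨j, rfl⟩
    · exact .inl rfl
    · exact .inr (.inl rfl)
    · exact .inr (.inr ⟨.lo j, rfl⟩)

theorem reflTransGen_capD_start (D : Diagram u (p ++ a :: a.dual :: q)) {x : Pt}
    (hx : IsStart u (p ++ q) x) :
    ReflTransGen (stack D (capD a p q)) (emb 0 2 x) (emb 0 1 (x.skipLo p.length)) := by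
  cases x with
  | up i => exact .refl
  | lo i => exact .single (.inr ⟨_, _, capD_Xstar hx, rfl, rfl⟩)

theorem reflTransGen_capD_end (D : Diagram u (p ++ a :: a.dual :: q)) {x : Pt}
    (hx : IsEnd u (p ++ q) x) :
    ReflTransGen (stack D (capD a p q)) (emb 0 1 (x.skipLo p.length)) (emb 0 2 x) := by
  cases x with
  | up i => exact .refl
  | lo i => exact .single (.inr ⟨_, _, capD_X hx, rfl, rfl⟩)

/-- Capping off two adjacent lower points joins the strings that end there. -/
theorem comp_capD_arc (D : Diagram u (p ++ a :: a.dual :: q)) {x y : Pt} :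
    (D.comp (capD a p q)).arc x y ↔ D.arc (x.skipLo p.length) (y.skipLo p.length) ∨
      (D.arc (x.skipLo p.length) (.lo (p.length + a.posX)) ∧
        D.arc (.lo (p.length + a.posXstar)) (y.skipLo p.length)) := by
  have key : ∀ {x y : Pt}, D.arc (x.skipLo p.length) (y.skipLo p.length) ∨
      (D.arc (x.skipLo p.length) (.lo (p.length + a.posX)) ∧
        D.arc (.lo (p.length + a.posXstar)) (y.skipLo p.length)) →
      (D.comp (capD a p q)).arc x y := by
    rintro x y (h | ⟨h, h'⟩)
    · exact TransGen.trans_left (TransGen.tail' (reflTransGen_capD_start D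
        (isStart_skipLo.1 (D.isStart h))) (.inl ⟨_, _, h, rfl, rfl⟩))
        (reflTransGen_capD_end D (isEnd_skipLo.1 (D.isEnd h)))
    · have h1 : stack D (capD a p q) (emb 0 1 (x.skipLo p.length)) (1, p.length + a.posX) :=
        .inl ⟨_, _, h, rfl, rfl⟩
      have h2 : stack D (capD a p q) (1, p.length + a.posX) (1, p.length + a.posXstar) :=
        .inr ⟨_, _, capD_mid, rfl, rfl⟩
      have h3 : stack D (capD a p q) (1, p.length + a.posXstar) (emb 0 1 (y.skipLo p.length)) :=
        .inl ⟨_, _, h', rfl, rfl⟩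
      exact TransGen.trans_left ((TransGen.tail' (reflTransGen_capD_start D
        (isStart_skipLo.1 (D.isStart h))) h1).tail h2 |>.tail h3)
        (reflTransGen_capD_end D (isEnd_skipLo.1 (D.isEnd h')))
  refine ⟨fun h => ?_, key⟩
  obtain ⟨z, hz⟩ := D.exists_out (isStart_skipLo.2 ((D.comp (capD a p q)).isStart h))
  rcases eq_or_exists_skipLo a p.length z with rfl | rfl | ⟨y', rfl⟩
  · obtain ⟨z', hz'⟩ := D.exists_out (p := .lo (p.length + a.posXstar)) getElem?_posXstar
    have hend := D.isEnd hz'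
    rcases eq_or_exists_skipLo a p.length z' with rfl | rfl | ⟨y', rfl⟩
    · have e := D.in_unique hz hz'
      cases x with
      | up i => exact Pt.noConfusion e
      | lo i => exact (del_ne_posXstar a _ i (Pt.lo.inj e)).elim
    · exact (not_start_end (D.isStart hz') (D.isEnd hz')).elim
    · obtain rfl := (D.comp (capD a p q)).out_unique h (key (.inr ⟨hz, hz'⟩))
      exact .inr ⟨hz, hz'⟩
  · have := D.isEnd hz
    simp only [IsEnd, getElem?_posXstar] at this
    cases this
  · obtain rfl := (D.comp (capD a p q)).out_unique h (key (.inl hz))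
    exact .inl hz

/-- Inserting a lower arc adds one string and renumbers the others. -/
theorem comp_cupD_arc (D : Diagram u (p ++ q)) {x y : Pt} :
    (D.comp (cupD a p q)).arc x y ↔
      (∃ x' y', D.arc x' y' ∧ x'.skipLo p.length = x ∧ y'.skipLo p.length = y) ∨
      (x = .lo (p.length + a.posXstar) ∧ y = .lo (p.length + a.posX)) := by
  have key : ∀ {x y : Pt}, (∃ x' y', D.arc x' y' ∧ x'.skipLo p.length = x ∧
      y'.skipLo p.length = y) ∨
      (x = .lo (p.length + a.posXstar) ∧ y = .lo (p.length + a.posX)) →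
      (D.comp (cupD a p q)).arc x y := by
    rintro x y (⟨x, y, h, rfl, rfl⟩ | ⟨rfl, rfl⟩)
    · have h1 : ReflTransGen (stack D (cupD a p q)) (emb 0 2 (x.skipLo p.length)) (emb 0 1 x) := by
        cases x with
        | up i => exact .refl
        | lo i => exact .single (.inr ⟨_, _, cupD_Xstar (D.isStart h), rfl, rfl⟩)
      have h2 : ReflTransGen (stack D (cupD a p q)) (emb 0 1 y) (emb 0 2 (y.skipLo p.length)) := by
        cases y with
        | up i => exact .refl
        | lo i => exact .single (.inr ⟨_, _, cupD_X (D.isEnd h), rfl, rfl⟩)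
      exact (TransGen.tail' h1 (.inl ⟨_, _, h, rfl, rfl⟩)).trans_left h2
    · exact .single (.inr ⟨_, _, cupD_mid, rfl, rfl⟩)
  refine ⟨fun h => ?_, key⟩
  have hs := (D.comp (cupD a p q)).isStart h
  rcases eq_or_exists_skipLo a p.length x with rfl | rfl | ⟨x, rfl⟩
  · simp only [IsStart, getElem?_posX] at hs
    cases hs
  · exact .inr ⟨rfl, (D.comp (cupD a p q)).out_unique h (key (.inr ⟨rfl, rfl⟩))⟩
  · obtain ⟨z, hz⟩ := D.exists_out (isStart_skipLo.1 hs)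
    exact .inl ⟨x, z, hz, rfl, (D.comp (cupD a p q)).out_unique (key (.inl ⟨x, z, hz, rfl, rfl⟩)) h⟩

theorem loops_eq_zero {D : Diagram u v} {E : Diagram v w}
    (h : ∀ x, ¬ TransGen (stack D E) x x) : loops D E = 0 := by
  have : loopSet (stack D E) = ∅ := by
    rw [Set.eq_empty_iff_forall_notMem]
    rintro c ⟨x, hx, -⟩
    exact h x hx
  simp [loops, this]

theorem loops_cupD (D : Diagram u (p ++ q)) : loops D (cupD a p q) = 0 :=
  loops_eq_zero fun _ hx => by
    obtain ⟨i, j, h⟩ := cycle_lower hx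
    exact not_cupD_up_up h

theorem loops_capD_left (D : Diagram (p ++ q) v) : loops (capD a p q) D = 0 :=
  loops_eq_zero fun _ hx => by
    obtain ⟨i, j, h⟩ := cycle_upper hx
    exact not_capD_lo_lo h

theorem posX_ne_posXstar (a : Letter) (k : ℕ) : k + a.posX ≠ k + a.posXstar := by
  cases a <;> simp [Letter.posX, Letter.posXstar]

theorem cycle_step_capD {D : Diagram u (p ++ a :: a.dual :: q)} {x : ℕ × ℕ}
    (hx : TransGen (stack D (capD a p q)) x x) :
    (x = (1, p.length + a.posX) ∧
      TransGen (stack D (capD a p q)) (1, p.length + a.posXstar) (1, p.length + a.posXstar)) ∨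
    ∃ i, x = (1, i) ∧ D.arc (.lo i) (.lo (p.length + a.posX)) ∧
      TransGen (stack D (capD a p q)) (1, p.length + a.posX) (1, p.length + a.posX) := by
  have upper : ∀ {x y : ℕ × ℕ}, x.1 = 1 → y.1 = 1 → place 1 2 (capD a p q).arc x y →
      x = (1, p.length + a.posX) ∧ y = (1, p.length + a.posXstar) := by
    rintro _ _ h1 h2 ⟨x, y, h, rfl, rfl⟩
    cases x <;> cases y <;> simp [emb] at h1 h2
    obtain ⟨rfl, rfl⟩ := capD_up_up h
    exact ⟨rfl, rfl⟩
  obtain ⟨y, h, hy⟩ := cycle_next hx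
  have hx1 := cycle_mid hx
  have hy1 := cycle_mid hy
  rcases h with ⟨s, t, h, rfl, rfl⟩ | h
  · obtain ⟨z, h', hz⟩ := cycle_next hy
    rcases h' with ⟨s', t', h', e, rfl⟩ | h'
    · cases emb_injective (by decide) e
      exact (not_start_end (D.isStart h') (D.isEnd h)).elim
    · obtain ⟨e, -⟩ := upper hy1 (cycle_mid hz) h'
      rw [e] at hy
      cases s <;> cases t <;> simp [emb] at hx1 hy1 e
      subst e
      exact .inr ⟨_, rfl, h, hy⟩
  · obtain ⟨rfl, rfl⟩ := upper hx1 hy1 h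
    exact .inl ⟨rfl, hy⟩

theorem cycle_capD {D : Diagram u (p ++ a :: a.dual :: q)} {x : ℕ × ℕ}
    (hx : TransGen (stack D (capD a p q)) x x) :
    D.arc (.lo (p.length + a.posXstar)) (.lo (p.length + a.posX)) ∧
      (x = (1, p.length + a.posX) ∨ x = (1, p.length + a.posXstar)) := by
  have hT : ∀ {x}, TransGen (stack D (capD a p q)) x x → TransGen (stack D (capD a p q))
      (1, p.length + a.posXstar) (1, p.length + a.posXstar) := by
    intro x hx
    rcases cycle_step_capD hx with ⟨-, h⟩ | ⟨i, -, -, h⟩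
    · exact h
    · rcases cycle_step_capD h with ⟨-, h⟩ | ⟨j, e, h, -⟩
      · exact h
      · cases e
        exact (not_start_end (D.isStart h) (D.isEnd h)).elim
  have arc : D.arc (.lo (p.length + a.posXstar)) (.lo (p.length + a.posX)) := by
    rcases cycle_step_capD (hT hx) with ⟨e, -⟩ | ⟨i, e, h, -⟩
    · exact (posX_ne_posXstar a _ (congrArg Prod.snd e).symm).elim
    · cases e
      exact h
  refine ⟨arc, ?_⟩
  rcases cycle_step_capD hx with ⟨e, -⟩ | ⟨i, rfl, h, -⟩
  · exact .inl e
  · cases D.in_unique h arc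
    exact .inr rfl

theorem loops_capD_of_not_arc {D : Diagram u (p ++ a :: a.dual :: q)}
    (h : ¬ D.arc (.lo (p.length + a.posXstar)) (.lo (p.length + a.posX))) :
    loops D (capD a p q) = 0 :=
  loops_eq_zero fun _ hx => h (cycle_capD hx).1

theorem loops_capD_of_arc {D : Diagram u (p ++ a :: a.dual :: q)}
    (h : D.arc (.lo (p.length + a.posXstar)) (.lo (p.length + a.posX))) :
    loops D (capD a p q) = 1 := by
  have h1 : stack D (capD a p q) (1, p.length + a.posXstar) (1, p.length + a.posX) :=
    .inl ⟨_, _, h, rfl, rfl⟩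
  have h2 : stack D (capD a p q) (1, p.length + a.posX) (1, p.length + a.posXstar) :=
    .inr ⟨_, _, capD_mid, rfl, rfl⟩
  have conn : ∀ {x y : ℕ × ℕ}, (x = (1, p.length + a.posX) ∨ x = (1, p.length + a.posXstar)) →
      (y = (1, p.length + a.posX) ∨ y = (1, p.length + a.posXstar)) →
      TransGen (stack D (capD a p q)) x y := by
    rintro x y (rfl | rfl) (rfl | rfl)
    · exact (TransGen.single h2).tail h1
    · exact .single h2
    · exact .single h1
    · exact (TransGen.single h1).tail h2
  have : loopSet (stack D (capD a p q)) =
      {{x | x = (1, p.length + a.posX) ∨ x = (1, p.length + a.posXstar)}} := by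
    ext c
    constructor
    · rintro ⟨x, hx, rfl⟩
      have hx' := (cycle_capD hx).2
      ext y
      exact ⟨fun hy => (cycle_capD (hy.2.trans hy.1)).2, fun hy => ⟨conn hx' hy, conn hy hx'⟩⟩
    · rintro rfl
      refine ⟨_, conn (.inl rfl) (.inl rfl), ?_⟩
      ext y
      exact ⟨fun hy => ⟨conn (.inl rfl) hy, conn hy (.inl rfl)⟩,
        fun hy => (cycle_capD (hy.2.trans hy.1)).2⟩
  rw [loops, this, Set.ncard_singleton]

end Elementary

section Generation
open Relation

variable {u v w : List Letter} {a : Letter} {p q : List Letter}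

theorem Pt.key_skipUp_lt {k : ℕ} {x y : Pt} :
    (x.skipUp k).key < (y.skipUp k).key ↔ x.key < y.key := by
  cases x <;> cases y <;> simp only [skipUp, key, del] <;> split_ifs <;> omega

theorem Pt.key_skipLo_lt {k : ℕ} {x y : Pt} :
    (x.skipLo k).key < (y.skipLo k).key ↔ x.key < y.key := by
  cases x <;> cases y <;> simp only [skipLo, key, del] <;> split_ifs <;> omega

theorem Pt.skipUp_injective (k : ℕ) : Function.Injective (Pt.skipUp k) := by
  rintro (i | i) (j | j) h <;> simp only [skipUp, Pt.up.injEq, Pt.lo.injEq, reduceCtorEq] at h ⊢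
  · exact (del_strictMono k).injective h
  · exact h

theorem eq_or_exists_skipUp (a : Letter) (k : ℕ) (x : Pt) :
    x = .up (k + a.posX) ∨ x = .up (k + a.posXstar) ∨ ∃ y : Pt, x = y.skipUp k := by
  cases x with
  | lo i => exact .inr (.inr ⟨.lo i, rfl⟩)
  | up i =>
    rcases eq_or_exists_del a k i with rfl | rfl | ⟨j, rfl⟩
    · exact .inl rfl
    · exact .inr (.inl rfl)
    · exact .inr (.inr ⟨.up j, rfl⟩)

/-- Remove an upper arc between adjacent points. -/
def Diagram.removeCap (D : Diagram (p ++ a :: a.dual :: q) v)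
    (h : D.arc (.up (p.length + a.posX)) (.up (p.length + a.posXstar))) :
    Diagram (p ++ q) v where
  arc x y := D.arc (x.skipUp p.length) (y.skipUp p.length)
  isStart h := isStart_skipUp.1 (D.isStart h)
  isEnd h := isEnd_skipUp.1 (D.isEnd h)
  exists_out {x} hx := by
    obtain ⟨z, hz⟩ := D.exists_out (isStart_skipUp.2 hx)
    rcases eq_or_exists_skipUp a p.length z with rfl | rfl | ⟨y, rfl⟩
    · exact (not_start_end (D.isStart h) (D.isEnd hz)).elim
    · have e := D.in_unique h hz
      cases x with
      | up i => exact (del_ne_posX a _ i (Pt.up.inj e).symm).elim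
      | lo i => exact Pt.noConfusion e
    · exact ⟨y, hz⟩
  exists_in {x} hx := by
    obtain ⟨z, hz⟩ := D.exists_in (isEnd_skipUp.2 hx)
    rcases eq_or_exists_skipUp a p.length z with rfl | rfl | ⟨y, rfl⟩
    · have e := D.out_unique h hz
      cases x with
      | up i => exact (del_ne_posXstar a _ i (Pt.up.inj e).symm).elim
      | lo i => exact Pt.noConfusion e
    · exact (not_start_end (D.isStart hz) (D.isEnd h)).elim
    · exact ⟨y, hz⟩
  out_unique h h' := Pt.skipUp_injective _ (D.out_unique h h')
  in_unique h h' := Pt.skipUp_injective _ (D.in_unique h h')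
  noncrossing h h' h1 h2 h3 := D.noncrossing h h' (Pt.key_skipUp_lt.2 h1) (Pt.key_skipUp_lt.2 h2)
    (Pt.key_skipUp_lt.2 h3)

/-- An arc between adjacent upper points splits off as a basic arc between vertical strings. -/
theorem capD_comp_removeCap (D : Diagram (p ++ a :: a.dual :: q) v)
    (h : D.arc (.up (p.length + a.posX)) (.up (p.length + a.posXstar))) :
    (capD a p q).comp (D.removeCap h) = D := by
  symm
  apply Diagram.eq_of_le
  intro x y hxy
  have hs := D.isStart hxy
  have he := D.isEnd hxy
  rcases eq_or_exists_skipUp a p.length x with rfl | rfl | ⟨x, rfl⟩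
  · obtain rfl := D.out_unique h hxy
    exact .single (.inl ⟨_, _, capD_mid, rfl, rfl⟩)
  · exact (not_start_end hs (D.isEnd h)).elim
  rcases eq_or_exists_skipUp a p.length y with rfl | rfl | ⟨y, rfl⟩
  · exact (not_start_end (D.isStart h) he).elim
  · have e := D.in_unique h hxy
    cases x with
    | up i => exact (del_ne_posX a _ i (Pt.up.inj e).symm).elim
    | lo i => exact Pt.noConfusion e
  have h1 : ReflTransGen (stack (capD a p q) (D.removeCap h)) (emb 0 2 (x.skipUp p.length))
      (emb 1 2 x) := by
    cases x with
    | lo i => exact .refl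
    | up i =>
      refine .single (.inl ⟨_, _, capD_X ?_, rfl, rfl⟩)
      exact isStart_skipUp.1 hs
  have h2 : ReflTransGen (stack (capD a p q) (D.removeCap h)) (emb 1 2 y)
      (emb 0 2 (y.skipUp p.length)) := by
    cases y with
    | lo i => exact .refl
    | up i =>
      refine .single (.inl ⟨_, _, capD_Xstar ?_, rfl, rfl⟩)
      exact isEnd_skipUp.1 he
  exact (TransGen.tail' h1 (.inr ⟨x, y, hxy, rfl, rfl⟩)).trans_left h2

/-- Move the first upper point to the front of the lower line. -/
def Pt.unbend : Pt → Pt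
  | .up 0 => .lo 0
  | .up (i + 1) => .up i
  | .lo j => .lo (j + 1)

theorem Pt.key_unbend (x : Pt) : x.unbend.key = x.key + 1 := by
  rcases x with (_ | i) | j <;> simp [unbend, key]

theorem Pt.unbend_bijective : Function.Bijective Pt.unbend := by
  constructor
  · rintro ((_ | i) | i) ((_ | j) | j) h <;> simp_all [unbend]
  · rintro (i | (_ | j))
    · exact ⟨.up (i + 1), rfl⟩
    · exact ⟨.up 0, rfl⟩
    · exact ⟨.lo j, rfl⟩

theorem isStart_unbend {x : Pt} : IsStart u (a :: v) x.unbend ↔ IsStart (a.dual :: u) v x := by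
  rcases x with (_ | i) | j <;> cases a <;> simp [Pt.unbend, IsStart, Letter.dual]

theorem isEnd_unbend {x : Pt} : IsEnd u (a :: v) x.unbend ↔ IsEnd (a.dual :: u) v x := by
  rcases x with (_ | i) | j <;> cases a <;> simp [Pt.unbend, IsEnd, Letter.dual]

/-- Bend the string at the first lower point around the left edge, so that it ends at a new first
upper point.  The positions along the boundary are all shifted by one. -/
def Diagram.bend (D : Diagram u (a :: v)) : Diagram (a.dual :: u) v where
  arc x y := D.arc x.unbend y.unbend
  isStart h := isStart_unbend.1 (D.isStart h)
  isEnd h := isEnd_unbend.1 (D.isEnd h)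
  exists_out {x} hx := by
    obtain ⟨z, hz⟩ := D.exists_out (isStart_unbend.2 hx)
    obtain ⟨y, rfl⟩ := Pt.unbend_bijective.2 z
    exact ⟨y, hz⟩
  exists_in {x} hx := by
    obtain ⟨z, hz⟩ := D.exists_in (isEnd_unbend.2 hx)
    obtain ⟨y, rfl⟩ := Pt.unbend_bijective.2 z
    exact ⟨y, hz⟩
  out_unique h h' := Pt.unbend_bijective.1 (D.out_unique h h')
  in_unique h h' := Pt.unbend_bijective.1 (D.in_unique h h')
  noncrossing h h' h1 h2 h3 := by
    refine D.noncrossing h h' ?_ ?_ ?_ <;> rw [Pt.key_unbend, Pt.key_unbend] <;> omega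

/-- A bent string can be straightened by a lower arc at its left. -/
theorem cupD_comp_bend (D : Diagram u (a :: v)) :
    (cupD a [] u).comp ((Diagram.id [a]).juxta D.bend) = D := by
  symm
  apply Diagram.eq_of_le
  intro x y h
  obtain ⟨x, rfl⟩ := Pt.unbend_bijective.2 x
  obtain ⟨y, rfl⟩ := Pt.unbend_bijective.2 y
  have hs := isStart_unbend.1 (D.isStart h)
  have he := isEnd_unbend.1 (D.isEnd h)
  set R := stack (cupD a [] u) ((Diagram.id [a]).juxta D.bend) with hR
  have hm : R (emb 1 2 (x.shift 1 1)) (emb 1 2 (y.shift 1 1)) :=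
    .inr ⟨_, _, .inr ⟨x, y, h, rfl, rfl⟩, rfl, rfl⟩
  have h1 : ReflTransGen R (emb 0 2 x.unbend) (emb 1 2 (x.shift 1 1)) := by
    rcases x with (_ | i) | j
    · cases a
      · cases hs
      · have e1 : R (2, 0) (1, 0) :=
          .inr ⟨.lo 0, .up 0, .inl ⟨0, .inr ⟨rfl, rfl, rfl⟩⟩, rfl, rfl⟩
        have e2 : R (1, 0) (1, 1) := .inl ⟨_, _, cupD_mid (p := []), rfl, rfl⟩
        exact (ReflTransGen.single e1).tail e2
    · refine .single (.inl ⟨.up i, .lo (del 0 i), cupD_X (p := []) hs, rfl, ?_⟩)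
      simp [emb, Pt.shift, del]; omega
    · have : Pt.shift 1 1 (.lo j) = .lo (j + 1) := by simp [Pt.shift, add_comm]
      rw [this]
      exact .refl
  have h2 : ReflTransGen R (emb 1 2 (y.shift 1 1)) (emb 0 2 y.unbend) := by
    rcases y with (_ | i) | j
    · cases a
      · have e1 : R (1, 0) (2, 0) :=
          .inr ⟨.up 0, .lo 0, .inl ⟨0, .inl ⟨rfl, rfl, rfl⟩⟩, rfl, rfl⟩
        have e2 : R (1, 1) (1, 0) := .inl ⟨_, _, cupD_mid (p := []), rfl, rfl⟩
        exact (ReflTransGen.single e2).tail e1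
      · cases he
    · refine .single (.inl ⟨.lo (del 0 i), .up i, cupD_Xstar (p := []) he, ?_, rfl⟩)
      simp [emb, Pt.shift, del]; omega
    · have : Pt.shift 1 1 (.lo j) = .lo (j + 1) := by simp [Pt.shift, add_comm]
      rw [this]
      exact .refl
  exact (TransGen.tail' h1 hm).trans_left h2

theorem cupD_lo_lo {i j : ℕ} (h : (cupD a p q).arc (.lo i) (.lo j)) :
    i = p.length + a.posXstar ∧ j = p.length + a.posX := by
  rcases eq_or_exists_del a p.length i with rfl | rfl | ⟨m, rfl⟩
  · exact (not_start_end ((cupD a p q).isStart h) ((cupD a p q).isEnd cupD_mid)).elim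
  · cases (cupD a p q).out_unique h cupD_mid
    exact ⟨rfl, rfl⟩
  · have := (cupD a p q).isStart h
    rw [IsStart, getElem?_del] at this
    exact Pt.noConfusion ((cupD a p q).out_unique h (cupD_Xstar this))

theorem loops_cupD_bend (D : Diagram u (a :: v)) :
    loops (cupD a [] u) ((Diagram.id [a]).juxta D.bend) = 0 := by
  apply loops_eq_zero
  have aux : ∀ {x y}, TransGen (stack (cupD a [] u) ((Diagram.id [a]).juxta D.bend)) x x →
      TransGen (stack (cupD a [] u) ((Diagram.id [a]).juxta D.bend)) y y →
      place 0 1 (cupD a [] u).arc x y → False := by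
    rintro _ _ hx hy ⟨s, t, h, rfl, rfl⟩
    have h1 := cycle_mid hx
    have h2 := cycle_mid hy
    cases s <;> cases t <;> simp [emb] at h1 h2
    obtain ⟨rfl, rfl⟩ := cupD_lo_lo h
    cases a
    · obtain ⟨z, hz, hz'⟩ := cycle_next hy
      have e1 : stack (cupD .X [] u) ((Diagram.id [.X]).juxta D.bend) (1, 0) (2, 0) :=
        .inr ⟨.up 0, .lo 0, .inl ⟨0, .inl ⟨rfl, rfl, rfl⟩⟩, rfl, rfl⟩
      obtain rfl := stack_out hz e1
      have := cycle_mid hz'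
      omega
    · obtain ⟨z, hz, hz'⟩ := TransGen.tail'_iff.1 hx
      have e1 : stack (cupD .Xstar [] u) ((Diagram.id [.Xstar]).juxta D.bend) (2, 0) (1, 0) :=
        .inr ⟨.lo 0, .up 0, .inl ⟨0, .inr ⟨rfl, rfl, rfl⟩⟩, rfl, rfl⟩
      obtain rfl := stack_in hz' e1
      have := cycle_mid (TransGen.head' hz' hz)
      omega
  intro x hx
  obtain ⟨y, hy, hyc⟩ := cycle_next hx
  rcases hy with hy | hy
  · exact aux hx hyc hy
  · obtain ⟨z, hz, hzc⟩ := cycle_next hyc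
    rcases hz with hz | hz
    · exact aux hyc hzc hz
    · obtain ⟨s, t, h1, -, rfl⟩ := hy
      obtain ⟨s', t', h2, e, -⟩ := hz
      cases emb_injective (by decide) e
      exact (not_start_end (Diagram.isStart _ h2) (Diagram.isEnd _ h1)).elim

/-- A nonempty diagram without lower points has an arc between adjacent points. -/
theorem exists_adjacent (D : Diagram u []) (hu : u ≠ []) :
    ∃ i, D.arc (.up i) (.up (i + 1)) ∨ D.arc (.up (i + 1)) (.up i) := by
  set link : ℕ → ℕ → Prop := fun i j => D.arc (.up i) (.up j) ∨ D.arc (.up j) (.up i) with hlink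
  have symm : ∀ {i j}, link i j → link j i := fun h => h.symm
  have uniq : ∀ {i j m}, link i j → link i m → j = m := by
    rintro i j m (h | h) (h' | h')
    · exact Pt.up.inj (D.out_unique h h')
    · exact (not_start_end (D.isStart h) (D.isEnd h')).elim
    · exact (not_start_end (D.isStart h') (D.isEnd h)).elim
    · exact Pt.up.inj (D.in_unique h h')
  have ex : ∀ i, i < u.length → ∃ j, j ≠ i ∧ link i j := by
    intro i hi
    have hlo : ∀ {j}, ¬ IsStart u [] (.lo j) ∧ ¬ IsEnd u [] (.lo j) := by simp [IsStart, IsEnd]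
    cases e : u[i] with
    | X =>
      obtain ⟨z, hz⟩ := D.exists_out (p := .up i) (List.getElem?_eq_some_iff.2 ⟨hi, e⟩)
      cases z with
      | up j =>
        refine ⟨j, ?_, .inl hz⟩
        rintro rfl
        exact not_start_end (D.isStart hz) (D.isEnd hz)
      | lo j => exact (hlo.2 (D.isEnd hz)).elim
    | Xstar =>
      obtain ⟨z, hz⟩ := D.exists_in (q := .up i) (List.getElem?_eq_some_iff.2 ⟨hi, e⟩)
      cases z with
      | up j =>
        refine ⟨j, ?_, .inr hz⟩
        rintro rfl
        exact not_start_end (D.isStart hz) (D.isEnd hz)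
      | lo j => exact (hlo.1 (D.isStart hz)).elim
  have lt_length : ∀ {i j}, link i j → j < u.length := by
    rintro i j (h | h)
    · exact (List.getElem?_eq_some_iff.1 (D.isEnd h)).1
    · exact (List.getElem?_eq_some_iff.1 (D.isStart h)).1
  -- the strings that start under an arc stay under it, and there are shorter and shorter ones
  have main : ∀ n i j, j ≤ i + n → i < j → link i j → ∃ i, link i (i + 1) := by
    intro n
    induction n with
    | zero => intro i j h1 h2; omega
    | succ n ih =>
      intro i j h1 h2 h
      rcases Nat.lt_or_ge (i + 1) j with h3 | h3
      · obtain ⟨m, hm, hl⟩ := ex (i + 1) (h3.trans (lt_length h))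
        have n1 : m ≠ i := by rintro rfl; exact absurd (uniq h (symm hl)) (by omega)
        have n2 : m ≠ j := by rintro rfl; exact absurd (uniq (symm h) (symm hl)) (by omega)
        have g1 := D.noncrossing (p := .up j) (q := .up i) (p' := .up (i + 1)) (q' := .up m)
          (symm h) hl
        have g2 := D.noncrossing (p := .up m) (q := .up (i + 1)) (p' := .up j) (q' := .up i)
          (symm hl) (symm h)
        simp only [Pt.key] at g1 g2
        push_cast at g1 g2
        exact ih (i + 1) m (by omega) (by omega) hl
      · obtain rfl : j = i + 1 := by omega
        exact ⟨i, h⟩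
  obtain ⟨j, hj, hl⟩ := ex 0 (List.length_pos_iff.2 hu)
  exact main j 0 j (by omega) (by omega) hl

variable {d : ℂ}

/-- The closure of the basic arcs between vertical strings under composition and linear
combinations. -/
inductive Generated : ∀ {X Y : Obj d}, (X ⟶ Y) → Prop
  | zero (X Y : Obj d) : Generated (0 : X ⟶ Y)
  | add {X Y : Obj d} {f g : X ⟶ Y} : Generated f → Generated g → Generated (f + g)
  | smul {X Y : Obj d} (c : ℂ) {f : X ⟶ Y} : Generated f → Generated (c • f)
  | id (X : Obj d) : Generated (𝟙 X)
  | comp {X Y Z : Obj d} {f : X ⟶ Y} {g : Y ⟶ Z} : Generated f → Generated g → Generated (f ≫ g)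
  | cap (a : Letter) (p q : List Letter) :
      Generated ((capD a p q).hom : (⟨p ++ a :: a.dual :: q⟩ : Obj d) ⟶ ⟨p ++ q⟩)
  | cup (a : Letter) (p q : List Letter) :
      Generated ((cupD a p q).hom : (⟨p ++ q⟩ : Obj d) ⟶ ⟨p ++ a :: a.dual :: q⟩)

theorem id_juxta_capD (b : Letter) :
    (Diagram.id [b]).juxta (capD a p q) = capD a (b :: p) q := by
  refine Diagram.ext (((juxta_assoc_arc _ _ _).symm.trans ?_))
  rw [juxta_id]
  rfl

theorem id_juxta_cupD (b : Letter) :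
    (Diagram.id [b]).juxta (cupD a p q) = cupD a (b :: p) q := by
  refine Diagram.ext (((juxta_assoc_arc _ _ _).symm.trans ?_))
  rw [juxta_id]
  rfl

theorem Generated.tensor {X Y : Obj d} {f : X ⟶ Y} (h : Generated f) (b : Letter) :
    Generated ((⟨[b]⟩ : Obj d) ◁ f) := by
  induction h with
  | zero X Y =>
    have : (⟨[b]⟩ : Obj d) ◁ (0 : X ⟶ Y) = 0 := tensorHom_zero _
    rw [this]
    exact .zero _ _
  | @add X Y f g _ _ hf hg =>
    have : (⟨[b]⟩ : Obj d) ◁ (f + g) = (⟨[b]⟩ : Obj d) ◁ f + (⟨[b]⟩ : Obj d) ◁ g :=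
      tensorHom_add _ _ _
    rw [this]
    exact .add hf hg
  | @smul X Y c f _ hf =>
    have : (⟨[b]⟩ : Obj d) ◁ (c • f) = c • ((⟨[b]⟩ : Obj d) ◁ f) := tensorHom_smul _ _ _
    rw [this]
    exact .smul c hf
  | id X =>
    rw [MonoidalCategory.whiskerLeft_id]
    exact .id _
  | comp _ _ hf hg =>
    rw [MonoidalCategory.whiskerLeft_comp]
    exact .comp hf hg
  | cap a p q =>
    have : (⟨[b]⟩ : Obj d) ◁ ((capD a p q).hom : (⟨p ++ a :: a.dual :: q⟩ : Obj d) ⟶ ⟨p ++ q⟩) =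
        ((capD a (b :: p) q).hom : (⟨b :: p ++ a :: a.dual :: q⟩ : Obj d) ⟶ ⟨b :: p ++ q⟩) := by
      refine (hom_tensorHom_hom (X := ⟨[b]⟩) (Y := ⟨[b]⟩) _ _).trans ?_
      rw [id_juxta_capD]
    rw [this]
    exact .cap _ _ _
  | cup a p q =>
    have : (⟨[b]⟩ : Obj d) ◁ ((cupD a p q).hom : (⟨p ++ q⟩ : Obj d) ⟶ ⟨p ++ a :: a.dual :: q⟩) =
        ((cupD a (b :: p) q).hom : (⟨b :: p ++ q⟩ : Obj d) ⟶ ⟨b :: p ++ a :: a.dual :: q⟩) := by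
      refine (hom_tensorHom_hom (X := ⟨[b]⟩) (Y := ⟨[b]⟩) _ _).trans ?_
      rw [id_juxta_cupD]
    rw [this]
    exact .cup _ _ _

theorem hom_comp_of_loops {X Y Z : Obj d} {D : Diagram X.word Y.word} {E : Diagram Y.word Z.word}
    (h : loops D E = 0) : ((D.comp E).hom : X ⟶ Z) = (D.hom : X ⟶ Y) ≫ (E.hom : Y ⟶ Z) := by
  rw [hom_comp_hom, h, pow_zero, one_smul]

theorem generated_hom_nil (n : ℕ) : ∀ (u : List Letter) (_ : u.length ≤ n) (D : Diagram u []),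
    Generated (d := d) (D.hom : (⟨u⟩ : Obj d) ⟶ ⟨[]⟩) := by
  induction n with
  | zero =>
    intro u hu D
    obtain rfl : u = [] := List.length_eq_zero_iff.1 (by omega)
    have : D = Diagram.id [] := by
      symm
      apply Diagram.eq_of_le
      rintro x y ⟨i, ⟨h, -⟩ | ⟨h, -⟩⟩ <;> simp at h
    rw [this]
    exact .id _
  | succ n ih =>
    intro u hu D
    -- split off an innermost arc, and induct on the number of points
    by_cases hn : u = []
    · subst hn
      exact ih [] (by simp) D
    obtain ⟨i, a, q, e, h⟩ : ∃ i, ∃ (a : Letter) (q : List Letter),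
        u = u.take i ++ a :: a.dual :: q ∧
          D.arc (.up ((u.take i).length + a.posX)) (.up ((u.take i).length + a.posXstar)) := by
      obtain ⟨i, h⟩ := exists_adjacent D hn
      have h1 : i + 1 < u.length := by
        rcases h with h | h
        · exact (List.getElem?_eq_some_iff.1 (D.isEnd h)).1
        · exact (List.getElem?_eq_some_iff.1 (D.isStart h)).1
      have hl : (u.take i).length = i := by rw [List.length_take]; omega
      refine ⟨i, u[i], u.drop (i + 2), ?_, ?_⟩
      · have hd : u[i + 1] = u[i].dual := by
          rcases h with h | h
          · rw [(List.getElem?_eq_some_iff.1 (D.isStart h)).2,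
              (List.getElem?_eq_some_iff.1 (D.isEnd h)).2]
            rfl
          · rw [(List.getElem?_eq_some_iff.1 (D.isStart h)).2,
              (List.getElem?_eq_some_iff.1 (D.isEnd h)).2]
            rfl
        rw [← hd, ← List.drop_eq_getElem_cons h1, ← List.drop_eq_getElem_cons, List.take_append_drop]
      · rw [hl]
        rcases h with h | h
        · rw [(List.getElem?_eq_some_iff.1 (D.isStart h)).2]
          exact h
        · rw [(List.getElem?_eq_some_iff.1 (D.isEnd h)).2]
          exact h
    generalize u.take i = p at e h
    subst e
    have := ih (p ++ q) (by simp at hu ⊢; omega) (D.removeCap h)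
    rw [← capD_comp_removeCap D h]
    rw [hom_comp_of_loops (X := ⟨p ++ a :: a.dual :: q⟩) (Y := ⟨p ++ q⟩) (Z := ⟨[]⟩)
      (loops_capD_left _)]
    exact .comp (.cap _ _ _) this

theorem generated_hom : ∀ (v u : List Letter) (D : Diagram u v),
    Generated (d := d) (D.hom : (⟨u⟩ : Obj d) ⟶ ⟨v⟩)
  | [], u, D => generated_hom_nil u.length u le_rfl D
  | a :: v, u, D => by
    rw [← cupD_comp_bend D, hom_comp_of_loops (X := ⟨u⟩) (Y := ⟨a :: a.dual :: u⟩) (Z := ⟨a :: v⟩)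
      (loops_cupD_bend D)]
    refine .comp (.cup _ _ _) ?_
    have := (generated_hom v (a.dual :: u) D.bend).tensor a
    have e : (⟨[a]⟩ : Obj d) ◁ (D.bend.hom : (⟨a.dual :: u⟩ : Obj d) ⟶ ⟨v⟩) =
        (((Diagram.id [a]).juxta D.bend).hom : (⟨a :: a.dual :: u⟩ : Obj d) ⟶ ⟨a :: v⟩) :=
      hom_tensorHom_hom (X := ⟨[a]⟩) (Y := ⟨[a]⟩) _ _
    rwa [e] at this

/-- Every morphism is generated by the basic arcs. -/
theorem generated {X Y : Obj d} (f : X ⟶ Y) : Generated f :=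
  hom_induction f (.zero _ _) (fun _ _ => .add) (fun c _ => .smul c) fun D => generated_hom _ _ D

end Generation
end OrientedKauffman

/-! ### Labellings of words, and the weight of a diagram -/

namespace OrientedKauffman

section Labels

variable {ι : Type*} {u v w : List Letter}

/-- Labellings of the letters of the word `u` by elements of `ι`. -/
abbrev Idx (ι : Type*) (u : List Letter) : Type _ := List.Vector ι u.length

/-- Juxtaposition of labellings. -/
def Idx.app (I : Idx ι u) (J : Idx ι v) : Idx ι (u ++ v) := ⟨I.1 ++ J.1, by simp [I.2, J.2]⟩

/-- The labelling of the empty word. -/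
def Idx.nil : Idx ι [] := ⟨[], rfl⟩

/-- The labelling of a one-letter word. -/
def Idx.one {a : Letter} (i : ι) : Idx ι [a] := ⟨[i], rfl⟩

/-- The labelling of a two-letter word. -/
def Idx.two {a b : Letter} (i j : ι) : Idx ι [a, b] := ⟨[i, j], rfl⟩

/-- A labelling of a juxtaposition is a pair of labellings. -/
def Idx.appEquiv (u v : List Letter) : Idx ι u × Idx ι v ≃ Idx ι (u ++ v) where
  toFun x := x.1.app x.2
  invFun K := (⟨K.1.take u.length, by simp [K.2]⟩, ⟨K.1.drop u.length, by simp [K.2]⟩)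
  left_inv := by
    rintro ⟨⟨I, hI⟩, ⟨J, hJ⟩⟩
    refine Prod.ext (Subtype.ext ?_) (Subtype.ext ?_)
    · change (I ++ J).take u.length = I
      rw [← hI, List.take_left]
    · change (I ++ J).drop u.length = J
      rw [← hI, List.drop_left]
  right_inv K := Subtype.ext (List.take_append_drop _ _)

theorem Idx.app_inj {I I' : Idx ι u} {J J' : Idx ι v} : I.app J = I'.app J' ↔ I = I' ∧ J = J' := by
  rw [← Prod.mk.injEq]
  exact (Idx.appEquiv u v).injective.eq_iff (a := (I, J)) (b := (I', J'))

theorem Idx.exists_app (K : Idx ι (u ++ v)) : ∃ (I : Idx ι u) (J : Idx ι v), K = I.app J :=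
  ⟨_, _, ((Idx.appEquiv u v).right_inv K).symm⟩

theorem Idx.exists_one {a : Letter} (I : Idx ι [a]) : ∃ i, I = Idx.one i := by
  obtain ⟨l, h⟩ := I
  obtain ⟨i, rfl⟩ := List.length_eq_one_iff.1 h
  exact ⟨i, rfl⟩

theorem Idx.one_inj {a : Letter} {i j : ι} : (Idx.one i : Idx ι [a]) = Idx.one j ↔ i = j :=
  ⟨fun h => by simpa [Idx.one] using congrArg Subtype.val h, fun h => h ▸ rfl⟩

theorem Idx.eq_nil (I : Idx ι []) : I = Idx.nil := by
  obtain ⟨l, h⟩ := I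
  exact Subtype.ext (List.length_eq_zero_iff.1 h)

instance : Unique (Idx ι []) := ⟨⟨Idx.nil⟩, Idx.eq_nil⟩

theorem Idx.one_bijective (a : Letter) : Function.Bijective (Idx.one : ι → Idx ι [a]) :=
  ⟨fun _ _ => Idx.one_inj.1, fun I => (Idx.exists_one I).imp fun _ h => h.symm⟩

theorem Idx.exists_two {a b : Letter} (I : Idx ι [a, b]) : ∃ i j, I = Idx.two i j := by
  obtain ⟨I, J, rfl⟩ := Idx.exists_app (u := [a]) (v := [b]) I
  obtain ⟨i, rfl⟩ := I.exists_one
  obtain ⟨j, rfl⟩ := J.exists_one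
  exact ⟨i, j, rfl⟩

variable [Fintype ι] {M : Type*} [AddCommMonoid M]

theorem Idx.sum_app (F : Idx ι (u ++ v) → M) :
    ∑ K, F K = ∑ I : Idx ι u, ∑ J : Idx ι v, F (I.app J) := by
  rw [← (Idx.appEquiv u v).sum_comp, Fintype.sum_prod_type]
  rfl

theorem Idx.sum_nil (F : Idx ι [] → M) : ∑ K, F K = F Idx.nil := Fintype.sum_unique F

theorem Idx.sum_one {a : Letter} (F : Idx ι [a] → M) : ∑ K, F K = ∑ i, F (Idx.one i) :=
  ((Idx.one_bijective a).sum_comp F).symm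

theorem Idx.sum_two {a b : Letter} (F : Idx ι [a, b] → M) :
    ∑ K, F K = ∑ i, ∑ j, F (Idx.two i j) := by
  exact (Idx.sum_app (u := [a]) (v := [b]) F).trans ((Idx.sum_one _).trans
    (Finset.sum_congr rfl fun i _ => Idx.sum_one _))

end Labels

section Model

variable {ι : Type*} [Fintype ι] [DecidableEq ι] {u v w u' v' : List Letter}

/-- The labels of the terminal points, given by labellings of the two words.  Points that do not
belong to the words get the default label; no string ends there. -/
def lab [Inhabited ι] (I K : List ι) : Pt → ι
  | .up i => I.getD i default
  | .lo j => K.getD j default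

/-- `1` for a lower point, `0` for an upper one. -/
def Pt.lower : Pt → ℤ
  | .up _ => 0
  | .lo _ => 1

/-- The power of the matrix that is attached to a string from `x` to `y`: a rotation number.  It is
`0` on vertical strings and on arcs from left to right, `1` on upper arcs from right to left, which
turn clockwise, and `-1` on lower arcs from right to left, which turn counterclockwise.  Arcs from
left to right are normalized to `0` so that half turns need no fractions; an upper and a lower arc
in the same direction, which compose to a vertical string, have sum `0` in either case.  In terms of
the positions `key` along the boundary, one formula covers all cases. -/
def expo (x y : Pt) : ℤ := (if x.key < y.key then 1 else 0) - y.lower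

/-- The strings of a diagram, as pairs of terminal points. -/
def Diagram.arcSet (D : Diagram u v) : Set (Pt × Pt) := {x | D.arc x.1 x.2}

theorem Diagram.finite_arcSet (D : Diagram u v) : D.arcSet.Finite := by
  have h : {y | ∃ x, D.arc x y}.Finite := by
    refine ((place_finite 0 1 D).preimage
      (emb_injective (a := 0) (b := 1) (by decide)).injOn).subset ?_
    rintro y ⟨x, h⟩
    exact ⟨_, x, y, h, rfl, rfl⟩
  refine Set.Finite.of_finite_image (f := Prod.snd) (h.subset ?_) ?_
  · rintro _ ⟨x, hx, rfl⟩
    exact ⟨_, hx⟩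
  · rintro ⟨x, y⟩ hx ⟨x', y'⟩ hy (rfl : y = y')
    exact Prod.ext (D.in_unique hx hy) rfl

/-- The matrix entry attached to a string. -/
noncomputable def wt (C : GL ι ℂ) (l : Pt → ι) (x : Pt × Pt) : ℂ :=
  ((C ^ expo x.1 x.2 : GL ι ℂ) : Matrix ι ι ℂ) (l x.1) (l x.2)

/-- The product of the matrix entries attached to the strings of a labelled diagram. -/
noncomputable def weight (C : GL ι ℂ) (D : Diagram u v) (l : Pt → ι) : ℂ :=
  ∏ᶠ (x) (_ : x ∈ D.arcSet), wt C l x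

/-- The matrix of a diagram. -/
noncomputable def mat [Inhabited ι] (C : GL ι ℂ) (D : Diagram u v) :
    Matrix (Idx ι v) (Idx ι u) ℂ :=
  fun K I => weight C D (lab I.1 K.1)

theorem weight_congr {C : GL ι ℂ} {D : Diagram u v} {l l' : Pt → ι}
    (h : ∀ x, x.Inside u.length v.length → l x = l' x) : weight C D l = weight C D l' := by
  refine finprod_mem_congr rfl fun x hx => ?_
  rw [wt, wt, h _ (D.isStart hx).inside, h _ (D.isEnd hx).inside]

theorem expo_of_key {x y x' y' : Pt} (h : x.key < y.key ↔ x'.key < y'.key)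
    (h' : y.lower = y'.lower) : expo x y = expo x' y' := by
  simp only [expo, h, h']

theorem expo_shift (m n : ℕ) (x y : Pt) : expo (x.shift m n) (y.shift m n) = expo x y := by
  apply expo_of_key
  · cases x <;> cases y <;> simp only [Pt.shift, Pt.key] <;> omega
  · cases y <;> rfl

theorem expo_skipLo (k : ℕ) (x y : Pt) : expo (x.skipLo k) (y.skipLo k) = expo x y := by
  apply expo_of_key Pt.key_skipLo_lt
  cases y <;> rfl

theorem weight_juxta (C : GL ι ℂ) (D : Diagram u v) (E : Diagram u' v') (l : Pt → ι) :
    weight C (D.juxta E) l = weight C D l * weight C E (l ∘ Pt.shift u.length v.length) := by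
  have e : (D.juxta E).arcSet = D.arcSet ∪
      Prod.map (Pt.shift u.length v.length) (Pt.shift u.length v.length) '' E.arcSet := by
    ext ⟨x, y⟩
    constructor
    · rintro (h | ⟨x, y, h, rfl, rfl⟩)
      · exact .inl h
      · exact .inr ⟨(x, y), h, rfl⟩
    · rintro (h | ⟨⟨x, y⟩, h, h'⟩)
      · exact .inl h
      · cases h'
        exact .inr ⟨x, y, h, rfl, rfl⟩
  have hd : Disjoint D.arcSet
      (Prod.map (Pt.shift u.length v.length) (Pt.shift u.length v.length) '' E.arcSet) := by
    rw [Set.disjoint_left]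
    rintro _ h ⟨⟨x, y⟩, h', rfl⟩
    exact not_inside_shift (D.isStart h).inside
  rw [weight, e, finprod_mem_union hd D.finite_arcSet (E.finite_arcSet.image _),
    finprod_mem_image ((Pt.shift_injective _ _).prodMap (Pt.shift_injective _ _)).injOn]
  congr 1
  refine finprod_mem_congr rfl fun x _ => ?_
  simp only [wt, Prod.map_fst, Prod.map_snd, expo_shift, Function.comp]

theorem weight_of_arc {C : GL ι ℂ} {D : Diagram u v} {l : Pt → ι} {x y : Pt}
    (h : ∀ x' y', D.arc x' y' ↔ x' = x ∧ y' = y) :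
    weight C D l = ((C ^ expo x y : GL ι ℂ) : Matrix ι ι ℂ) (l x) (l y) := by
  have : D.arcSet = {(x, y)} := by
    ext ⟨x', y'⟩
    rw [Set.mem_singleton_iff, Prod.mk.injEq]
    exact h x' y'
  rw [weight, this, finprod_mem_singleton]
  rfl

variable {a : Letter} {p q : List Letter}

/-- The exponents are additive when strings are joined by a cap.  This is where planarity enters:
the string from `x` and the string to `y` do not cross, which excludes the orders of the points
along the boundary in which the two sides differ. -/
theorem expo_join (D : Diagram u (p ++ a :: a.dual :: q)) {x y : Pt}
    (hx : D.arc (x.skipLo p.length) (.lo (p.length + a.posX)))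
    (hy : D.arc (.lo (p.length + a.posXstar)) (y.skipLo p.length)) :
    expo x y = expo (x.skipLo p.length) (.lo (p.length + a.posX)) +
      expo (.up a.posX) (.up a.posXstar) +
      expo (.lo (p.length + a.posXstar)) (y.skipLo p.length) := by
  have g1 := D.noncrossing (.inl hx) (.inl hy)
  have g2 := D.noncrossing (.inl hx) (.inr hy)
  have g3 := D.noncrossing (.inr hx) (.inl hy)
  have g6 := D.noncrossing (.inr hy) (.inl hx)
  have g7 := D.noncrossing (.inl hy) (.inr hx)
  have g8 := D.noncrossing (.inr hy) (.inr hx)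
  have hne : x.key ≠ y.key := by
    intro h
    have : x = y := by
      cases x <;> cases y <;> simp only [Pt.key, Pt.up.injEq, Pt.lo.injEq] at h ⊢ <;> omega
    subst this
    exact not_start_end (D.isStart hx) (D.isEnd hy)
  have hne' : (x.skipLo p.length).key ≠ (y.skipLo p.length).key := by
    have h1 := Pt.key_skipLo_lt (k := p.length) (x := x) (y := y)
    have h2 := Pt.key_skipLo_lt (k := p.length) (x := y) (y := x)
    omega
  have outside : ∀ z : Pt, (z.skipLo p.length).key < p.length ∨
      p.length + 1 < (z.skipLo p.length).key := by
    rintro (i | i)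
    · simp only [Pt.skipLo, Pt.key]
      omega
    · simp only [Pt.skipLo, Pt.key, del]
      split_ifs <;> omega
  have hx1 := outside x
  have hy1 := outside y
  rw [← expo_skipLo p.length x y]
  clear hx hy hne outside
  have e1 : ∀ i, (Pt.up i).lower = 0 := fun _ => rfl
  have e2 : ∀ i, (Pt.lo i).lower = 1 := fun _ => rfl
  simp only [expo, e1, e2]
  generalize (x.skipLo p.length).key = X at *
  generalize (y.skipLo p.length).key = Y at *
  generalize (y.skipLo p.length).lower = Z at *
  cases a
  · clear g1 g6 g7
    simp only [Letter.posX, Letter.posXstar, Pt.key] at *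
    push_cast at *
    rcases hx1 with hx1 | hx1 <;> rcases hy1 with hy1 | hy1 <;> split_ifs <;> omega
  · clear g2 g3 g8
    simp only [Letter.posX, Letter.posXstar, Pt.key] at *
    push_cast at *
    rcases hx1 with hx1 | hx1 <;> rcases hy1 with hy1 | hy1 <;> split_ifs <;> omega

/-- Capping off two adjacent lower points corresponds to a contraction of tensors.  If the two
points are joined by a string, the contraction is the trace of `C` or of `C⁻¹`, depending on the
orientation of the closed loop; otherwise it is a product of powers of `C`. -/
theorem sum_weight_capD {d : ℂ} {C : GL ι ℂ} (h1 : Matrix.trace (C : Matrix ι ι ℂ) = d)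
    (h2 : Matrix.trace ((C⁻¹ : GL ι ℂ) : Matrix ι ι ℂ) = d) (D : Diagram u (p ++ a :: a.dual :: q))
    (l : ι → ι → Pt → ι) (l' : Pt → ι) (hl : ∀ s t x, l s t (Pt.skipLo p.length x) = l' x)
    (hs : ∀ s t, l s t (.lo (p.length + a.posX)) = s)
    (ht : ∀ s t, l s t (.lo (p.length + a.posXstar)) = t) :
    ∑ s, ∑ t, ((C ^ expo (.up a.posX) (.up a.posXstar) : GL ι ℂ) : Matrix ι ι ℂ) s t *
      weight C D (l s t) = d ^ loops D (capD a p q) * weight C (D.comp (capD a p q)) l' := by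
  set k := p.length with hk
  set S : Pt := .lo (k + a.posX) with hS
  set T : Pt := .lo (k + a.posXstar) with hT
  have inj : Function.Injective (Prod.map (Pt.skipLo k) (Pt.skipLo k)) :=
    (Pt.skipLo_injective k).prodMap (Pt.skipLo_injective k)
  have wt_skip : ∀ s t x, wt C (l s t) (Prod.map (Pt.skipLo k) (Pt.skipLo k) x) = wt C l' x := by
    intro s t x
    simp only [wt, Prod.map_fst, Prod.map_snd, expo_skipLo, hl]
  have skipS : ∀ x : Pt, x.skipLo k ≠ S := by
    rintro (i | i) h
    · exact Pt.noConfusion h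
    · exact del_ne_posX a k i (Pt.lo.inj h)
  have skipT : ∀ x : Pt, x.skipLo k ≠ T := by
    rintro (i | i) h
    · exact Pt.noConfusion h
    · exact del_ne_posXstar a k i (Pt.lo.inj h)
  set R : Set (Pt × Pt) := {x | D.arc (x.1.skipLo k) (x.2.skipLo k)} with hR
  have hRf : R.Finite := by
    refine (D.finite_arcSet.preimage inj.injOn).subset ?_
    exact fun x hx => hx
  by_cases hloop : D.arc T S
  · -- the two points are joined by a string, which becomes a closed loop
    rw [loops_capD_of_arc hloop, pow_one]
    have e1 : D.arcSet = insert (T, S) (Prod.map (Pt.skipLo k) (Pt.skipLo k) '' R) := by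
      ext ⟨x, y⟩
      constructor
      · intro h
        rcases eq_or_exists_skipLo a k x with rfl | rfl | ⟨x, rfl⟩
        · exact (not_start_end (D.isStart h) (D.isEnd hloop)).elim
        · exact .inl (Prod.ext rfl (D.out_unique h hloop))
        · rcases eq_or_exists_skipLo a k y with rfl | rfl | ⟨y, rfl⟩
          · exact (skipT _ (D.in_unique h hloop)).elim
          · exact (not_start_end (D.isStart hloop) (D.isEnd h)).elim
          · exact .inr ⟨(x, y), h, rfl⟩
      · rintro (h | ⟨⟨x, y⟩, h, h'⟩)
        · cases h
          exact hloop
        · cases h'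
          exact h
    have e2 : (D.comp (capD a p q)).arcSet = R := by
      ext ⟨x, y⟩
      refine (comp_capD_arc D).trans (or_iff_left ?_)
      rintro ⟨h, -⟩
      exact skipT _ (D.in_unique h hloop)
    have e3 : ∀ s t, weight C D (l s t) =
        ((C ^ expo T S : GL ι ℂ) : Matrix ι ι ℂ) t s * weight C (D.comp (capD a p q)) l' := by
      intro s t
      rw [weight, e1, finprod_mem_insert _ _ (hRf.image _), finprod_mem_image inj.injOn, weight, e2]
      · simp only [wt_skip]
        congr 1
        rw [wt, ht, hs]
      · rintro ⟨⟨x, y⟩, -, h⟩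
        exact skipT x (congrArg Prod.fst h)
    simp only [e3, ← mul_assoc, ← Finset.sum_mul]
    congr 1
    have : ∑ s, ∑ t, ((C ^ expo (.up a.posX) (.up a.posXstar) : GL ι ℂ) : Matrix ι ι ℂ) s t *
        ((C ^ expo T S : GL ι ℂ) : Matrix ι ι ℂ) t s =
        Matrix.trace ((C ^ (expo (.up a.posX) (.up a.posXstar) + expo T S) : GL ι ℂ) :
          Matrix ι ι ℂ) := by
      rw [zpow_add]
      rfl
    rw [this]
    cases a
    · have : expo (.up Letter.X.posX) (.up Letter.X.posXstar) + expo T S = -1 := by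
        simp [expo, Pt.key, Pt.lower, hS, hT, Letter.posX, Letter.posXstar]
      rw [this, zpow_neg_one, h2]
    · have : expo (.up Letter.Xstar.posX) (.up Letter.Xstar.posXstar) + expo T S = 1 := by
        simp [expo, Pt.key, Pt.lower, hS, hT, Letter.posX, Letter.posXstar]
      rw [this, zpow_one, h1]
  · -- the strings that end at the two points are joined to a string from `x₀` to `y₀`
    rw [loops_capD_of_not_arc hloop, pow_zero, one_mul]
    obtain ⟨x₀, hx₀⟩ : ∃ x, D.arc (Pt.skipLo k x) S := by
      obtain ⟨z, hz⟩ := D.exists_in (q := S) getElem?_posX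
      rcases eq_or_exists_skipLo a k z with rfl | rfl | ⟨x, rfl⟩
      · exact (not_start_end (D.isStart hz) (D.isEnd hz)).elim
      · exact (hloop hz).elim
      · exact ⟨x, hz⟩
    obtain ⟨y₀, hy₀⟩ : ∃ y, D.arc T (Pt.skipLo k y) := by
      obtain ⟨z, hz⟩ := D.exists_out (p := T) getElem?_posXstar
      rcases eq_or_exists_skipLo a k z with rfl | rfl | ⟨x, rfl⟩
      · exact (hloop hz).elim
      · exact (not_start_end (D.isStart hz) (D.isEnd hz)).elim
      · exact ⟨x, hz⟩
    have e1 : D.arcSet = insert (x₀.skipLo k, S) (insert (T, y₀.skipLo k)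
        (Prod.map (Pt.skipLo k) (Pt.skipLo k) '' R)) := by
      ext ⟨x, y⟩
      constructor
      · intro h
        rcases eq_or_exists_skipLo a k x with rfl | rfl | ⟨x, rfl⟩
        · exact (not_start_end (D.isStart h) (D.isEnd hx₀)).elim
        · exact .inr (.inl (Prod.ext rfl (D.out_unique h hy₀)))
        · rcases eq_or_exists_skipLo a k y with rfl | rfl | ⟨y, rfl⟩
          · exact .inl (Prod.ext (D.in_unique h hx₀) rfl)
          · exact (not_start_end (D.isStart hy₀) (D.isEnd h)).elim
          · exact .inr (.inr ⟨(x, y), h, rfl⟩)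
      · rintro (h | h | ⟨⟨x, y⟩, h, h'⟩)
        · cases h
          exact hx₀
        · cases h
          exact hy₀
        · cases h'
          exact h
    have e2 : (D.comp (capD a p q)).arcSet = insert (x₀, y₀) R := by
      ext ⟨x, y⟩
      refine (comp_capD_arc D).trans ?_
      constructor
      · rintro (h | ⟨h, h'⟩)
        · exact .inr h
        · exact .inl (Prod.ext (Pt.skipLo_injective k (D.in_unique h hx₀))
            (Pt.skipLo_injective k (D.out_unique h' hy₀)))
      · rintro (h | h)
        · cases h
          exact .inr ⟨hx₀, hy₀⟩
        · exact .inl h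
    have e3 : ∀ s t, weight C D (l s t) =
        ((C ^ expo (x₀.skipLo k) S : GL ι ℂ) : Matrix ι ι ℂ) (l' x₀) s *
        (((C ^ expo T (y₀.skipLo k) : GL ι ℂ) : Matrix ι ι ℂ) t (l' y₀) *
          ∏ᶠ (x) (_ : x ∈ R), wt C l' x) := by
      intro s t
      rw [weight, e1, finprod_mem_insert _ _ ((hRf.image _).insert _),
        finprod_mem_insert _ _ (hRf.image _), finprod_mem_image inj.injOn]
      · simp only [wt_skip]
        rw [wt, wt, ht, hs, hl, hl]
      · rintro ⟨⟨x, y⟩, -, h⟩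
        exact skipT x (congrArg Prod.fst h)
      · rintro (h | ⟨⟨x, y⟩, -, h⟩)
        · exact skipT _ (congrArg Prod.fst h)
        · exact skipS y (congrArg Prod.snd h)
    have e4 : weight C (D.comp (capD a p q)) l' =
        ((C ^ expo x₀ y₀ : GL ι ℂ) : Matrix ι ι ℂ) (l' x₀) (l' y₀) *
          ∏ᶠ (x) (_ : x ∈ R), wt C l' x := by
      rw [weight, e2, finprod_mem_insert _ _ hRf]
      · rfl
      · intro h
        exact skipS _ (D.out_unique h hx₀)
    have e5 := expo_join D hx₀ hy₀
    rw [e4, e5]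
    simp only [e3, zpow_add, Units.val_mul, Matrix.mul_apply, Finset.sum_mul]
    rw [Finset.sum_comm]
    refine Finset.sum_congr rfl fun s _ => Finset.sum_congr rfl fun t _ => ?_
    ring

theorem weight_comp_cupD (C : GL ι ℂ) (D : Diagram u (p ++ q)) (l : Pt → ι) :
    weight C (D.comp (cupD a p q)) l =
      ((C ^ expo (.lo a.posXstar) (.lo a.posX) : GL ι ℂ) : Matrix ι ι ℂ)
        (l (.lo (p.length + a.posXstar))) (l (.lo (p.length + a.posX))) *
      weight C D (l ∘ Pt.skipLo p.length) := by
  have inj : Function.Injective (Prod.map (Pt.skipLo p.length) (Pt.skipLo p.length)) :=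
    (Pt.skipLo_injective _).prodMap (Pt.skipLo_injective _)
  have e : (D.comp (cupD a p q)).arcSet =
      insert (.lo (p.length + a.posXstar), .lo (p.length + a.posX))
        (Prod.map (Pt.skipLo p.length) (Pt.skipLo p.length) '' D.arcSet) := by
    ext ⟨x, y⟩
    refine (comp_cupD_arc D).trans ?_
    constructor
    · rintro (⟨x, y, h, rfl, rfl⟩ | ⟨rfl, rfl⟩)
      · exact .inr ⟨(x, y), h, rfl⟩
      · exact .inl rfl
    · rintro (h | ⟨⟨x, y⟩, h, h'⟩)
      · cases h
        exact .inr ⟨rfl, rfl⟩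
      · cases h'
        exact .inl ⟨x, y, h, rfl, rfl⟩
  rw [weight, e, finprod_mem_insert _ _ (D.finite_arcSet.image _), finprod_mem_image inj.injOn]
  · congr 1
    · rw [wt]
      have : expo (.lo (p.length + a.posXstar)) (.lo (p.length + a.posX)) =
          expo (.lo a.posXstar) (.lo a.posX) := by
        refine expo_of_key ?_ rfl
        simp only [Pt.key]
        omega
      rw [this]
    · refine finprod_mem_congr rfl fun x _ => ?_
      simp only [wt, Prod.map_fst, Prod.map_snd, expo_skipLo, Function.comp]
  · rintro ⟨⟨x | x, y⟩, -, h⟩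
    · cases congrArg Prod.fst h
    · exact del_ne_posXstar a _ _ (Pt.lo.inj (congrArg Prod.fst h))

end Model
end OrientedKauffman

/-! ### The matrix of a diagram -/

namespace OrientedKauffman

section PairLabels

variable {ι : Type*} {u v : List Letter} {a : Letter} {p q : List Letter}

theorem Idx.one_apply_app [DecidableEq ι] (K I : Idx ι u) (K' I' : Idx ι v) :
    (1 : Matrix (Idx ι (u ++ v)) (Idx ι (u ++ v)) ℂ) (K.app K') (I.app I') =
      (1 : Matrix (Idx ι u) (Idx ι u) ℂ) K I * (1 : Matrix (Idx ι v) (Idx ι v) ℂ) K' I' := by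
  simp only [Matrix.one_apply, Idx.app_inj]
  by_cases h : K = I <;> by_cases h' : K' = I' <;> simp [h, h']

/-- The labelling of `a a*` with the label `s` at `X` and the label `t` at `X*`. -/
def Idx.pair : ∀ {a : Letter}, ι → ι → Idx ι [a, a.dual]
  | .X, s, t => Idx.two s t
  | .Xstar, s, t => Idx.two t s

theorem Idx.exists_pair {a : Letter} (I : Idx ι [a, a.dual]) : ∃ s t, I = Idx.pair s t := by
  obtain ⟨i, j, rfl⟩ := I.exists_two
  cases a
  · exact ⟨i, j, rfl⟩
  · exact ⟨j, i, rfl⟩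

theorem Idx.sum_pair [Fintype ι] {M : Type*} [AddCommMonoid M] {a : Letter}
    (F : Idx ι [a, a.dual] → M) :
    ∑ K, F K = ∑ s, ∑ t, F (Idx.pair s t) := by
  rw [Idx.sum_two]
  cases a
  · rfl
  · exact Finset.sum_comm

/-- Insert the labels of two letters between those of the words `p` and `q`. -/
def Idx.ins (P : Idx ι p) (J : Idx ι [a, a.dual]) (Q : Idx ι q) : Idx ι (p ++ a :: a.dual :: q) :=
  P.app (J.app Q)

theorem Idx.sum_ins [Fintype ι] {M : Type*} [AddCommMonoid M]
    (F : Idx ι (p ++ a :: a.dual :: q) → M) :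
    ∑ K, F K = ∑ P : Idx ι p, ∑ Q : Idx ι q, ∑ s, ∑ t, F (P.ins (Idx.pair s t) Q) := by
  refine (Idx.sum_app (u := p) (v := [a, a.dual] ++ q) F).trans (Finset.sum_congr rfl fun P _ => ?_)
  refine (Idx.sum_app (u := [a, a.dual]) (v := q) _).trans (Finset.sum_comm.trans ?_)
  exact Finset.sum_congr rfl fun Q _ => Idx.sum_pair _

variable [Inhabited ι]

theorem getD_del (P Q : List ι) (x y : ι) (j : ℕ) :
    (P ++ x :: y :: Q).getD (del P.length j) default = (P ++ Q).getD j default := by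
  unfold del
  split_ifs with h
  · rw [List.getD_append _ _ _ _ h, List.getD_append _ _ _ _ h]
  · rw [List.getD_append_right _ _ _ _ (by omega), List.getD_append_right _ _ _ _ (by omega),
      show j + 2 - P.length = j - P.length + 1 + 1 by omega]
    rfl

theorem lab_ins_skipLo (I : List ι) (P : Idx ι p) (Q : Idx ι q) (s t : ι) (x : Pt) :
    lab I (P.ins (Idx.pair (a := a) s t) Q).1 (x.skipLo p.length) = lab I (P.app Q).1 x := by
  rw [← P.2]
  cases x with
  | up i => rfl
  | lo i => cases a <;> exact getD_del P.1 Q.1 _ _ i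

theorem lab_ins_posX (I : List ι) (P : Idx ι p) (Q : Idx ι q) (s t : ι) :
    lab I (P.ins (Idx.pair (a := a) s t) Q).1 (.lo (p.length + a.posX)) = s := by
  have : ∀ (J : List ι) (k : ℕ), (P.1 ++ J).getD (p.length + k) default = J.getD k default := by
    intro J k
    rw [List.getD_append_right _ _ _ _ (by rw [P.2]; omega), P.2, Nat.add_sub_cancel_left]
  refine (this _ _).trans ?_
  cases a <;> rfl

theorem lab_ins_posXstar (I : List ι) (P : Idx ι p) (Q : Idx ι q) (s t : ι) :
    lab I (P.ins (Idx.pair (a := a) s t) Q).1 (.lo (p.length + a.posXstar)) = t := by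
  have : ∀ (J : List ι) (k : ℕ), (P.1 ++ J).getD (p.length + k) default = J.getD k default := by
    intro J k
    rw [List.getD_append_right _ _ _ _ (by rw [P.2]; omega), P.2, Nat.add_sub_cancel_left]
  refine (this _ _).trans ?_
  cases a <;> rfl

end PairLabels

section ModelMatrix

variable {ι : Type*} [Fintype ι] [DecidableEq ι] [Inhabited ι] {u v w u' v' : List Letter}

theorem mat_juxta (C : GL ι ℂ) (D : Diagram u v) (E : Diagram u' v') (I : Idx ι u) (I' : Idx ι u')
    (K : Idx ι v) (K' : Idx ι v') :
    mat C (D.juxta E) (K.app K') (I.app I') = mat C D K I * mat C E K' I' := by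
  rw [mat, weight_juxta]
  congr 1
  · refine weight_congr ?_
    rintro (i | j) h
    · exact List.getD_append _ _ _ _ (h.trans_eq I.2.symm)
    · exact List.getD_append _ _ _ _ (h.trans_eq K.2.symm)
  · refine weight_congr ?_
    rintro (i | j) -
    · change (I.1 ++ I'.1).getD (u.length + i) default = I'.1.getD i default
      rw [List.getD_append_right _ _ _ _ (by rw [I.2]; omega), I.2, Nat.add_sub_cancel_left]
    · change (K.1 ++ K'.1).getD (v.length + j) default = K'.1.getD j default
      rw [List.getD_append_right _ _ _ _ (by rw [K.2]; omega), K.2, Nat.add_sub_cancel_left]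

theorem mat_id_nil (C : GL ι ℂ) (K I : Idx ι []) : mat C (Diagram.id []) K I = 1 := by
  have : (Diagram.id []).arcSet = ∅ := by
    rw [Set.eq_empty_iff_forall_notMem]
    rintro x ⟨i, ⟨h, -⟩ | ⟨h, -⟩⟩ <;> simp at h
  rw [mat, weight, this, finprod_mem_empty]

theorem mat_id_one (C : GL ι ℂ) (a : Letter) (i j : ι) :
    mat C (Diagram.id [a]) (Idx.one i) (Idx.one j) = (1 : Matrix ι ι ℂ) i j := by
  cases a with
  | X =>
    rw [mat, weight_of_arc (x := .up 0) (y := .lo 0)]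
    · change (1 : Matrix ι ι ℂ) j i = _
      simp only [Matrix.one_apply, eq_comm]
    · intro x y
      constructor
      · rintro ⟨_ | i, ⟨h, rfl, rfl⟩ | ⟨h, rfl, rfl⟩⟩ <;> simp at h
        exact ⟨rfl, rfl⟩
      · rintro ⟨rfl, rfl⟩
        exact ⟨0, .inl ⟨rfl, rfl, rfl⟩⟩
  | Xstar =>
    rw [mat, weight_of_arc (x := .lo 0) (y := .up 0)]
    · rfl
    · intro x y
      constructor
      · rintro ⟨_ | i, ⟨h, rfl, rfl⟩ | ⟨h, rfl, rfl⟩⟩ <;> simp at h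
        exact ⟨rfl, rfl⟩
      · rintro ⟨rfl, rfl⟩
        exact ⟨0, .inr ⟨rfl, rfl, rfl⟩⟩

theorem mat_id (C : GL ι ℂ) : ∀ u : List Letter, mat C (Diagram.id u) = 1
  | [] => by
    ext K I
    rw [mat_id_nil, Subsingleton.elim K I, Matrix.one_apply_eq]
  | a :: u => by
    ext K I
    obtain ⟨K₁, K, rfl⟩ := Idx.exists_app (u := [a]) K
    obtain ⟨I₁, I, rfl⟩ := Idx.exists_app (u := [a]) I
    obtain ⟨i, rfl⟩ := K₁.exists_one
    obtain ⟨j, rfl⟩ := I₁.exists_one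
    have : Diagram.id (a :: u) = (Diagram.id [a]).juxta (Diagram.id u) :=
      (juxta_id (u := [a])).symm
    rw [this]
    refine (mat_juxta C _ _ _ _ _ _).trans ?_
    rw [mat_id_one, mat_id C u]
    refine Eq.trans ?_ (Idx.one_apply_app _ _ _ _).symm
    congr 1
    simp only [Matrix.one_apply, Idx.one_inj]

theorem mat_capArc (C : GL ι ℂ) (a : Letter) (K : Idx ι []) (s t : ι) :
    mat C (capArc a) K (Idx.pair s t) =
      ((C ^ expo (.up a.posX) (.up a.posXstar) : GL ι ℂ) : Matrix ι ι ℂ) s t := by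
  rw [mat, weight_of_arc fun x y => capArc_arc]
  cases a <;> rfl

theorem mat_cupArc (C : GL ι ℂ) (a : Letter) (I : Idx ι []) (s t : ι) :
    mat C (cupArc a) (Idx.pair s t) I =
      ((C ^ expo (.lo a.posXstar) (.lo a.posX) : GL ι ℂ) : Matrix ι ι ℂ) t s := by
  rw [mat, weight_of_arc fun x y => Iff.rfl]
  cases a <;> rfl

variable {a : Letter} {p q : List Letter}

theorem mat_capD (C : GL ι ℂ) (P P' : Idx ι p) (Q Q' : Idx ι q) (s t : ι) :
    mat C (capD a p q) (P'.app Q') (P.ins (Idx.pair s t) Q) =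
      (1 : Matrix (Idx ι p) (Idx ι p) ℂ) P' P *
        (((C ^ expo (.up a.posX) (.up a.posXstar) : GL ι ℂ) : Matrix ι ι ℂ) s t *
          (1 : Matrix (Idx ι q) (Idx ι q) ℂ) Q' Q) := by
  have h1 := mat_juxta C (Diagram.id p) ((capArc a).juxta (Diagram.id q)) P
    ((Idx.pair s t).app Q) P' (Idx.nil.app Q')
  have h2 := mat_juxta C (capArc a) (Diagram.id q) (Idx.pair s t) Q Idx.nil Q'
  rw [h2, mat_id, mat_id, mat_capArc] at h1
  exact h1

theorem mat_cupD (C : GL ι ℂ) (P P' : Idx ι p) (Q Q' : Idx ι q) (s t : ι) :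
    mat C (cupD a p q) (P'.ins (Idx.pair s t) Q') (P.app Q) =
      (1 : Matrix (Idx ι p) (Idx ι p) ℂ) P' P *
        (((C ^ expo (.lo a.posXstar) (.lo a.posX) : GL ι ℂ) : Matrix ι ι ℂ) t s *
          (1 : Matrix (Idx ι q) (Idx ι q) ℂ) Q' Q) := by
  have h1 := mat_juxta C (Diagram.id p) ((cupArc a).juxta (Diagram.id q)) P
    (Idx.nil.app Q) P' ((Idx.pair s t).app Q')
  have h2 := mat_juxta C (cupArc a) (Diagram.id q) Idx.nil Q (Idx.pair s t) Q'
  rw [h2, mat_id, mat_id, mat_cupArc] at h1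
  exact h1

theorem mat_comp_capD {d : ℂ} {C : GL ι ℂ} (h1 : Matrix.trace (C : Matrix ι ι ℂ) = d)
    (h2 : Matrix.trace ((C⁻¹ : GL ι ℂ) : Matrix ι ι ℂ) = d)
    (D : Diagram u (p ++ a :: a.dual :: q)) :
    d ^ loops D (capD a p q) • mat C (D.comp (capD a p q)) = mat C (capD a p q) * mat C D := by
  ext K I
  obtain ⟨P, Q, rfl⟩ := Idx.exists_app K
  rw [Matrix.mul_apply, Idx.sum_ins, Matrix.smul_apply, smul_eq_mul, mat]
  rw [← sum_weight_capD h1 h2 D (fun s t => lab I.1 (P.ins (Idx.pair s t) Q).1) _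
    (fun s t x => lab_ins_skipLo _ _ _ _ _ _) (fun s t => lab_ins_posX _ _ _ _ _)
    (fun s t => lab_ins_posXstar _ _ _ _ _)]
  simp only [mat_capD, Matrix.one_apply]
  rw [Finset.sum_eq_single_of_mem P (Finset.mem_univ _)
      (fun P' _ h => by simp [h.symm]),
    Finset.sum_eq_single_of_mem Q (Finset.mem_univ _) (fun Q' _ h => by simp [h.symm])]
  simp [mat]

theorem mat_comp_cupD (C : GL ι ℂ) (D : Diagram u (p ++ q)) :
    mat C (D.comp (cupD a p q)) = mat C (cupD a p q) * mat C D := by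
  ext K I
  obtain ⟨P, J, rfl⟩ := Idx.exists_app (u := p) (v := [a, a.dual] ++ q) K
  obtain ⟨J, Q, rfl⟩ := Idx.exists_app (u := [a, a.dual]) (v := q) J
  obtain ⟨s, t, rfl⟩ := J.exists_pair
  change mat C (D.comp (cupD a p q)) (P.ins (Idx.pair s t) Q) I =
    ∑ J, mat C (cupD a p q) (P.ins (Idx.pair s t) Q) J * mat C D J I
  rw [mat, weight_comp_cupD, lab_ins_posX, lab_ins_posXstar]
  refine Eq.trans ?_ (Idx.sum_app (u := p) (v := q) _).symm
  simp only [mat_cupD, Matrix.one_apply]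
  rw [Finset.sum_eq_single_of_mem P (Finset.mem_univ _)
      (fun P' _ h => by simp [h.symm]),
    Finset.sum_eq_single_of_mem Q (Finset.mem_univ _) (fun Q' _ h => by simp [h.symm])]
  simp only [if_true, one_mul, mul_one]
  congr 2
  funext x
  exact lab_ins_skipLo _ _ _ _ _ _

/-- The matrix of a linear combination of diagrams. -/
noncomputable def homMat {d : ℂ} (C : GL ι ℂ) {X Y : Obj d} :
    (X ⟶ Y) →ₗ[ℂ] Matrix (Idx ι Y.word) (Idx ι X.word) ℂ :=
  Finsupp.linearCombination ℂ (mat C : Diagram X.word Y.word → _)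

variable {d : ℂ} {X Y Z : Obj d}

theorem homMat_hom (C : GL ι ℂ) (D : Diagram X.word Y.word) :
    homMat C (D.hom : X ⟶ Y) = mat C D := by
  refine (Finsupp.linearCombination_single _ _ _).trans (one_smul _ _)

theorem homMat_id (C : GL ι ℂ) (X : Obj d) : homMat C (𝟙 X) = 1 :=
  (homMat_hom C (X := X) (Y := X) (Diagram.id X.word)).trans (mat_id C _)

/-- Functoriality: it suffices to compose with the generators. -/
theorem homMat_comp {C : GL ι ℂ} (h1 : Matrix.trace (C : Matrix ι ι ℂ) = d)
    (h2 : Matrix.trace ((C⁻¹ : GL ι ℂ) : Matrix ι ι ℂ) = d) (f : X ⟶ Y) (g : Y ⟶ Z) :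
    homMat C (f ≫ g) = homMat C g * homMat C f := by
  induction generated g generalizing X with
  | zero => simp
  | add _ _ ih ih' => simp only [Preadditive.comp_add, map_add, ih, ih', Matrix.add_mul]
  | smul c _ ih => simp only [Linear.comp_smul, map_smul, ih, Matrix.smul_mul]
  | id => rw [Category.comp_id, homMat_id, Matrix.one_mul]
  | comp _ _ ih ih' => rw [← Category.assoc, ih', ih, ih', Matrix.mul_assoc]
  | cap a p q =>
    induction f using hom_induction with
    | h0 => simp
    | hadd f g hf hg => simp only [Preadditive.add_comp, map_add, hf, hg, Matrix.mul_add]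
    | hsmul c f hf => simp only [Linear.smul_comp, map_smul, hf, Matrix.mul_smul]
    | h1 D =>
      rw [hom_comp_hom, map_smul, homMat_hom, homMat_hom, homMat_hom]
      exact mat_comp_capD h1 h2 D
  | cup a p q =>
    induction f using hom_induction with
    | h0 => simp
    | hadd f g hf hg => simp only [Preadditive.add_comp, map_add, hf, hg, Matrix.mul_add]
    | hsmul c f hf => simp only [Linear.smul_comp, map_smul, hf, Matrix.mul_smul]
    | h1 D =>
      rw [hom_comp_hom, map_smul, homMat_hom, homMat_hom, homMat_hom, loops_cupD, pow_zero,
        one_smul]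
      exact mat_comp_cupD C D

theorem homMat_tensorHom (C : GL ι ℂ) {X' Y' : Obj d} (f : X ⟶ Y) (g : X' ⟶ Y')
    (I : Idx ι X.word) (I' : Idx ι X'.word) (K : Idx ι Y.word) (K' : Idx ι Y'.word) :
    homMat C (f ⊗ₘ g) (K.app K') (I.app I') = homMat C f K I * homMat C g K' I' := by
  induction f using hom_induction with
  | h0 =>
    rw [zero_tensorHom, map_zero, map_zero]
    simp
  | hadd f f' hf hf' =>
    rw [add_tensorHom, map_add, map_add, Matrix.add_apply, Matrix.add_apply, hf, hf', add_mul]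
  | hsmul c f hf =>
    rw [smul_tensorHom, map_smul, map_smul, Matrix.smul_apply, Matrix.smul_apply, hf,
      smul_mul_assoc]
  | h1 D =>
    induction g using hom_induction with
    | h0 =>
      rw [tensorHom_zero, map_zero, map_zero]
      simp
    | hadd f f' hf hf' =>
      rw [tensorHom_add, map_add, map_add, Matrix.add_apply, Matrix.add_apply, hf, hf', mul_add]
    | hsmul c f hf =>
      rw [tensorHom_smul, map_smul, map_smul, Matrix.smul_apply, Matrix.smul_apply, hf,
        mul_smul_comm]
    | h1 E =>
      rw [hom_tensorHom_hom, homMat_hom, homMat_hom, homMat_hom]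
      exact mat_juxta C D E I I' K K'

end ModelMatrix
end OrientedKauffman

/-! ### The fiber functor of a matrix -/

namespace OrientedKauffman

section ModelFunctor

variable {n : ℕ} {u v : List Letter}

/-- Tensors on `u` and `v` give tensors on the juxtaposition of `u` and `v`. -/
noncomputable def tensorIdx (n : ℕ) (u v : List Letter) :
    (Idx (Fin n) u → ℂ) ⊗[ℂ] (Idx (Fin n) v → ℂ) ≃ₗ[ℂ] (Idx (Fin n) (u ++ v) → ℂ) :=
  (((Pi.basisFun ℂ (Idx (Fin n) u)).tensorProduct (Pi.basisFun ℂ (Idx (Fin n) v))).reindex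
    (Idx.appEquiv u v)).equivFun

theorem tensorIdx_apply (f : Idx (Fin n) u → ℂ) (g : Idx (Fin n) v → ℂ) (I : Idx (Fin n) u)
    (J : Idx (Fin n) v) : tensorIdx n u v (f ⊗ₜ[ℂ] g) (I.app J) = f I * g J := by
  rw [tensorIdx, Module.Basis.equivFun_apply, Module.Basis.repr_reindex_apply,
    show (Idx.appEquiv u v).symm (I.app J) = (I, J) from
      (Idx.appEquiv u v).symm_apply_apply (I, J), Module.Basis.tensorProduct_repr_tmul_apply]
  simp [mul_comm]

theorem tensorIdx_single (I : Idx (Fin n) u) (J : Idx (Fin n) v) :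
    tensorIdx n u v (Pi.single I 1 ⊗ₜ[ℂ] Pi.single J 1) = Pi.single (I.app J) 1 := by
  ext K
  obtain ⟨I', J', rfl⟩ := Idx.exists_app K
  rw [tensorIdx_apply]
  simp only [Pi.single_apply, Idx.app_inj]
  by_cases h : I' = I <;> by_cases h' : J' = J <;> simp [h, h']

theorem tensorIdx_ext {M : Type*} [AddCommMonoid M] [Module ℂ M]
    {f g : (Idx (Fin n) u → ℂ) ⊗[ℂ] (Idx (Fin n) v → ℂ) →ₗ[ℂ] M}
    (h : ∀ I J, f (Pi.single I 1 ⊗ₜ[ℂ] Pi.single J 1) = g (Pi.single I 1 ⊗ₜ[ℂ] Pi.single J 1)) :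
    f = g := by
  refine ((Pi.basisFun ℂ (Idx (Fin n) u)).tensorProduct (Pi.basisFun ℂ (Idx (Fin n) v))).ext ?_
  rintro ⟨I, J⟩
  simpa [Module.Basis.tensorProduct_apply] using h I J

theorem const_one_idx_nil :
    (fun _ => (1 : ℂ) : Idx (Fin n) [] → ℂ) = Pi.single Idx.nil 1 := by
  ext I
  rw [I.eq_nil, Pi.single_eq_same]

/-- The basis of the vectors on a one-letter word. -/
noncomputable def letterBasis (n : ℕ) (a : Letter) :
    Module.Basis (Fin n) ℂ (Idx (Fin n) [a] → ℂ) :=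
  (Pi.basisFun ℂ (Idx (Fin n) [a])).reindex (Equiv.ofBijective _ (Idx.one_bijective _)).symm

theorem letterBasis_apply (a : Letter) (i : Fin n) :
    letterBasis n a i = Pi.single (Idx.one i) 1 := by
  rw [letterBasis, Module.Basis.reindex_apply, Pi.basisFun_apply]
  rfl

theorem toLin'_homMat_eqToHom {d : ℂ} [NeZero n] (C : GL (Fin n) ℂ) {X Y : Obj d} (h : X = Y)
    (I : Idx (Fin n) X.word) (J : Idx (Fin n) Y.word) (hIJ : I.1 = J.1) :
    (homMat C (eqToHom h)).toLin' (Pi.single I 1) = Pi.single J 1 := by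
  subst h
  obtain rfl : I = J := Subtype.ext hIJ
  rw [eqToHom_refl, homMat_id, Matrix.toLin'_one]
  rfl

variable {d : ℂ} [NeZero n] {C : GL (Fin n) ℂ}

/-- The functor that maps a diagram to its matrix. -/
noncomputable def modelFunctor (h1 : Matrix.trace (C : Matrix (Fin n) (Fin n) ℂ) = d)
    (h2 : Matrix.trace ((C⁻¹ : GL (Fin n) ℂ) : Matrix (Fin n) (Fin n) ℂ) = d) :
    Obj d ⥤ FGModuleCat.{0} ℂ where
  obj X := FGModuleCat.of ℂ (Idx (Fin n) X.word → ℂ)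
  map f := FGModuleCat.ofHom (homMat C f).toLin'
  map_id X := by
    rw [homMat_id, Matrix.toLin'_one]
    rfl
  map_comp f g := by
    rw [homMat_comp h1 h2, Matrix.toLin'_mul]
    rfl

variable (h1 : Matrix.trace (C : Matrix (Fin n) (Fin n) ℂ) = d)
  (h2 : Matrix.trace ((C⁻¹ : GL (Fin n) ℂ) : Matrix (Fin n) (Fin n) ℂ) = d)

instance : (modelFunctor h1 h2).Additive where
  map_add {X Y f g} := by
    apply FGModuleCat.hom_ext
    change (homMat C (f + g)).toLin' = (homMat C f).toLin' + (homMat C g).toLin'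
    rw [map_add, map_add]

instance : (modelFunctor h1 h2).Linear ℂ where
  map_smul {X Y} f c := by
    apply FGModuleCat.hom_ext
    change (homMat C (c • f)).toLin' = c • (homMat C f).toLin'
    rw [map_smul, map_smul]

theorem toLin'_single_tensor {X Y X' Y' : Obj d} (f : X ⟶ Y) (g : X' ⟶ Y')
    (I : Idx (Fin n) X.word) (I' : Idx (Fin n) X'.word) :
    (homMat C (f ⊗ₘ g)).toLin' (Pi.single (I.app I') 1) =
      tensorIdx n Y.word Y'.word ((homMat C f).toLin' (Pi.single I 1) ⊗ₜ[ℂ]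
        (homMat C g).toLin' (Pi.single I' 1)) := by
  ext K
  obtain ⟨K, K', rfl⟩ := Idx.exists_app (u := Y.word) (v := Y'.word) K
  rw [tensorIdx_apply]
  simp only [Matrix.toLin'_apply]
  refine (congrFun (Matrix.mulVec_single_one _ _) _).trans ?_
  rw [Matrix.mulVec_single_one, Matrix.mulVec_single_one]
  exact homMat_tensorHom C f g I I' K K'

/-- The monoidal structure of the model functor: the canonical identification of tensors on a
juxtaposition with tensor products. -/
noncomputable def modelMonoidal : (modelFunctor h1 h2).CoreMonoidal where
  εIso := (LinearEquiv.funUnique (Idx (Fin n) []) ℂ ℂ).symm.toFGModuleCatIso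
  μIso X Y := (tensorIdx n X.word Y.word).toFGModuleCatIso
  μIso_hom_natural_left {X Y} f Z := by
    apply FGModuleCat.hom_ext
    refine tensorIdx_ext fun I J => ?_
    change tensorIdx n Y.word Z.word ((homMat C f).toLin' (Pi.single I 1) ⊗ₜ[ℂ] Pi.single J 1) =
      (homMat C (f ⊗ₘ 𝟙 Z)).toLin' (tensorIdx n X.word Z.word
        (Pi.single I 1 ⊗ₜ[ℂ] Pi.single J 1))
    rw [tensorIdx_single, toLin'_single_tensor, homMat_id, Matrix.toLin'_one]
    rfl
  μIso_hom_natural_right {X Y} Z f := by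
    apply FGModuleCat.hom_ext
    refine tensorIdx_ext fun I J => ?_
    change tensorIdx n Z.word Y.word (Pi.single I 1 ⊗ₜ[ℂ] (homMat C f).toLin' (Pi.single J 1)) =
      (homMat C (𝟙 Z ⊗ₘ f)).toLin' (tensorIdx n Z.word X.word
        (Pi.single I 1 ⊗ₜ[ℂ] Pi.single J 1))
    rw [tensorIdx_single, toLin'_single_tensor, homMat_id, Matrix.toLin'_one]
    rfl
  associativity X Y Z := by
    apply FGModuleCat.hom_ext
    refine TensorProduct.ext (tensorIdx_ext fun I J => ?_)
    refine (Pi.basisFun ℂ (Idx (Fin n) Z.word)).ext fun K => ?_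
    rw [Pi.basisFun_apply]
    change (homMat C (eqToHom (obj_tensor_assoc X Y Z))).toLin'
      (tensorIdx n (X.word ++ Y.word) Z.word
        (tensorIdx n X.word Y.word (Pi.single I 1 ⊗ₜ[ℂ] Pi.single J 1) ⊗ₜ[ℂ] Pi.single K 1)) =
      tensorIdx n X.word (Y.word ++ Z.word) (Pi.single I 1 ⊗ₜ[ℂ]
        tensorIdx n Y.word Z.word (Pi.single J 1 ⊗ₜ[ℂ] Pi.single K 1))
    rw [tensorIdx_single, tensorIdx_single, tensorIdx_single, tensorIdx_single]
    exact toLin'_homMat_eqToHom C _ _ _ (List.append_assoc _ _ _)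
  left_unitality X := by
    apply FGModuleCat.hom_ext
    refine TensorProduct.ext (LinearMap.ext_ring ((Pi.basisFun ℂ (Idx (Fin n) X.word)).ext
      fun I => ?_))
    rw [Pi.basisFun_apply]
    change (1 : ℂ) • (Pi.single I 1 : Idx (Fin n) X.word → ℂ) =
      (homMat C (eqToHom (rfl : X = X))).toLin' (tensorIdx n [] X.word
        ((fun _ => (1 : ℂ)) ⊗ₜ[ℂ] Pi.single I 1))
    rw [one_smul, const_one_idx_nil, tensorIdx_single]
    exact (toLin'_homMat_eqToHom C _ _ _ rfl).symm
  right_unitality X := by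
    apply FGModuleCat.hom_ext
    refine TensorProduct.ext ((Pi.basisFun ℂ (Idx (Fin n) X.word)).ext fun I =>
      LinearMap.ext_ring ?_)
    rw [Pi.basisFun_apply]
    change (1 : ℂ) • (Pi.single I 1 : Idx (Fin n) X.word → ℂ) =
      (homMat C (eqToHom (obj_tensor_nil X))).toLin' (tensorIdx n X.word []
        (Pi.single I 1 ⊗ₜ[ℂ] (fun _ => (1 : ℂ))))
    rw [one_smul, const_one_idx_nil, tensorIdx_single]
    exact (toLin'_homMat_eqToHom C _ _ _ (List.append_nil _)).symm

noncomputable instance : (modelFunctor h1 h2).Monoidal := (modelMonoidal h1 h2).toMonoidal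

/-- The fiber functor of a matrix whose trace, and the trace of whose inverse, is `d`. -/
noncomputable def modelFiberFunctor : FiberFunctor d where
  functor := modelFunctor h1 h2
  additive := inferInstance
  linear := inferInstance
  monoidal := inferInstance

theorem homMat_capArc_apply (a : Letter) (i j : Fin n) :
    (homMat C ((capArc a).hom : (⟨[a, a.dual]⟩ : Obj d) ⟶ ⟨[]⟩)).toLin'
      (tensorIdx n [a] [a.dual] (letterBasis n a i ⊗ₜ[ℂ] letterBasis n a.dual j)) Idx.nil =
      mat C (capArc a) Idx.nil (Idx.two i j) := by
  rw [letterBasis_apply, letterBasis_apply, tensorIdx_single, homMat_hom, Matrix.toLin'_apply]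
  exact congrFun (Matrix.mulVec_single_one _ _) _

/-- The transpose appears because `C` is indexed by the start and the end of a string, and the
string of the arc on `X* X` starts at `X`, the right one of the two points. -/
theorem modelFiberFunctor_hasMatrix :
    (modelFiberFunctor h1 h2).HasMatrix ((C : Matrix (Fin n) (Fin n) ℂ).transpose) := by
  refine ⟨letterBasis n .X, letterBasis n .Xstar, fun i j => ?_, fun j i => ?_⟩
  · refine (homMat_capArc_apply (d := d) (C := C) .X i j).trans
      ((mat_capArc C .X _ i j).trans ?_)
    rfl
  · refine (homMat_capArc_apply (d := d) (C := C) .Xstar j i).trans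
      ((mat_capArc C .Xstar _ i j).trans ?_)
    have : expo (.up Letter.Xstar.posX) (.up Letter.Xstar.posXstar) = 1 := rfl
    rw [this, zpow_one]
    rfl

end ModelFunctor
end OrientedKauffman

/-! ### Fiber functors in coordinates -/

namespace OrientedKauffman

namespace FiberFunctor

section Structure

variable {d : ℂ} (Φ : FiberFunctor d) {X Y Z X' Y' : Obj d}

theorem lin_id (x : Φ.space X) : Φ.lin (𝟙 X) x = x :=
  LinearMap.congr_fun (congrArg (fun f => f.hom.hom) (Φ.functor.map_id X)) x

theorem lin_comp (f : X ⟶ Y) (g : Y ⟶ Z) (x : Φ.space X) :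
    Φ.lin (f ≫ g) x = Φ.lin g (Φ.lin f x) :=
  LinearMap.congr_fun (congrArg (fun f => f.hom.hom) (Φ.functor.map_comp f g)) x

theorem lin_zero : Φ.lin (0 : X ⟶ Y) = 0 :=
  congrArg (fun f => f.hom.hom) (Φ.functor.map_zero X Y)

theorem lin_add (f g : X ⟶ Y) : Φ.lin (f + g) = Φ.lin f + Φ.lin g :=
  congrArg (fun f => f.hom.hom) (Φ.functor.map_add (f := f) (g := g))

theorem lin_smul (c : ℂ) (f : X ⟶ Y) : Φ.lin (c • f) = c • Φ.lin f :=
  congrArg (fun f => f.hom.hom) (CategoryTheory.Functor.map_smul (R := ℂ) Φ.functor c f)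

theorem lin_tensorHom (f : X ⟶ Y) (g : X' ⟶ Y') (x : Φ.space X) (y : Φ.space X') :
    Φ.lin (f ⊗ₘ g) (Φ.mu X X' (x ⊗ₜ y)) = Φ.mu Y Y' (Φ.lin f x ⊗ₜ Φ.lin g y) :=
  (LinearMap.congr_fun (congrArg (fun f => f.hom.hom)
    (Functor.LaxMonoidal.μ_natural Φ.functor f g)) (x ⊗ₜ[ℂ] y)).symm

theorem lin_associator (x : Φ.space X) (y : Φ.space Y) (z : Φ.space Z) :
    Φ.lin (α_ X Y Z).hom (Φ.mu (X ⊗ Y) Z (Φ.mu X Y (x ⊗ₜ y) ⊗ₜ z)) =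
      Φ.mu X (Y ⊗ Z) (x ⊗ₜ Φ.mu Y Z (y ⊗ₜ z)) :=
  LinearMap.congr_fun (congrArg (fun f => f.hom.hom)
    (Functor.LaxMonoidal.associativity Φ.functor X Y Z)) (x ⊗ₜ[ℂ] y ⊗ₜ[ℂ] z)

theorem lin_leftUnitor (x : Φ.space X) :
    Φ.lin (λ_ X).hom (Φ.mu (𝟙_ (Obj d)) X (Φ.unit 1 ⊗ₜ x)) = x := by
  refine (LinearMap.congr_fun (congrArg (fun f => f.hom.hom)
    (Functor.LaxMonoidal.left_unitality Φ.functor X)) ((1 : ℂ) ⊗ₜ[ℂ] x)).symm.trans ?_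
  exact one_smul ℂ x

theorem lin_rightUnitor (x : Φ.space X) :
    Φ.lin (ρ_ X).hom (Φ.mu X (𝟙_ (Obj d)) (x ⊗ₜ Φ.unit 1)) = x := by
  refine (LinearMap.congr_fun (congrArg (fun f => f.hom.hom)
    (Functor.LaxMonoidal.right_unitality Φ.functor X)) (x ⊗ₜ[ℂ] (1 : ℂ))).symm.trans ?_
  exact one_smul ℂ x

/-- The isomorphism `Φ(Y) ⊗ Φ(Z) ≃ Φ(Y ⊗ Z)`. -/
noncomputable def muEquiv (Y Z : Obj d) : Φ.space Y ⊗[ℂ] Φ.space Z ≃ₗ[ℂ] Φ.space (Y ⊗ Z) :=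
  FGModuleCat.isoToLinearEquiv (Functor.Monoidal.μIso Φ.functor Y Z)

/-- The isomorphism `ℂ ≃ Φ(I)`. -/
noncomputable def unitEquiv : ℂ ≃ₗ[ℂ] Φ.space (𝟙_ (Obj d)) :=
  FGModuleCat.isoToLinearEquiv (Functor.Monoidal.εIso Φ.functor)

theorem unitInv_unit (c : ℂ) : Φ.unitInv (Φ.unit c) = c := Φ.unitEquiv.symm_apply_apply c

theorem unit_unitInv (x : Φ.space (𝟙_ (Obj d))) : Φ.unit (Φ.unitInv x) = x :=
  Φ.unitEquiv.apply_symm_apply x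

end Structure

section Coordinates

variable {d : ℂ} (Φ : FiberFunctor d) {n : ℕ}
  (b : ∀ a : Letter, Module.Basis (Fin n) ℂ (Φ.space (⟨[a]⟩ : Obj d)))

/-- The basis of `Φ` at a word that consists of the tensor products of given basis vectors. -/
noncomputable def wordBasis : ∀ u : List Letter,
    Module.Basis (Idx (Fin n) u) ℂ (Φ.space (⟨u⟩ : Obj d))
  | [] => (Module.Basis.singleton (Idx (Fin n) []) ℂ).map Φ.unitEquiv
  | a :: u => (((b a).tensorProduct (wordBasis u)).reindex
      (((Equiv.ofBijective _ (Idx.one_bijective a)).prodCongr (Equiv.refl _)).trans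
        (Idx.appEquiv [a] u))).map (Φ.muEquiv ⟨[a]⟩ ⟨u⟩)

theorem wordBasis_nil (I : Idx (Fin n) []) : Φ.wordBasis b [] I = Φ.unit 1 := by
  rw [wordBasis, Module.Basis.map_apply, Module.Basis.singleton_apply]
  rfl

theorem wordBasis_cons {a : Letter} {u : List Letter} (i : Fin n) (I : Idx (Fin n) u) :
    Φ.wordBasis b (a :: u) ((Idx.one i : Idx (Fin n) [a]).app I) =
      Φ.mu ⟨[a]⟩ ⟨u⟩ (b a i ⊗ₜ Φ.wordBasis b u I) := by
  rw [wordBasis, Module.Basis.map_apply, Module.Basis.reindex_apply]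
  have : (((Equiv.ofBijective _ (Idx.one_bijective a)).prodCongr (Equiv.refl _)).trans
      (Idx.appEquiv [a] u)).symm ((Idx.one i : Idx (Fin n) [a]).app I) = (i, I) := by
    rw [Equiv.symm_apply_eq]
    rfl
  rw [this, Module.Basis.tensorProduct_apply]
  rfl

theorem wordBasis_app : ∀ {u v : List Letter} (I : Idx (Fin n) u) (J : Idx (Fin n) v),
    Φ.wordBasis b (u ++ v) (I.app J) =
      Φ.mu ⟨u⟩ ⟨v⟩ (Φ.wordBasis b u I ⊗ₜ Φ.wordBasis b v J)
  | [], v, I, J => by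
    rw [wordBasis_nil]
    obtain rfl := I.eq_nil
    exact (Φ.lin_leftUnitor (X := ⟨v⟩) (Φ.wordBasis b v J)).symm.trans (Φ.lin_id _)
  | a :: u, v, I, J => by
    obtain ⟨I₁, I, rfl⟩ := Idx.exists_app (u := [a]) I
    obtain ⟨i, rfl⟩ := I₁.exists_one
    refine (Φ.wordBasis_cons b (a := a) (u := u ++ v) i (I.app J)).trans ?_
    rw [wordBasis_app I J]
    refine (Φ.lin_associator (X := ⟨[a]⟩) (Y := ⟨u⟩) (Z := ⟨v⟩) _ _ _).symm.trans ?_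
    refine (Φ.lin_id _).trans ?_
    exact congrArg (fun x => Φ.mu ⟨a :: u⟩ ⟨v⟩ (x ⊗ₜ Φ.wordBasis b v J))
      (Φ.wordBasis_cons b (a := a) (u := u) i I).symm

theorem wordBasis_one {a : Letter} (i : Fin n) : Φ.wordBasis b [a] (Idx.one i) = b a i := by
  refine (Φ.wordBasis_cons b (a := a) (u := []) i Idx.nil).trans ?_
  rw [wordBasis_nil]
  exact (Φ.lin_id _).symm.trans (Φ.lin_rightUnitor (X := ⟨[a]⟩) (b a i))

theorem wordBasis_two {a a' : Letter} (i j : Fin n) :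
    Φ.wordBasis b [a, a'] (Idx.two i j) = Φ.mu ⟨[a]⟩ ⟨[a']⟩ (b a i ⊗ₜ b a' j) := by
  refine (Φ.wordBasis_cons b (a := a) (u := [a']) i (Idx.one j)).trans ?_
  rw [wordBasis_one]

theorem wordBasis_repr_nil (x : Φ.space (⟨[]⟩ : Obj d)) (I : Idx (Fin n) []) :
    (Φ.wordBasis b []).repr x I = Φ.unitInv x := by
  rw [wordBasis, Module.Basis.map_repr, LinearEquiv.trans_apply, Module.Basis.singleton_repr]
  rfl

theorem wordBasis_repr_mu {u v : List Letter} (x : Φ.space (⟨u⟩ : Obj d))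
    (y : Φ.space (⟨v⟩ : Obj d)) (I : Idx (Fin n) u) (J : Idx (Fin n) v) :
    (Φ.wordBasis b (u ++ v)).repr (Φ.mu ⟨u⟩ ⟨v⟩ (x ⊗ₜ y)) (I.app J) =
      (Φ.wordBasis b u).repr x I * (Φ.wordBasis b v).repr y J := by
  have : Φ.wordBasis b (u ++ v) = (((Φ.wordBasis b u).tensorProduct (Φ.wordBasis b v)).reindex
      (Idx.appEquiv u v)).map (Φ.muEquiv ⟨u⟩ ⟨v⟩) := by
    apply Module.Basis.eq_of_apply_eq
    intro K
    obtain ⟨I, J, rfl⟩ := Idx.exists_app K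
    rw [wordBasis_app, Module.Basis.map_apply, Module.Basis.reindex_apply,
      show (Idx.appEquiv u v).symm (I.app J) = (I, J) from
        (Idx.appEquiv u v).symm_apply_apply (I, J), Module.Basis.tensorProduct_apply]
    rfl
  rw [this, Module.Basis.map_repr]
  change (((Φ.wordBasis b u).tensorProduct (Φ.wordBasis b v)).reindex (Idx.appEquiv u v)).repr
    ((Φ.muEquiv ⟨u⟩ ⟨v⟩).symm (Φ.muEquiv ⟨u⟩ ⟨v⟩ (x ⊗ₜ y))) (I.app J) = _
  rw [LinearEquiv.symm_apply_apply, Module.Basis.repr_reindex_apply,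
    show (Idx.appEquiv u v).symm (I.app J) = (I, J) from
      (Idx.appEquiv u v).symm_apply_apply (I, J), Module.Basis.tensorProduct_repr_tmul_apply]
  simp [mul_comm]

/-- The matrix of `Φ(f)` in the bases of tensor products of given basis vectors. -/
noncomputable def matrix {Y Z : Obj d} (f : Y ⟶ Z) :
    Matrix (Idx (Fin n) Z.word) (Idx (Fin n) Y.word) ℂ :=
  fun K I => (Φ.wordBasis b Z.word).repr (Φ.lin f (Φ.wordBasis b Y.word I)) K

variable {X Y Z X' Y' : Obj d}

theorem lin_wordBasis (f : Y ⟶ Z) (I : Idx (Fin n) Y.word) :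
    Φ.lin f (Φ.wordBasis b Y.word I) = ∑ K, Φ.matrix b f K I • Φ.wordBasis b Z.word K :=
  ((Φ.wordBasis b Z.word).sum_repr _).symm

theorem matrix_id (X : Obj d) : Φ.matrix b (𝟙 X) = 1 := by
  ext K I
  rw [matrix, lin_id, Module.Basis.repr_self, Matrix.one_apply, Finsupp.single_apply]
  simp only [eq_comm]

theorem matrix_comp (f : X ⟶ Y) (g : Y ⟶ Z) :
    Φ.matrix b (f ≫ g) = Φ.matrix b g * Φ.matrix b f := by
  ext K I
  rw [matrix, lin_comp, lin_wordBasis, map_sum, map_sum, Finsupp.finsetSum_apply,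
    Matrix.mul_apply]
  refine Finset.sum_congr rfl fun J _ => ?_
  rw [map_smul, map_smul, Finsupp.smul_apply, smul_eq_mul, mul_comm]
  rfl

theorem matrix_zero : Φ.matrix b (0 : X ⟶ Y) = 0 := by
  ext K I
  rw [matrix, lin_zero, LinearMap.zero_apply, map_zero]
  rfl

theorem matrix_add (f g : X ⟶ Y) : Φ.matrix b (f + g) = Φ.matrix b f + Φ.matrix b g := by
  ext K I
  rw [matrix, lin_add, LinearMap.add_apply, map_add]
  rfl

theorem matrix_smul (c : ℂ) (f : X ⟶ Y) : Φ.matrix b (c • f) = c • Φ.matrix b f := by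
  ext K I
  rw [matrix, lin_smul, LinearMap.smul_apply, map_smul]
  rfl

theorem matrix_tensorHom (f : X ⟶ Y) (g : X' ⟶ Y') (I : Idx (Fin n) X.word)
    (I' : Idx (Fin n) X'.word) (K : Idx (Fin n) Y.word) (K' : Idx (Fin n) Y'.word) :
    Φ.matrix b (f ⊗ₘ g) (K.app K') (I.app I') = Φ.matrix b f K I * Φ.matrix b g K' I' := by
  have h : Φ.wordBasis b (X ⊗ X').word (I.app I') =
      Φ.mu X X' (Φ.wordBasis b X.word I ⊗ₜ Φ.wordBasis b X'.word I') := Φ.wordBasis_app b I I'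
  rw [matrix, h, lin_tensorHom]
  exact Φ.wordBasis_repr_mu b _ _ K K'

/-- The matrix of the basic upper arc of type `(a a*, ∅)`. -/
noncomputable def capMatrix (a : Letter) : Matrix (Fin n) (Fin n) ℂ := fun i j =>
  Φ.matrix b ((capArc a).hom : (⟨[a, a.dual]⟩ : Obj d) ⟶ ⟨[]⟩) Idx.nil (Idx.two i j)

/-- The matrix of the basic lower arc of type `(∅, a a*)`. -/
noncomputable def cupMatrix (a : Letter) : Matrix (Fin n) (Fin n) ℂ := fun i j =>
  Φ.matrix b ((cupArc a).hom : (⟨[]⟩ : Obj d) ⟶ ⟨[a, a.dual]⟩) (Idx.two i j) Idx.nil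

theorem capMatrix_X (i j : Fin n) : Φ.capMatrix b .X i j = Φ.formX (b .X i) (b .Xstar j) := by
  rw [capMatrix, matrix, wordBasis_repr_nil]
  exact congrArg (fun x => Φ.unitInv (Φ.lin (epsX d) x)) (Φ.wordBasis_two b i j)

theorem capMatrix_Xstar (i j : Fin n) :
    Φ.capMatrix b .Xstar i j = Φ.formXstar (b .Xstar i) (b .X j) := by
  rw [capMatrix, matrix, wordBasis_repr_nil]
  exact congrArg (fun x => Φ.unitInv (Φ.lin (epsXstar d) x)) (Φ.wordBasis_two b i j)

end Coordinates

end FiberFunctor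
end OrientedKauffman

/-! ### Straightening strings and evaluating loops -/

namespace OrientedKauffman

theorem bend_id_arc {a : Letter} {x y : Pt} (h : (Diagram.id [a]).bend.arc x y) :
    x = .up a.dual.posX ∧ y = .up a.dual.posXstar := by
  obtain ⟨i, ⟨h, hx, hy⟩ | ⟨h, hx, hy⟩⟩ := h
  all_goals
    rcases i with _ | i
    · obtain rfl := Option.some.inj h
      exact ⟨Pt.unbend_bijective.1 hx, Pt.unbend_bijective.1 hy⟩
    · cases h

theorem bend_id_X : (Diagram.id [Letter.X]).bend = capArc .Xstar :=
  Diagram.eq_of_le fun _ _ h => capArc_arc.2 (bend_id_arc h)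

theorem bend_id_Xstar : (Diagram.id [Letter.Xstar]).bend = capArc .X :=
  Diagram.eq_of_le fun _ _ h => capArc_arc.2 (bend_id_arc h)

theorem diagram_nil (D : Diagram [] []) : D = Diagram.id [] := by
  symm
  apply Diagram.eq_of_le
  rintro x y ⟨i, ⟨h, -⟩ | ⟨h, -⟩⟩ <;> simp at h

namespace FiberFunctor

section Duality

variable {d : ℂ} (Φ : FiberFunctor d) {n : ℕ}
  (b : ∀ a : Letter, Module.Basis (Fin n) ℂ (Φ.space (⟨[a]⟩ : Obj d)))
  {p q : List Letter} {a : Letter}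

theorem matrix_hom_juxta {u v u' v' : List Letter} (D : Diagram u v) (E : Diagram u' v')
    (I : Idx (Fin n) u) (I' : Idx (Fin n) u') (K : Idx (Fin n) v) (K' : Idx (Fin n) v') :
    Φ.matrix b ((D.juxta E).hom : (⟨u ++ u'⟩ : Obj d) ⟶ ⟨v ++ v'⟩) (K.app K') (I.app I') =
      Φ.matrix b (D.hom : (⟨u⟩ : Obj d) ⟶ ⟨v⟩) K I *
        Φ.matrix b (E.hom : (⟨u'⟩ : Obj d) ⟶ ⟨v'⟩) K' I' := by
  rw [← matrix_tensorHom]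
  exact congrArg (fun f : (⟨u ++ u'⟩ : Obj d) ⟶ ⟨v ++ v'⟩ => Φ.matrix b f (K.app K') (I.app I'))
    (hom_tensorHom_hom (X := ⟨u⟩) (Y := ⟨v⟩) (X' := ⟨u'⟩) (Y' := ⟨v'⟩) D E).symm

theorem matrix_capD (P P' : Idx (Fin n) p) (Q Q' : Idx (Fin n) q) (i j : Fin n) :
    Φ.matrix b ((capD a p q).hom : (⟨p ++ a :: a.dual :: q⟩ : Obj d) ⟶ ⟨p ++ q⟩) (P'.app Q')
      (P.ins (Idx.two i j) Q) =
      (1 : Matrix _ _ ℂ) P' P * (Φ.capMatrix b a i j * (1 : Matrix _ _ ℂ) Q' Q) := by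
  refine (Φ.matrix_hom_juxta b (Diagram.id p) ((capArc a).juxta (Diagram.id q)) P
    ((Idx.two i j).app Q) P' (Idx.nil.app Q')).trans ?_
  rw [Φ.matrix_hom_juxta b (capArc a) (Diagram.id q)]
  exact congrArg₂ _ (congrFun₂ (Φ.matrix_id b ⟨p⟩) _ _)
    (congrArg _ (congrFun₂ (Φ.matrix_id b ⟨q⟩) _ _))

theorem matrix_cupD (P P' : Idx (Fin n) p) (Q Q' : Idx (Fin n) q) (i j : Fin n) :
    Φ.matrix b ((cupD a p q).hom : (⟨p ++ q⟩ : Obj d) ⟶ ⟨p ++ a :: a.dual :: q⟩)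
      (P'.ins (Idx.two i j) Q') (P.app Q) =
      (1 : Matrix _ _ ℂ) P' P * (Φ.cupMatrix b a i j * (1 : Matrix _ _ ℂ) Q' Q) := by
  refine (Φ.matrix_hom_juxta b (Diagram.id p) ((cupArc a).juxta (Diagram.id q)) P
    (Idx.nil.app Q) P' ((Idx.two i j).app Q')).trans ?_
  rw [Φ.matrix_hom_juxta b (cupArc a) (Diagram.id q)]
  exact congrArg₂ _ (congrFun₂ (Φ.matrix_id b ⟨p⟩) _ _)
    (congrArg _ (congrFun₂ (Φ.matrix_id b ⟨q⟩) _ _))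

theorem matrix_bend_id (i j : Fin n) :
    Φ.matrix b ((Diagram.id [a]).bend.hom : (⟨[a.dual, a]⟩ : Obj d) ⟶ ⟨[]⟩) Idx.nil
      (Idx.two i j) = Φ.capMatrix b a.dual i j := by
  cases a
  · exact congrArg (fun D : Diagram [.Xstar, .X] [] => Φ.matrix b
      (D.hom : (⟨[.Xstar, .X]⟩ : Obj d) ⟶ ⟨[]⟩) Idx.nil (Idx.two i j)) bend_id_X
  · exact congrArg (fun D : Diagram [.X, .Xstar] [] => Φ.matrix b
      (D.hom : (⟨[.X, .Xstar]⟩ : Obj d) ⟶ ⟨[]⟩) Idx.nil (Idx.two i j)) bend_id_Xstar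

theorem id_eq_cupD_comp_bend : (𝟙 (⟨[a]⟩ : Obj d) : (⟨[a]⟩ : Obj d) ⟶ ⟨[a]⟩) =
    ((cupD a [] [a]).hom : (⟨[a]⟩ : Obj d) ⟶ ⟨[a, a.dual, a]⟩) ≫
      (((Diagram.id [a]).juxta (Diagram.id [a]).bend).hom :
        (⟨[a, a.dual, a]⟩ : Obj d) ⟶ ⟨[a]⟩) := by
  rw [← hom_comp_of_loops (X := ⟨[a]⟩) (Y := ⟨[a, a.dual, a]⟩) (Z := ⟨[a]⟩)
    (loops_cupD_bend (Diagram.id [a])), cupD_comp_bend]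
  rfl

/-- Straightening a vertical string that has been bent twice. -/
theorem cupMatrix_mul_capMatrix : Φ.cupMatrix b a * Φ.capMatrix b a.dual = 1 := by
  ext k i
  have h := congrArg (fun f : (⟨[a]⟩ : Obj d) ⟶ ⟨[a]⟩ => Φ.matrix b f (Idx.one k) (Idx.one i))
    (id_eq_cupD_comp_bend (a := a) (d := d))
  simp only [matrix_id, matrix_comp] at h
  have h1 : (1 : Matrix (Idx (Fin n) [a]) (Idx (Fin n) [a]) ℂ) (Idx.one k) (Idx.one i) =
      (1 : Matrix (Fin n) (Fin n) ℂ) k i := by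
    simp only [Matrix.one_apply, Idx.one_inj]
  refine (h1.symm.trans (h.trans ?_)).symm
  refine (Matrix.mul_apply ..).trans ?_
  refine (Idx.sum_app (u := [a]) (v := [a.dual, a]) _).trans ?_
  refine (Idx.sum_one _).trans ?_
  refine (Finset.sum_eq_single k ?_ (by simp)).trans ?_
  · intro l _ hl
    refine Finset.sum_eq_zero fun J _ => ?_
    refine mul_eq_zero_of_left ((Φ.matrix_hom_juxta b (Diagram.id [a]) (Diagram.id [a]).bend
      (Idx.one l) J (Idx.one k) Idx.nil).trans (mul_eq_zero_of_left ?_ _)) _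
    refine (congrFun₂ (Φ.matrix_id b ⟨[a]⟩) _ _).trans (Matrix.one_apply_ne ?_)
    rw [ne_eq, Idx.one_inj]
    exact hl.symm
  refine (Idx.sum_two _).trans ?_
  rw [Matrix.mul_apply]
  refine Finset.sum_congr rfl fun j _ => ?_
  have e1 : ∀ l, Φ.matrix b (((Diagram.id [a]).juxta (Diagram.id [a]).bend).hom :
      (⟨[a, a.dual, a]⟩ : Obj d) ⟶ ⟨[a]⟩) (Idx.one k) ((Idx.one k : Idx (Fin n) [a]).app
        (Idx.two j l : Idx (Fin n) [a.dual, a])) = Φ.capMatrix b a.dual j l := by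
    intro l
    refine (Φ.matrix_hom_juxta b (Diagram.id [a]) (Diagram.id [a]).bend
      (Idx.one k) (Idx.two j l) (Idx.one k) Idx.nil).trans ?_
    rw [matrix_bend_id]
    refine (congrArg (· * _) (congrFun₂ (Φ.matrix_id b ⟨[a]⟩) _ _)).trans ?_
    rw [Matrix.one_apply_eq, one_mul]
  have e2 : ∀ l, Φ.matrix b ((cupD a [] [a]).hom : (⟨[a]⟩ : Obj d) ⟶ ⟨[a, a.dual, a]⟩)
      ((Idx.one k : Idx (Fin n) [a]).app (Idx.two j l : Idx (Fin n) [a.dual, a])) (Idx.one i) =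
        Φ.cupMatrix b a k j * (1 : Matrix (Fin n) (Fin n) ℂ) l i := by
    intro l
    refine (Φ.matrix_cupD b (a := a) (p := []) (q := [a]) Idx.nil Idx.nil (Idx.one i) (Idx.one l)
      k j).trans ?_
    rw [Matrix.one_apply_eq, one_mul]
    simp only [Matrix.one_apply, Idx.one_inj]
  refine (Finset.sum_eq_single i ?_ (by simp)).trans ?_
  · intro l _ hl
    refine (congrArg _ (e2 l)).trans ?_
    rw [Matrix.one_apply_ne hl, mul_zero, mul_zero]
  · refine (congrArg₂ _ (e1 i) (e2 i)).trans ?_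
    rw [Matrix.one_apply_eq, mul_one, mul_comm]

theorem sum_capMatrix_mul_cupMatrix : ∑ i, ∑ j, Φ.capMatrix b a i j * Φ.cupMatrix b a i j = d := by
  have h : ((cupD a [] []).hom : (⟨[]⟩ : Obj d) ⟶ ⟨[a, a.dual]⟩) ≫
      ((capD a [] []).hom : (⟨[a, a.dual]⟩ : Obj d) ⟶ ⟨[]⟩) = d • 𝟙 (⟨[]⟩ : Obj d) := by
    refine (hom_comp_hom (X := ⟨[]⟩) (Y := ⟨[a, a.dual]⟩) (Z := ⟨[]⟩) _ _).trans ?_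
    rw [loops_capD_of_arc (p := []) (q := []) cupD_mid, pow_one]
    exact congrArg (fun D : Diagram [] [] => d • (D.hom : (⟨[]⟩ : Obj d) ⟶ ⟨[]⟩)) (diagram_nil _)
  have h' := congrArg (fun f : (⟨[]⟩ : Obj d) ⟶ ⟨[]⟩ => Φ.matrix b f Idx.nil Idx.nil) h
  simp only [matrix_id, matrix_comp, matrix_smul] at h'
  have h1 : (d • (1 : Matrix (Idx (Fin n) []) (Idx (Fin n) []) ℂ)) Idx.nil Idx.nil = d := by
    simp
  refine Eq.trans ?_ (h'.trans h1)
  refine Eq.trans ?_ (Matrix.mul_apply ..).symm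
  refine Eq.trans ?_ (Idx.sum_two _).symm
  refine Finset.sum_congr rfl fun i _ => Finset.sum_congr rfl fun j _ => ?_
  have e1 := Φ.matrix_capD b (a := a) (p := []) (q := []) Idx.nil Idx.nil Idx.nil Idx.nil i j
  have e2 := Φ.matrix_cupD b (a := a) (p := []) (q := []) Idx.nil Idx.nil Idx.nil Idx.nil i j
  rw [Matrix.one_apply_eq, one_mul, mul_one] at e1 e2
  exact (congrArg₂ _ e1 e2).symm

/-- The bilinear form of the basic upper arc of type `(a* a, ∅)`. -/
noncomputable def form (a : Letter) (f : Φ.space (⟨[a.dual]⟩ : Obj d))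
    (x : Φ.space (⟨[a]⟩ : Obj d)) : ℂ :=
  Φ.unitInv (Φ.lin ((Diagram.id [a]).bend.hom : (⟨[a.dual, a]⟩ : Obj d) ⟶ ⟨[]⟩)
    (Φ.mu ⟨[a.dual]⟩ ⟨[a]⟩ (f ⊗ₜ x)))

theorem lin_hom_juxta {u v u' v' : List Letter} (D : Diagram u v) (E : Diagram u' v')
    (x : Φ.space (⟨u⟩ : Obj d)) (y : Φ.space (⟨u'⟩ : Obj d)) :
    Φ.lin ((D.juxta E).hom : (⟨u ++ u'⟩ : Obj d) ⟶ ⟨v ++ v'⟩) (Φ.mu ⟨u⟩ ⟨u'⟩ (x ⊗ₜ y)) =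
      Φ.mu ⟨v⟩ ⟨v'⟩ (Φ.lin (D.hom : (⟨u⟩ : Obj d) ⟶ ⟨v⟩) x ⊗ₜ
        Φ.lin (E.hom : (⟨u'⟩ : Obj d) ⟶ ⟨v'⟩) y) := by
  rw [← lin_tensorHom]
  exact congrArg (fun f : (⟨u ++ u'⟩ : Obj d) ⟶ ⟨v ++ v'⟩ => Φ.lin f (Φ.mu ⟨u⟩ ⟨u'⟩ (x ⊗ₜ y)))
    (hom_tensorHom_hom (X := ⟨u⟩) (Y := ⟨v⟩) (X' := ⟨u'⟩) (Y' := ⟨v'⟩) D E).symm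

/-- The form of the arc `(a* a, ∅)` is non-degenerate, by straightening a string. -/
theorem eq_zero_of_form (x : Φ.space (⟨[a]⟩ : Obj d)) (h : ∀ f, Φ.form a f x = 0) : x = 0 := by
  have h0 : ∀ f, Φ.lin ((Diagram.id [a]).bend.hom : (⟨[a.dual, a]⟩ : Obj d) ⟶ ⟨[]⟩)
      (Φ.mu ⟨[a.dual]⟩ ⟨[a]⟩ (f ⊗ₜ x)) = 0 := fun f => Φ.unitEquiv.symm.injective
    ((h f).trans (map_zero _).symm)
  have h1 : ∀ t : Φ.space (⟨[a, a.dual]⟩ : Obj d),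
      Φ.lin (((Diagram.id [a]).juxta (Diagram.id [a]).bend).hom :
        (⟨[a, a.dual, a]⟩ : Obj d) ⟶ ⟨[a]⟩) (Φ.mu ⟨[a, a.dual]⟩ ⟨[a]⟩ (t ⊗ₜ x)) = 0 := by
    intro t
    obtain ⟨t, rfl⟩ := (Φ.muEquiv ⟨[a]⟩ ⟨[a.dual]⟩).surjective t
    induction t using TensorProduct.induction_on with
    | zero => rw [map_zero, TensorProduct.zero_tmul, map_zero, map_zero]
    | add s t hs ht => rw [map_add, TensorProduct.add_tmul, map_add, map_add, hs, ht, add_zero]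
    | tmul e f =>
      have := (Φ.lin_id _).symm.trans
        (Φ.lin_associator (X := ⟨[a]⟩) (Y := ⟨[a.dual]⟩) (Z := ⟨[a]⟩) e f x)
      refine (congrArg _ this).trans ?_
      refine (Φ.lin_hom_juxta (Diagram.id [a]) (Diagram.id [a]).bend e _).trans ?_
      rw [h0, TensorProduct.tmul_zero, map_zero]
  rw [← Φ.lin_id x, id_eq_cupD_comp_bend, lin_comp]
  have h2 : x = Φ.mu ⟨[]⟩ ⟨[a]⟩ (Φ.unit 1 ⊗ₜ x) :=
    (Φ.lin_leftUnitor (X := ⟨[a]⟩) x).symm.trans (Φ.lin_id _)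
  have h3 : Φ.lin ((cupD a [] [a]).hom : (⟨[a]⟩ : Obj d) ⟶ ⟨[a, a.dual, a]⟩)
      (Φ.mu ⟨[]⟩ ⟨[a]⟩ (Φ.unit 1 ⊗ₜ x)) = Φ.mu ⟨[a, a.dual]⟩ ⟨[a]⟩
        (Φ.lin ((cupArc a).hom : (⟨[]⟩ : Obj d) ⟶ ⟨[a, a.dual]⟩) (Φ.unit 1) ⊗ₜ x) := by
    have e : cupD a [] [a] = (cupArc a).juxta (Diagram.id [a]) := Diagram.ext (id_nil_juxta_arc _)
    rw [e]
    refine (Φ.lin_hom_juxta (cupArc a) (Diagram.id [a]) _ _).trans ?_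
    exact congrArg (fun y => Φ.mu ⟨[a, a.dual]⟩ ⟨[a]⟩ (_ ⊗ₜ y)) (Φ.lin_id x)
  exact (congrArg _ ((congrArg _ h2).trans h3)).trans (h1 _)

end Duality

end FiberFunctor
end OrientedKauffman

/-! ### Classification of fiber functors -/

namespace OrientedKauffman
namespace FiberFunctor

section Comparison

variable {d : ℂ} {Φ Ψ : FiberFunctor d} {n : ℕ}
  (b : ∀ a : Letter, Module.Basis (Fin n) ℂ (Φ.space (⟨[a]⟩ : Obj d)))
  (c : ∀ a : Letter, Module.Basis (Fin n) ℂ (Ψ.space (⟨[a]⟩ : Obj d)))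

theorem cupMatrix_eq_inv (a : Letter) : Φ.cupMatrix b a = (Φ.capMatrix b a.dual)⁻¹ :=
  (Matrix.inv_eq_left_inv (Φ.cupMatrix_mul_capMatrix b)).symm

theorem isUnit_capMatrix : ∀ a : Letter, IsUnit (Φ.capMatrix b a)
  | .X => IsUnit.of_mul_eq_one_right _ (Φ.cupMatrix_mul_capMatrix b (a := .Xstar))
  | .Xstar => IsUnit.of_mul_eq_one_right _ (Φ.cupMatrix_mul_capMatrix b (a := .X))

/-- The matrices of the upper arcs determine the matrices of all morphisms. -/
theorem matrix_eq (h : ∀ a, Φ.capMatrix b a = Ψ.capMatrix c a) {Y Z : Obj d} (f : Y ⟶ Z) :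
    Φ.matrix b f = Ψ.matrix c f := by
  induction generated f with
  | zero => rw [matrix_zero, matrix_zero]
  | add _ _ ih ih' => rw [matrix_add, matrix_add, ih, ih']
  | smul c _ ih => rw [matrix_smul, matrix_smul, ih]
  | id => rw [matrix_id, matrix_id]
  | comp _ _ ih ih' => rw [matrix_comp, matrix_comp, ih, ih']
  | cap a p q =>
    ext K I
    obtain ⟨P', Q', rfl⟩ := Idx.exists_app (u := p) (v := q) K
    obtain ⟨P, J, rfl⟩ := Idx.exists_app (u := p) (v := [a, a.dual] ++ q) I
    obtain ⟨J, Q, rfl⟩ := Idx.exists_app (u := [a, a.dual]) (v := q) J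
    obtain ⟨i, j, rfl⟩ := J.exists_two
    refine (Φ.matrix_capD b P P' Q Q' i j).trans (Eq.trans ?_ (Ψ.matrix_capD c P P' Q Q' i j).symm)
    rw [h]
  | cup a p q =>
    ext K I
    obtain ⟨P, Q, rfl⟩ := Idx.exists_app (u := p) (v := q) I
    obtain ⟨P', J, rfl⟩ := Idx.exists_app (u := p) (v := [a, a.dual] ++ q) K
    obtain ⟨J, Q', rfl⟩ := Idx.exists_app (u := [a, a.dual]) (v := q) J
    obtain ⟨i, j, rfl⟩ := J.exists_two
    refine (Φ.matrix_cupD b P P' Q Q' i j).trans (Eq.trans ?_ (Ψ.matrix_cupD c P P' Q Q' i j).symm)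
    rw [cupMatrix_eq_inv, cupMatrix_eq_inv, h]

/-- The isomorphisms that identify the bases of tensor products of basis vectors. -/
noncomputable def wordEquiv (u : List Letter) :
    Φ.space (⟨u⟩ : Obj d) ≃ₗ[ℂ] Ψ.space (⟨u⟩ : Obj d) :=
  (Φ.wordBasis b u).equiv (Ψ.wordBasis c u) (Equiv.refl _)

theorem wordEquiv_apply {u : List Letter} (I : Idx (Fin n) u) :
    wordEquiv b c u (Φ.wordBasis b u I) = Ψ.wordBasis c u I :=
  Module.Basis.equiv_apply ..

/-- A fiber functor is determined up to equivalence by the matrices of the upper arcs: the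
identification of the bases is natural, since all morphisms have the same matrices. -/
theorem equivalent_of_capMatrix_eq (h : ∀ a, Φ.capMatrix b a = Ψ.capMatrix c a) :
    Equivalent Φ Ψ := by
  refine ⟨NatIso.ofComponents (fun Y => (wordEquiv b c Y.word).toFGModuleCatIso) ?_, ⟨?_, ?_⟩⟩
  · intro Y Z f
    apply FGModuleCat.hom_ext
    refine (Φ.wordBasis b Y.word).ext fun I => ?_
    change wordEquiv b c Z.word (Φ.lin f (Φ.wordBasis b Y.word I)) =
      Ψ.lin f (wordEquiv b c Y.word (Φ.wordBasis b Y.word I))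
    rw [wordEquiv_apply, lin_wordBasis, lin_wordBasis, map_sum]
    refine Finset.sum_congr rfl fun K _ => ?_
    rw [map_smul, wordEquiv_apply, matrix_eq b c h]
  · apply FGModuleCat.hom_ext
    refine LinearMap.ext_ring ?_
    change wordEquiv b c [] (Φ.unit 1) = Ψ.unit 1
    rw [← Φ.wordBasis_nil b Idx.nil, wordEquiv_apply, wordBasis_nil]
  · intro Y Z
    apply FGModuleCat.hom_ext
    refine ((Φ.wordBasis b Y.word).tensorProduct (Φ.wordBasis b Z.word)).ext fun ⟨I, J⟩ => ?_
    rw [Module.Basis.tensorProduct_apply]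
    change wordEquiv b c (Y.word ++ Z.word)
        (Φ.mu Y Z (Φ.wordBasis b Y.word I ⊗ₜ Φ.wordBasis b Z.word J)) =
      Ψ.mu Y Z (wordEquiv b c Y.word (Φ.wordBasis b Y.word I) ⊗ₜ
        wordEquiv b c Z.word (Φ.wordBasis b Z.word J))
    rw [wordEquiv_apply, wordEquiv_apply]
    exact (congrArg _ (Φ.wordBasis_app b I J).symm).trans ((wordEquiv_apply b c _).trans
      (Ψ.wordBasis_app c I J))

end Comparison

section Classification

variable {d : ℂ} {Φ Ψ : FiberFunctor d} {n : ℕ}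

/-- Bases of `Φ(X)` and `Φ(X*)`, as a family indexed by the letters. -/
def basisFamily (v : Module.Basis (Fin n) ℂ (Φ.space (Obj.X d)))
    (w : Module.Basis (Fin n) ℂ (Φ.space (Obj.Xstar d))) :
    ∀ a : Letter, Module.Basis (Fin n) ℂ (Φ.space (⟨[a]⟩ : Obj d))
  | .X => v
  | .Xstar => w

variable (Φ) in
/-- The bilinear map `formX`. -/
noncomputable def bilinX : Φ.space (Obj.X d) →ₗ[ℂ] Φ.space (Obj.Xstar d) →ₗ[ℂ] ℂ :=
  TensorProduct.curry (Φ.unitInv ∘ₗ Φ.lin (epsX d) ∘ₗ Φ.mu (Obj.X d) (Obj.Xstar d))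

variable (Φ) in
/-- The bilinear map `formXstar`. -/
noncomputable def bilinXstar : Φ.space (Obj.Xstar d) →ₗ[ℂ] Φ.space (Obj.X d) →ₗ[ℂ] ℂ :=
  TensorProduct.curry (Φ.unitInv ∘ₗ Φ.lin (epsXstar d) ∘ₗ Φ.mu (Obj.Xstar d) (Obj.X d))

theorem hasMatrix_iff {B : Matrix (Fin n) (Fin n) ℂ} : Φ.HasMatrix B ↔
    ∃ (v : Module.Basis (Fin n) ℂ (Φ.space (Obj.X d)))
      (w : Module.Basis (Fin n) ℂ (Φ.space (Obj.Xstar d))),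
      LinearMap.toMatrix₂ v w Φ.bilinX = 1 ∧ LinearMap.toMatrix₂ w v Φ.bilinXstar = B := by
  refine exists₂_congr fun v w => and_congr ?_ ?_
  · rw [← Matrix.ext_iff]
    simp only [LinearMap.toMatrix₂_apply]
    rfl
  · rw [← Matrix.ext_iff]
    simp only [LinearMap.toMatrix₂_apply]
    rfl

theorem form_X (y : Φ.space (Obj.Xstar d)) (x : Φ.space (Obj.X d)) :
    Φ.form .X y x = Φ.formXstar y x :=
  congrArg (fun D : Diagram [.Xstar, .X] [] => Φ.unitInv (Φ.lin
    (D.hom : (⟨[.Xstar, .X]⟩ : Obj d) ⟶ ⟨[]⟩) (Φ.mu (Obj.Xstar d) (Obj.X d) (y ⊗ₜ x)))) bend_id_X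

theorem form_Xstar (x : Φ.space (Obj.X d)) (y : Φ.space (Obj.Xstar d)) :
    Φ.form .Xstar x y = Φ.formX x y :=
  congrArg (fun D : Diagram [.X, .Xstar] [] => Φ.unitInv (Φ.lin
    (D.hom : (⟨[.X, .Xstar]⟩ : Obj d) ⟶ ⟨[]⟩) (Φ.mu (Obj.X d) (Obj.Xstar d) (x ⊗ₜ y))))
    bend_id_Xstar

theorem injective_flip_bilinX : Function.Injective Φ.bilinX.flip := by
  rw [injective_iff_map_eq_zero]
  exact fun y h => Φ.eq_zero_of_form (a := .Xstar) y fun x => (form_Xstar x y).trans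
    (LinearMap.congr_fun h x)

theorem injective_flip_bilinXstar : Function.Injective Φ.bilinXstar.flip := by
  rw [injective_iff_map_eq_zero]
  exact fun x h => Φ.eq_zero_of_form (a := .X) x fun y => (form_X y x).trans
    (LinearMap.congr_fun h y)

theorem finrank_Xstar : Module.finrank ℂ (Φ.space (Obj.Xstar d)) =
    Module.finrank ℂ (Module.Dual ℂ (Φ.space (Obj.X d))) := by
  have h1 := LinearMap.finrank_le_finrank_of_injective (injective_flip_bilinX (Φ := Φ))
  have h2 := LinearMap.finrank_le_finrank_of_injective (injective_flip_bilinXstar (Φ := Φ))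
  rw [Subspace.dual_finrank_eq] at h1 h2 ⊢
  exact le_antisymm h1 h2

/-- If the arc on `X X*` has the identity matrix, then the evaluation of the loops of either
orientation says that the matrix of the arc on `X* X` and its inverse have trace `d`. -/
theorem exists_traceMatrix (b : ∀ a : Letter, Module.Basis (Fin n) ℂ (Φ.space (⟨[a]⟩ : Obj d)))
    (hX : Φ.capMatrix b .X = 1) :
    ∃ B : TraceMatrix n d, (B.1 : Matrix (Fin n) (Fin n) ℂ) = Φ.capMatrix b .Xstar := by
  have h1 : Φ.cupMatrix b .X * Φ.capMatrix b .Xstar = 1 := Φ.cupMatrix_mul_capMatrix b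
  have h2 : Φ.cupMatrix b .Xstar * Φ.capMatrix b .X = 1 := Φ.cupMatrix_mul_capMatrix b
  have t1 := Φ.sum_capMatrix_mul_cupMatrix b (a := .X)
  have t2 := Φ.sum_capMatrix_mul_cupMatrix b (a := .Xstar)
  rw [hX, mul_one] at h2
  rw [h2] at t2
  rw [hX] at t1
  simp only [Matrix.one_apply, ite_mul, one_mul, zero_mul, mul_ite, mul_one, mul_zero,
    Finset.sum_ite_eq, Finset.mem_univ, if_true] at t1 t2
  exact ⟨⟨⟨_, _, mul_eq_one_comm.1 h1, h1⟩, t2, t1.symm⟩, rfl⟩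

variable (Φ) in
/-- Every basis of `Φ(X)` has a dual basis of `Φ(X*)` with respect to the non-degenerate form
`formX`. -/
theorem exists_hasMatrix : ∃ (n : ℕ) (B : TraceMatrix n d),
    Φ.HasMatrix (B.1 : Matrix (Fin n) (Fin n) ℂ) := by
  let v := Module.finBasis ℂ (Φ.space (Obj.X d))
  let e := LinearEquiv.ofInjectiveOfFinrankEq _ (injective_flip_bilinX (Φ := Φ)) finrank_Xstar
  let w := v.dualBasis.map e.symm
  have hX : Φ.capMatrix (basisFamily v w) .X = 1 := by
    ext i j
    rw [capMatrix_X]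
    change e (e.symm (v.dualBasis j)) (v i) = _
    rw [LinearEquiv.apply_symm_apply, Module.Basis.dualBasis_apply_self, Matrix.one_apply]
  obtain ⟨B, hB⟩ := exists_traceMatrix _ hX
  refine ⟨_, B, v, w, fun i j => ?_, fun j i => ?_⟩
  · rw [← hX, capMatrix_X]
    rfl
  · rw [hB, capMatrix_Xstar]
    rfl

theorem HasMatrix.equivalent {B : Matrix (Fin n) (Fin n) ℂ} (h : Φ.HasMatrix B)
    (h' : Ψ.HasMatrix B) : Equivalent Φ Ψ := by
  obtain ⟨v, w, h1, h2⟩ := h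
  obtain ⟨v', w', h1', h2'⟩ := h'
  refine equivalent_of_capMatrix_eq (basisFamily v w) (basisFamily v' w') fun a => ?_
  ext i j
  cases a
  · rw [capMatrix_X, capMatrix_X]
    exact (h1 i j).trans (h1' i j).symm
  · rw [capMatrix_Xstar, capMatrix_Xstar]
    exact (h2 i j).trans (h2' i j).symm

theorem HasMatrix.of_equivalent {B : Matrix (Fin n) (Fin n) ℂ} (h : Φ.HasMatrix B)
    (e : Equivalent Φ Ψ) : Ψ.HasMatrix B := by
  obtain ⟨v, w, h1, h2⟩ := h
  obtain ⟨α, hα⟩ := e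
  let τ (Y : Obj d) : Φ.space Y ≃ₗ[ℂ] Ψ.space Y := FGModuleCat.isoToLinearEquiv (α.app Y)
  have nat : ∀ {Y Z : Obj d} (f : Y ⟶ Z) (x : Φ.space Y), τ Z (Φ.lin f x) = Ψ.lin f (τ Y x) :=
    fun f x => LinearMap.congr_fun (congrArg (fun f => f.hom.hom) (α.hom.naturality f)) x
  have hmu : ∀ {Y Z : Obj d} (x : Φ.space Y) (y : Φ.space Z),
      τ _ (Φ.mu Y Z (x ⊗ₜ y)) = Ψ.mu Y Z (τ Y x ⊗ₜ τ Z y) :=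
    fun x y => LinearMap.congr_fun (congrArg (fun f => f.hom.hom) (hα.tensor _ _)) (x ⊗ₜ[ℂ] y)
  have hunit : ∀ c : ℂ, τ _ (Φ.unit c) = Ψ.unit c :=
    fun c => LinearMap.congr_fun (congrArg (fun f => f.hom.hom) hα.unit) c
  have hinv : ∀ x, Ψ.unitInv (τ _ x) = Φ.unitInv x := fun x => by
    rw [← Φ.unit_unitInv x, hunit, unitInv_unit, unitInv_unit]
  refine ⟨v.map (τ _), w.map (τ _), fun i j => ?_, fun j i => ?_⟩
  · rw [Module.Basis.map_apply, Module.Basis.map_apply, formX, ← hmu, ← nat, hinv]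
    exact h1 i j
  · rw [Module.Basis.map_apply, Module.Basis.map_apply, formXstar, ← hmu, ← nat, hinv]
    exact h2 j i

theorem exists_basis_toMatrix {M : Type*} [AddCommGroup M] [Module ℂ M]
    (v : Module.Basis (Fin n) ℂ M) (T : GL (Fin n) ℂ) :
    ∃ v' : Module.Basis (Fin n) ℂ M, v.toMatrix v' = (T : Matrix (Fin n) (Fin n) ℂ) := by
  refine ⟨v.map (Matrix.toLinearEquiv v T.1 ((Matrix.isUnit_iff_isUnit_det _).1 T.isUnit)), ?_⟩
  ext i j
  rw [Module.Basis.toMatrix_apply, Module.Basis.map_apply]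
  change v.repr (Matrix.toLin v v T.1 (v j)) i = _
  rw [Matrix.toLin_self, Module.Basis.repr_sum_self]

/-- Change the basis of `Φ(X)` by `T`, and the basis of `Φ(X*)` by the contragredient matrix, so
that the matrix of `formX` stays the identity. -/
theorem HasMatrix.conj {B : Matrix (Fin n) (Fin n) ℂ} (h : Φ.HasMatrix B) (T : GL (Fin n) ℂ) :
    Φ.HasMatrix (((T⁻¹ : GL (Fin n) ℂ) : Matrix (Fin n) (Fin n) ℂ) * B *
      (T : Matrix (Fin n) (Fin n) ℂ)) := by
  rw [hasMatrix_iff] at h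
  obtain ⟨v, w, h1, rfl⟩ := h
  let R : GL (Fin n) ℂ := ⟨(T⁻¹).1.transpose, T.1.transpose, by
    rw [← Matrix.transpose_mul]
    exact (congrArg _ T.3).trans Matrix.transpose_one, by
    rw [← Matrix.transpose_mul]
    exact (congrArg _ T.4).trans Matrix.transpose_one⟩
  obtain ⟨v', hv⟩ := exists_basis_toMatrix v T
  obtain ⟨w', hw⟩ := exists_basis_toMatrix w R
  refine hasMatrix_iff.2 ⟨v', w', ?_, ?_⟩
  · rw [← LinearMap.toMatrix₂_mul_basis_toMatrix v w, h1, mul_one, hv, hw]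
    exact (Matrix.transpose_mul _ _).symm.trans ((congrArg _ T.4).trans Matrix.transpose_one)
  · rw [← LinearMap.toMatrix₂_mul_basis_toMatrix w v, hv, hw]
    rfl

/-- Two bases of `Φ(X)` differ by a matrix `T`; the dual bases then differ by the contragredient
matrix, so that the matrices of `formXstar` are conjugate under `T`. -/
theorem HasMatrix.similar {B B' : Matrix (Fin n) (Fin n) ℂ} (h : Φ.HasMatrix B)
    (h' : Φ.HasMatrix B') : ∃ T : GL (Fin n) ℂ,
      B' = ((T⁻¹ : GL (Fin n) ℂ) : Matrix (Fin n) (Fin n) ℂ) * B *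
        (T : Matrix (Fin n) (Fin n) ℂ) := by
  rw [hasMatrix_iff] at h h'
  obtain ⟨v, w, h1, rfl⟩ := h
  obtain ⟨v', w', h1', rfl⟩ := h'
  have e1 := LinearMap.toMatrix₂_mul_basis_toMatrix v w v' w' Φ.bilinX
  rw [h1, h1', mul_one] at e1
  have e1' := congrArg Matrix.transpose e1
  rw [Matrix.transpose_mul, Matrix.transpose_transpose, Matrix.transpose_one] at e1'
  refine ⟨⟨v.toMatrix v', (w.toMatrix w').transpose, mul_eq_one_comm.1 e1', e1'⟩, ?_⟩
  exact (LinearMap.toMatrix₂_mul_basis_toMatrix w v w' v' Φ.bilinXstar).symm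

theorem HasMatrix.size_eq {m : ℕ} {B : Matrix (Fin n) (Fin n) ℂ} {B' : Matrix (Fin m) (Fin m) ℂ}
    (h : Φ.HasMatrix B) (h' : Φ.HasMatrix B') : n = m := by
  obtain ⟨v, -⟩ := h
  obtain ⟨v', -⟩ := h'
  simpa using Fintype.card_congr (v.indexEquiv v')

theorem exists_fiberFunctor_hasMatrix (hd : d ≠ 0) (B : TraceMatrix n d) :
    ∃ Φ : FiberFunctor d, Φ.HasMatrix (B.1 : Matrix (Fin n) (Fin n) ℂ) := by
  obtain ⟨B, h1, h2⟩ := B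
  -- the trace of the empty matrix is `0`, which differs from `d`
  have : NeZero n := ⟨by
    rintro rfl
    exact hd (h1.symm.trans (Matrix.trace_fin_zero _))⟩
  let C : GL (Fin n) ℂ := ⟨B.1.transpose, B.2.transpose, by
    rw [← Matrix.transpose_mul, B.4, Matrix.transpose_one], by
    rw [← Matrix.transpose_mul, B.3, Matrix.transpose_one]⟩
  have t1 : Matrix.trace (C : Matrix (Fin n) (Fin n) ℂ) = d := (Matrix.trace_transpose _).trans h1
  have t2 : Matrix.trace ((C⁻¹ : GL (Fin n) ℂ) : Matrix (Fin n) (Fin n) ℂ) = d :=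
    (Matrix.trace_transpose _).trans h2.symm
  exact ⟨modelFiberFunctor t1 t2, modelFiberFunctor_hasMatrix t1 t2⟩

theorem HasMatrix.orbit_eq_iff {m : ℕ} {B : TraceMatrix n d} {B' : TraceMatrix m d}
    (h : Φ.HasMatrix (B.1 : Matrix (Fin n) (Fin n) ℂ)) :
    (⟨n, ⟦B⟧⟩ : Σ n : ℕ, SimilarityOrbit n d) = ⟨m, ⟦B'⟧⟩ ↔
      Φ.HasMatrix (B'.1 : Matrix (Fin m) (Fin m) ℂ) := by
  constructor
  · intro e
    obtain rfl : n = m := congrArg Sigma.fst e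
    obtain ⟨T, hT⟩ := Quotient.exact (eq_of_heq (Sigma.mk.inj e).2)
    rw [hT]
    exact h.conj T
  · intro h'
    obtain rfl := h.size_eq h'
    obtain ⟨T, hT⟩ := h.similar h'
    exact congrArg (Sigma.mk n) (Quotient.sound ⟨T, Units.ext hT⟩)

/-- The classification of fiber functors up to natural equivalence. -/
theorem exists_classification (hd : d ≠ 0) :
    ∃ e : Quotient (FiberFunctor.setoid d) ≃ Σ n : ℕ, SimilarityOrbit n d,
      ∀ (Φ : FiberFunctor d) (n : ℕ) (B : TraceMatrix n d),
        e ⟦Φ⟧ = ⟨n, ⟦B⟧⟩ ↔ Φ.HasMatrix (B.1 : Matrix (Fin n) (Fin n) ℂ) := by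
  choose n B hB using exists_hasMatrix (d := d)
  have key : ∀ (Φ : FiberFunctor d) (m : ℕ) (B' : TraceMatrix m d),
      (⟨n Φ, ⟦B Φ⟧⟩ : Σ n : ℕ, SimilarityOrbit n d) = ⟨m, ⟦B'⟧⟩ ↔
        Φ.HasMatrix (B'.1 : Matrix (Fin m) (Fin m) ℂ) := fun Φ m B' => (hB Φ).orbit_eq_iff
  let F : Quotient (FiberFunctor.setoid d) → Σ n : ℕ, SimilarityOrbit n d :=
    Quotient.lift (fun Φ => ⟨n Φ, ⟦B Φ⟧⟩) fun Φ Ψ e =>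
      (key Φ _ _).2 ((hB Ψ).of_equivalent (Setoid.symm e))
  refine ⟨Equiv.ofBijective F ⟨?_, ?_⟩, key⟩
  · rintro ⟨Φ⟩ ⟨Ψ⟩ e
    exact Quotient.sound (((key Φ _ _).1 e).equivalent (hB Ψ))
  · rintro ⟨m, ⟨B'⟩⟩
    obtain ⟨Φ, h⟩ := exists_fiberFunctor_hasMatrix hd B'
    exact ⟨⟦Φ⟧, (key Φ _ _).2 h⟩

end Classification

end FiberFunctor
end OrientedKauffman

/-! ### The Hopf algebra with given generators and relations -/

namespace OrientedKauffman

section Transpose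

variable {n : ℕ} {R : Type*} [Ring R]

theorem transpose_mul_of_commute {M N : Matrix (Fin n) (Fin n) R}
    (h : ∀ i j k l, Commute (M i j) (N k l)) :
    (M * N).transpose = N.transpose * M.transpose := by
  ext i j
  rw [Matrix.transpose_apply, Matrix.mul_apply, Matrix.mul_apply]
  exact Finset.sum_congr rfl fun k _ => h _ _ _ _

theorem transpose_map_op_mul (M N : Matrix (Fin n) (Fin n) R) :
    (M * N).transpose.map MulOpposite.op =
      N.transpose.map MulOpposite.op * M.transpose.map MulOpposite.op := by
  ext i j
  simp [Matrix.mul_apply]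

end Transpose

section Compatible

variable {n : ℕ} {R S : Type*} [Ring R] [Algebra ℂ R] [Ring S] [Algebra ℂ S]

/-- A complex matrix, with entries regarded as scalars of an algebra. -/
def scalarMatrix (R : Type*) [Ring R] [Algebra ℂ R] (C : Matrix (Fin n) (Fin n) ℂ) :
    Matrix (Fin n) (Fin n) R := C.map (algebraMap ℂ R)

theorem scalarMatrix_mul (C D : Matrix (Fin n) (Fin n) ℂ) :
    scalarMatrix R (C * D) = scalarMatrix R C * scalarMatrix R D := Matrix.map_mul

theorem scalarMatrix_one : scalarMatrix R (1 : Matrix (Fin n) (Fin n) ℂ) = 1 :=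
  Matrix.map_one _ (map_zero _) (map_one _)

theorem map_scalarMatrix (f : R →ₐ[ℂ] S) (C : Matrix (Fin n) (Fin n) ℂ) :
    (scalarMatrix R C).map f = scalarMatrix S C := by
  ext i j
  exact f.commutes _

theorem mul_scalarMatrix_mul_apply (M N : Matrix (Fin n) (Fin n) R) (C : Matrix (Fin n) (Fin n) ℂ)
    (j l : Fin n) :
    (M * scalarMatrix R C * N) j l = ∑ i, ∑ k, C i k • (M j i * N k l) := by
  rw [Matrix.mul_apply, Finset.sum_comm]
  refine Finset.sum_congr rfl fun k _ => ?_
  rw [Matrix.mul_apply, Finset.sum_mul]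
  refine Finset.sum_congr rfl fun i _ => ?_
  rw [scalarMatrix, Matrix.map_apply, ← Algebra.commutes, mul_assoc, ← Algebra.smul_def]

theorem transpose_scalarMatrix_mul (C : Matrix (Fin n) (Fin n) ℂ) (M : Matrix (Fin n) (Fin n) R) :
    (scalarMatrix R C * M).transpose = M.transpose * (scalarMatrix R C).transpose :=
  transpose_mul_of_commute fun _ _ _ _ => Algebra.commutes _ _

theorem transpose_mul_scalarMatrix (C : Matrix (Fin n) (Fin n) ℂ) (M : Matrix (Fin n) (Fin n) R) :
    (M * scalarMatrix R C).transpose = (scalarMatrix R C).transpose * M.transpose :=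
  transpose_mul_of_commute fun _ _ _ _ => (Algebra.commutes _ _).symm

variable {C : Letter → Matrix (Fin n) (Fin n) ℂ}

/-- Square matrices `T a` over an algebra, one for each letter, that preserve the bilinear forms
`C a` on the pairs of letters `a a*` and the dual tensors. -/
structure IsCompatible (C : Letter → Matrix (Fin n) (Fin n) ℂ)
    (T : Letter → Matrix (Fin n) (Fin n) R) : Prop where
  cap : ∀ a, (T a).transpose * scalarMatrix R (C a) * T a.dual = scalarMatrix R (C a)
  cup : ∀ a, T a * scalarMatrix R (C a.dual)⁻¹ * (T a.dual).transpose =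
    scalarMatrix R (C a.dual)⁻¹

theorem IsCompatible.sum_cap {T : Letter → Matrix (Fin n) (Fin n) R} (h : IsCompatible C T)
    (a : Letter) (j l : Fin n) :
    ∑ i, ∑ k, C a i k • (T a i j * T a.dual k l) = C a j l • 1 := by
  have := congrFun₂ (h.cap a) j l
  rw [mul_scalarMatrix_mul_apply] at this
  rw [← Algebra.algebraMap_eq_smul_one]
  exact this

theorem IsCompatible.sum_cup {T : Letter → Matrix (Fin n) (Fin n) R} (h : IsCompatible C T)
    (a : Letter) (k l : Fin n) :
    ∑ j, ∑ i, (C a.dual)⁻¹ j i • (T a k j * T a.dual l i) = (C a.dual)⁻¹ k l • 1 := by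
  have := congrFun₂ (h.cup a) k l
  rw [mul_scalarMatrix_mul_apply] at this
  rw [← Algebra.algebraMap_eq_smul_one]
  exact this

theorem isCompatible_of_sum {T : Letter → Matrix (Fin n) (Fin n) R}
    (h1 : ∀ a j l, ∑ i, ∑ k, C a i k • (T a i j * T a.dual k l) = C a j l • 1)
    (h2 : ∀ a k l, ∑ j, ∑ i, (C a.dual)⁻¹ j i • (T a k j * T a.dual l i) =
      (C a.dual)⁻¹ k l • 1) : IsCompatible C T where
  cap a := by
    ext j l
    rw [mul_scalarMatrix_mul_apply]
    exact (h1 a j l).trans (Algebra.algebraMap_eq_smul_one _).symm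
  cup a := by
    ext k l
    rw [mul_scalarMatrix_mul_apply]
    exact (h2 a k l).trans (Algebra.algebraMap_eq_smul_one _).symm

theorem isCompatible_one : IsCompatible C (fun _ => (1 : Matrix (Fin n) (Fin n) R)) where
  cap a := by rw [Matrix.transpose_one, one_mul, mul_one]
  cup a := by rw [Matrix.transpose_one, one_mul, mul_one]

theorem IsCompatible.map {T : Letter → Matrix (Fin n) (Fin n) R} (h : IsCompatible C T)
    (f : R →ₐ[ℂ] S) : IsCompatible C (fun a => (T a).map f) where
  cap a := by
    have := congrArg (fun M => M.map f) (h.cap a)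
    rwa [Matrix.map_mul, Matrix.map_mul, map_scalarMatrix, Matrix.transpose_map] at this
  cup a := by
    have := congrArg (fun M => M.map f) (h.cup a)
    rwa [Matrix.map_mul, Matrix.map_mul, map_scalarMatrix, Matrix.transpose_map] at this

theorem IsCompatible.mul {T T' : Letter → Matrix (Fin n) (Fin n) R} (h : IsCompatible C T)
    (h' : IsCompatible C T') (hc : ∀ a a' i j k l, Commute (T a i j) (T' a' k l)) :
    IsCompatible C (fun a => T a * T' a) where
  cap a := by
    rw [transpose_mul_of_commute (hc a a)]
    calc _ = (T' a).transpose * ((T a).transpose * scalarMatrix R (C a) * T a.dual) * T' a.dual := by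
          simp only [mul_assoc]
      _ = _ := by rw [h.cap, h'.cap]
  cup a := by
    rw [transpose_mul_of_commute (hc a.dual a.dual)]
    calc _ = T a * (T' a * scalarMatrix R (C a.dual)⁻¹ * (T' a.dual).transpose) *
            (T a.dual).transpose := by
          simp only [mul_assoc]
      _ = _ := by rw [h'.cup, h.cup]

theorem Letter.dual_dual : ∀ a : Letter, a.dual.dual = a
  | .X => rfl
  | .Xstar => rfl

/-- The inverses of the matrices of a compatible family. -/
noncomputable def compatibleInv (C : Letter → Matrix (Fin n) (Fin n) ℂ)
    (T : Letter → Matrix (Fin n) (Fin n) R) (a : Letter) : Matrix (Fin n) (Fin n) R :=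
  scalarMatrix R (C a.dual)⁻¹ * (T a.dual).transpose * scalarMatrix R (C a.dual)

theorem scalarMatrix_inv_mul (hC : ∀ a, IsUnit (C a)) (a : Letter) :
    scalarMatrix R (C a)⁻¹ * scalarMatrix R (C a) = 1 := by
  rw [← scalarMatrix_mul, Matrix.nonsing_inv_mul _ ((Matrix.isUnit_iff_isUnit_det _).1 (hC a)),
    scalarMatrix_one]

theorem scalarMatrix_mul_inv (hC : ∀ a, IsUnit (C a)) (a : Letter) :
    scalarMatrix R (C a) * scalarMatrix R (C a)⁻¹ = 1 := by
  rw [← scalarMatrix_mul, Matrix.mul_nonsing_inv _ ((Matrix.isUnit_iff_isUnit_det _).1 (hC a)),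
    scalarMatrix_one]

theorem IsCompatible.mul_inv {T : Letter → Matrix (Fin n) (Fin n) R} (h : IsCompatible C T)
    (hC : ∀ a, IsUnit (C a)) (a : Letter) : T a * compatibleInv C T a = 1 := by
  rw [compatibleInv, ← mul_assoc, ← mul_assoc, h.cup, scalarMatrix_inv_mul hC]

theorem IsCompatible.inv_mul {T : Letter → Matrix (Fin n) (Fin n) R} (h : IsCompatible C T)
    (hC : ∀ a, IsUnit (C a)) (a : Letter) : compatibleInv C T a * T a = 1 := by
  have := h.cap a.dual
  rw [Letter.dual_dual] at this
  rw [compatibleInv, mul_assoc, mul_assoc, ← mul_assoc _ _ (T a), this, scalarMatrix_inv_mul hC]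

/-- The inverse matrices are compatible over the opposite algebra. -/
theorem IsCompatible.op_inv {T : Letter → Matrix (Fin n) (Fin n) R} (h : IsCompatible C T)
    (hC : ∀ a, IsUnit (C a)) :
    IsCompatible C (fun a => (compatibleInv C T a).map MulOpposite.op) where
  cap a := by
    have e : (compatibleInv C T a.dual).transpose * (scalarMatrix R (C a)).transpose *
        compatibleInv C T a = (scalarMatrix R (C a)).transpose := by
      rw [← transpose_scalarMatrix_mul, compatibleInv, Letter.dual_dual, ← mul_assoc, ← mul_assoc,
        scalarMatrix_mul_inv hC, one_mul, transpose_mul_scalarMatrix, Matrix.transpose_transpose,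
        mul_assoc, h.mul_inv hC, mul_one]
    have := congrArg (fun M => M.transpose.map MulOpposite.op) e
    rw [transpose_map_op_mul, transpose_map_op_mul, Matrix.transpose_transpose,
      Matrix.transpose_transpose, ← mul_assoc] at this
    exact this
  cup a := by
    have e : compatibleInv C T a.dual * (scalarMatrix R (C a.dual)⁻¹).transpose *
        (compatibleInv C T a).transpose = (scalarMatrix R (C a.dual)⁻¹).transpose := by
      rw [mul_assoc, ← transpose_mul_scalarMatrix, compatibleInv.eq_1 C T a,
        mul_assoc _ _ (scalarMatrix R (C a.dual)⁻¹), scalarMatrix_mul_inv hC, mul_one, transpose_scalarMatrix_mul, Matrix.transpose_transpose,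
        ← mul_assoc, h.inv_mul hC, one_mul]
    have := congrArg (fun M => M.transpose.map MulOpposite.op) e
    rw [transpose_map_op_mul, transpose_map_op_mul, Matrix.transpose_transpose,
      Matrix.transpose_transpose, ← mul_assoc] at this
    exact this

end Compatible

section HopfAlgebra

variable {n : ℕ} {R S : Type*} [Ring R] [Algebra ℂ R] [Ring S] [Algebra ℂ S]

/-- The pair of matrices `A`, `B`, as a family indexed by the letters. -/
def formFamily (A B : Matrix (Fin n) (Fin n) ℂ) : Letter → Matrix (Fin n) (Fin n) ℂ
  | .X => A
  | .Xstar => B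

/-- The generators of the free algebra, as a family of matrices. -/
noncomputable def freeGen (n : ℕ) : Letter → Matrix (Fin n) (Fin n) (FreeAlgebra ℂ (Gen n))
  | .X => genV
  | .Xstar => genW

variable (A B : Matrix (Fin n) (Fin n) ℂ)

/-- The generators of the algebra with relations `HopfRel A B`, as a family of matrices. -/
noncomputable def relGen (a : Letter) : Matrix (Fin n) (Fin n) (RingQuot (HopfRel A B)) :=
  (freeGen n a).map (RingQuot.mkAlgHom ℂ (HopfRel A B))

theorem isCompatible_relGen : IsCompatible (formFamily A B) (relGen A B) := by
  have key : ∀ {x y}, HopfRel A B x y → RingQuot.mkAlgHom ℂ (HopfRel A B) x =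
    RingQuot.mkAlgHom ℂ (HopfRel A B) y := fun h => RingQuot.mkAlgHom_rel ℂ h
  refine isCompatible_of_sum (fun a j l => ?_) fun a k l => ?_
  · cases a
    · have := key (.relA j l)
      simp only [map_sum, map_smul, map_mul, map_one] at this
      exact this
    · have := key (.relB j l)
      simp only [map_sum, map_smul, map_mul, map_one] at this
      exact this
  · cases a
    · have := key (.relBinv k l)
      simp only [map_sum, map_smul, map_mul, map_one] at this
      exact this
    · have := key (.relAinv k l)
      simp only [map_sum, map_smul, map_mul, map_one] at this
      exact this

variable {A B}

/-- A matrix family defines a homomorphism on the free algebra. -/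
noncomputable def freeLift (T : Letter → Matrix (Fin n) (Fin n) R) :
    FreeAlgebra ℂ (Gen n) →ₐ[ℂ] R :=
  FreeAlgebra.lift ℂ fun
    | .v i j => T .X i j
    | .w i j => T .Xstar i j

theorem freeLift_freeGen (T : Letter → Matrix (Fin n) (Fin n) R) :
    ∀ a i j, freeLift T (freeGen n a i j) = T a i j
  | .X, _, _ => FreeAlgebra.lift_ι_apply _ _
  | .Xstar, _, _ => FreeAlgebra.lift_ι_apply _ _

/-- The universal property of the algebra with relations `HopfRel A B`. -/
noncomputable def relLift {T : Letter → Matrix (Fin n) (Fin n) R}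
    (h : IsCompatible (formFamily A B) T) : RingQuot (HopfRel A B) →ₐ[ℂ] R :=
  RingQuot.liftAlgHom ℂ ⟨freeLift T, by
    have eX : ∀ i j, freeLift T (genV i j) = T .X i j := freeLift_freeGen T .X
    have eXstar : ∀ i j, freeLift T (genW i j) = T .Xstar i j := freeLift_freeGen T .Xstar
    rintro _ _ (⟨j, l⟩ | ⟨k, l⟩ | ⟨j, l⟩ | ⟨k, l⟩)
    · simp only [map_sum, map_smul, map_mul, map_one, eX, eXstar]
      exact h.sum_cap .X j l
    · simp only [map_sum, map_smul, map_mul, map_one, eX, eXstar]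
      exact h.sum_cup .Xstar k l
    · simp only [map_sum, map_smul, map_mul, map_one, eX, eXstar]
      exact h.sum_cap .Xstar j l
    · simp only [map_sum, map_smul, map_mul, map_one, eX, eXstar]
      exact h.sum_cup .X k l⟩

theorem relLift_relGen {T : Letter → Matrix (Fin n) (Fin n) R}
    (h : IsCompatible (formFamily A B) T) (a : Letter) (i j : Fin n) :
    relLift h (relGen A B a i j) = T a i j :=
  (RingQuot.liftAlgHom_mkAlgHom_apply ..).trans (freeLift_freeGen T a i j)

theorem relGen_algHom_ext {f g : RingQuot (HopfRel A B) →ₐ[ℂ] R}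
    (h : ∀ a i j, f (relGen A B a i j) = g (relGen A B a i j)) : f = g := by
  refine RingQuot.ringQuot_ext' ℂ f g (FreeAlgebra.hom_ext (funext ?_))
  rintro (⟨i, j⟩ | ⟨i, j⟩)
  · exact h .X i j
  · exact h .Xstar i j

@[elab_as_elim]
theorem relGen_induction {P : RingQuot (HopfRel A B) → Prop}
    (h0 : ∀ r, P (algebraMap ℂ _ r)) (h1 : ∀ a i j, P (relGen A B a i j))
    (hmul : ∀ x y, P x → P y → P (x * y)) (hadd : ∀ x y, P x → P y → P (x + y))
    (x : RingQuot (HopfRel A B)) : P x := by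
  obtain ⟨x, rfl⟩ := RingQuot.mkAlgHom_surjective ℂ _ x
  induction x using FreeAlgebra.induction with
  | grade0 r => rw [AlgHom.commutes]; exact h0 r
  | grade1 g =>
    cases g
    · exact h1 .X _ _
    · exact h1 .Xstar _ _
  | mul x y hx hy => rw [map_mul]; exact hmul _ _ hx hy
  | add x y hx hy => rw [map_add]; exact hadd _ _ hx hy

theorem commute_includeLeft_includeRight (x y : R) :
    Commute ((Algebra.TensorProduct.includeLeft : R →ₐ[ℂ] R ⊗[ℂ] R) x)
      ((Algebra.TensorProduct.includeRight : R →ₐ[ℂ] R ⊗[ℂ] R) y) := by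
  change (x ⊗ₜ[ℂ] 1) * (1 ⊗ₜ[ℂ] y) = (1 ⊗ₜ[ℂ] y) * (x ⊗ₜ[ℂ] 1)
  simp only [Algebra.TensorProduct.tmul_mul_tmul, one_mul, mul_one]

variable (A B) in
theorem isCompatible_comul : IsCompatible (formFamily A B) (fun a =>
    (relGen A B a).map (Algebra.TensorProduct.includeLeft :
      RingQuot (HopfRel A B) →ₐ[ℂ] RingQuot (HopfRel A B) ⊗[ℂ] RingQuot (HopfRel A B)) *
    (relGen A B a).map (Algebra.TensorProduct.includeRight :
      RingQuot (HopfRel A B) →ₐ[ℂ] RingQuot (HopfRel A B) ⊗[ℂ] RingQuot (HopfRel A B))) :=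
  ((isCompatible_relGen A B).map _).mul ((isCompatible_relGen A B).map _)
    fun _ _ _ _ _ _ => commute_includeLeft_includeRight _ _

variable (A B) in
/-- The comultiplication: matrix multiplication of the generators. -/
noncomputable def relComul :
    RingQuot (HopfRel A B) →ₐ[ℂ] RingQuot (HopfRel A B) ⊗[ℂ] RingQuot (HopfRel A B) :=
  relLift (isCompatible_comul A B)

variable (A B) in
/-- The counit: evaluation of the generators at the unit matrix. -/
noncomputable def relCounit : RingQuot (HopfRel A B) →ₐ[ℂ] ℂ :=
  relLift (isCompatible_one (C := formFamily A B))

theorem relComul_relGen (a : Letter) (i j : Fin n) : relComul A B (relGen A B a i j) =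
    ∑ k, relGen A B a i k ⊗ₜ[ℂ] relGen A B a k j := by
  rw [relComul, relLift_relGen, Matrix.mul_apply]
  refine Finset.sum_congr rfl fun k _ => ?_
  change (relGen A B a i k ⊗ₜ[ℂ] 1) * (1 ⊗ₜ[ℂ] relGen A B a k j) = _
  rw [Algebra.TensorProduct.tmul_mul_tmul, one_mul, mul_one]

theorem relCounit_relGen (a : Letter) (i j : Fin n) : relCounit A B (relGen A B a i j) =
    (1 : Matrix (Fin n) (Fin n) ℂ) i j := relLift_relGen _ a i j

theorem relComul_coassoc :
    ((Algebra.TensorProduct.assoc ℂ ℂ ℂ (RingQuot (HopfRel A B)) (RingQuot (HopfRel A B))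
      (RingQuot (HopfRel A B))).toAlgHom.comp
      (Algebra.TensorProduct.map (relComul A B) (AlgHom.id ℂ _))).comp (relComul A B) =
      (Algebra.TensorProduct.map (AlgHom.id ℂ _) (relComul A B)).comp (relComul A B) := by
  refine relGen_algHom_ext (R := RingQuot (HopfRel A B) ⊗[ℂ] (RingQuot (HopfRel A B) ⊗[ℂ]
    RingQuot (HopfRel A B))) fun a i j => ?_
  change Algebra.TensorProduct.assoc ℂ ℂ ℂ _ _ _ (Algebra.TensorProduct.map (relComul A B)
    (AlgHom.id ℂ _) (relComul A B (relGen A B a i j))) =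
    Algebra.TensorProduct.map (AlgHom.id ℂ _) (relComul A B) (relComul A B (relGen A B a i j))
  rw [relComul_relGen, map_sum, map_sum, map_sum]
  simp only [Algebra.TensorProduct.map_tmul, relComul_relGen, AlgHom.id_apply,
    TensorProduct.sum_tmul, TensorProduct.tmul_sum, map_sum, Algebra.TensorProduct.assoc_tmul]
  exact Finset.sum_comm

theorem relCounit_rTensor_relComul :
    (Algebra.TensorProduct.map (relCounit A B) (AlgHom.id ℂ _)).comp (relComul A B) =
      (Algebra.TensorProduct.lid ℂ (RingQuot (HopfRel A B))).symm := by
  refine relGen_algHom_ext fun a i j => ?_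
  change Algebra.TensorProduct.map (relCounit A B) (AlgHom.id ℂ _)
    (relComul A B (relGen A B a i j)) = 1 ⊗ₜ[ℂ] _
  rw [relComul_relGen, map_sum]
  simp only [Algebra.TensorProduct.map_tmul, relCounit_relGen, AlgHom.id_apply, Matrix.one_apply]
  rw [Finset.sum_eq_single i (fun k _ hk => by rw [if_neg hk.symm, TensorProduct.zero_tmul])
    (by simp), if_pos rfl]

theorem relCounit_lTensor_relComul :
    (Algebra.TensorProduct.map (AlgHom.id ℂ _) (relCounit A B)).comp (relComul A B) =
      (Algebra.TensorProduct.rid ℂ ℂ (RingQuot (HopfRel A B))).symm := by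
  refine relGen_algHom_ext (R := RingQuot (HopfRel A B) ⊗[ℂ] ℂ) fun a i j => ?_
  change Algebra.TensorProduct.map (AlgHom.id ℂ _) (relCounit A B)
    (relComul A B (relGen A B a i j)) = _ ⊗ₜ[ℂ] 1
  rw [relComul_relGen, map_sum]
  simp only [Algebra.TensorProduct.map_tmul, relCounit_relGen, AlgHom.id_apply, Matrix.one_apply]
  rw [Finset.sum_eq_single j (fun k _ hk => by rw [if_neg hk, TensorProduct.tmul_zero])
    (by simp), if_pos rfl]

/-- The algebra with the given relations is a bialgebra; the coalgebra axioms are checked on the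
generators. -/
noncomputable instance relBialgebra : Bialgebra ℂ (RingQuot (HopfRel A B)) :=
  Bialgebra.ofAlgHom (relComul A B) (relCounit A B) relComul_coassoc relCounit_rTensor_relComul
    relCounit_lTensor_relComul

variable (hC : ∀ a, IsUnit (formFamily A B a))

/-- The antipode, as a homomorphism to the opposite algebra: inversion of the matrices of
generators. -/
noncomputable def relAntipodeOp :
    RingQuot (HopfRel A B) →ₐ[ℂ] (RingQuot (HopfRel A B))ᵐᵒᵖ :=
  relLift ((isCompatible_relGen A B).op_inv hC)

/-- The antipode. -/
noncomputable def relAntipode : RingQuot (HopfRel A B) →ₗ[ℂ] RingQuot (HopfRel A B) :=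
  (MulOpposite.opLinearEquiv ℂ).symm.toLinearMap ∘ₗ (relAntipodeOp hC).toLinearMap

theorem relAntipode_mul (x y : RingQuot (HopfRel A B)) :
    relAntipode hC (x * y) = relAntipode hC y * relAntipode hC x :=
  congrArg MulOpposite.unop (map_mul (relAntipodeOp hC) x y)

theorem relAntipode_one : relAntipode hC 1 = 1 :=
  congrArg MulOpposite.unop (map_one (relAntipodeOp hC))

theorem relAntipode_relGen (a : Letter) (i j : Fin n) :
    relAntipode hC (relGen A B a i j) = compatibleInv (formFamily A B) (relGen A B) a i j :=
  congrArg MulOpposite.unop (relLift_relGen ((isCompatible_relGen A B).op_inv hC) a i j)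

theorem mul_antipode_rTensor_mul {x y : RingQuot (HopfRel A B) ⊗[ℂ] RingQuot (HopfRel A B)} {r : ℂ}
    (h : LinearMap.mul' ℂ _ ((relAntipode hC).rTensor _ x) = algebraMap ℂ _ r) :
    LinearMap.mul' ℂ _ ((relAntipode hC).rTensor _ (x * y)) =
      r • LinearMap.mul' ℂ _ ((relAntipode hC).rTensor _ y) := by
  induction y using TensorProduct.induction_on with
  | zero => simp
  | add y z hy hz => rw [mul_add, map_add, map_add, map_add, map_add, hy, hz, smul_add]
  | tmul p q =>
    have : ∀ x, LinearMap.mul' ℂ _ ((relAntipode hC).rTensor _ (x * p ⊗ₜ q)) =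
        relAntipode hC p * LinearMap.mul' ℂ _ ((relAntipode hC).rTensor _ x) * q := by
      intro x
      induction x using TensorProduct.induction_on with
      | zero => simp
      | add y z hy hz => rw [add_mul, map_add, map_add, map_add, map_add, hy, hz, mul_add, add_mul]
      | tmul s t =>
        rw [Algebra.TensorProduct.tmul_mul_tmul, LinearMap.rTensor_tmul, LinearMap.rTensor_tmul,
          LinearMap.mul'_apply, LinearMap.mul'_apply, relAntipode_mul]
        simp only [mul_assoc]
    rw [this, h, LinearMap.rTensor_tmul, LinearMap.mul'_apply, ← Algebra.commutes, mul_assoc,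
      Algebra.smul_def]

theorem mul_antipode_lTensor_mul {x y : RingQuot (HopfRel A B) ⊗[ℂ] RingQuot (HopfRel A B)} {r : ℂ}
    (h : LinearMap.mul' ℂ _ ((relAntipode hC).lTensor _ y) = algebraMap ℂ _ r) :
    LinearMap.mul' ℂ _ ((relAntipode hC).lTensor _ (x * y)) =
      r • LinearMap.mul' ℂ _ ((relAntipode hC).lTensor _ x) := by
  induction x using TensorProduct.induction_on with
  | zero => simp
  | add y z hy hz => rw [add_mul, map_add, map_add, map_add, map_add, hy, hz, smul_add]
  | tmul p q =>
    have : ∀ y, LinearMap.mul' ℂ _ ((relAntipode hC).lTensor _ (p ⊗ₜ q * y)) =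
        p * LinearMap.mul' ℂ _ ((relAntipode hC).lTensor _ y) * relAntipode hC q := by
      intro y
      induction y using TensorProduct.induction_on with
      | zero => simp
      | add y z hy hz => rw [mul_add, map_add, map_add, map_add, map_add, hy, hz, mul_add, add_mul]
      | tmul s t =>
        rw [Algebra.TensorProduct.tmul_mul_tmul, LinearMap.lTensor_tmul, LinearMap.lTensor_tmul,
          LinearMap.mul'_apply, LinearMap.mul'_apply, relAntipode_mul]
        simp only [mul_assoc]
    rw [this, h, LinearMap.lTensor_tmul, LinearMap.mul'_apply, ← Algebra.commutes, mul_assoc,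
      Algebra.smul_def]

/-- The Hopf algebra with relations `HopfRel A B`. -/
noncomputable abbrev relHopfAlgebra : HopfAlgebra ℂ (RingQuot (HopfRel A B)) where
  antipode := relAntipode hC
  mul_antipode_rTensor_comul := by
    refine LinearMap.ext fun x => ?_
    change LinearMap.mul' ℂ _ ((relAntipode hC).rTensor _ (relComul A B x)) =
      algebraMap ℂ _ (relCounit A B x)
    induction x using relGen_induction with
    | h0 r =>
      rw [AlgHom.commutes, AlgHom.commutes]
      rw [Algebra.algebraMap_eq_smul_one, map_smul, map_smul, Algebra.TensorProduct.one_def,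
        LinearMap.rTensor_tmul, relAntipode_one, LinearMap.mul'_apply, mul_one]
      exact (Algebra.algebraMap_eq_smul_one r).symm
    | h1 a i j =>
      rw [relComul_relGen, relCounit_relGen, map_sum, map_sum]
      simp only [LinearMap.rTensor_tmul, LinearMap.mul'_apply, relAntipode_relGen]
      have := congrFun₂ ((isCompatible_relGen A B).inv_mul hC a) i j
      rw [Matrix.mul_apply] at this
      rw [this, Matrix.one_apply, Matrix.one_apply, apply_ite (algebraMap ℂ _), map_one, map_zero]
    | hmul x y hx hy =>
      rw [map_mul, mul_antipode_rTensor_mul hC hx, hy, map_mul, map_mul, Algebra.smul_def]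
    | hadd x y hx hy => rw [map_add, map_add, map_add, hx, hy, map_add, map_add]
  mul_antipode_lTensor_comul := by
    refine LinearMap.ext fun x => ?_
    change LinearMap.mul' ℂ _ ((relAntipode hC).lTensor _ (relComul A B x)) =
      algebraMap ℂ _ (relCounit A B x)
    induction x using relGen_induction with
    | h0 r =>
      rw [AlgHom.commutes, AlgHom.commutes]
      rw [Algebra.algebraMap_eq_smul_one, map_smul, map_smul, Algebra.TensorProduct.one_def,
        LinearMap.lTensor_tmul, relAntipode_one, LinearMap.mul'_apply, mul_one]
      exact (Algebra.algebraMap_eq_smul_one r).symm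
    | h1 a i j =>
      rw [relComul_relGen, relCounit_relGen, map_sum, map_sum]
      simp only [LinearMap.lTensor_tmul, LinearMap.mul'_apply, relAntipode_relGen]
      have := congrFun₂ ((isCompatible_relGen A B).mul_inv hC a) i j
      rw [Matrix.mul_apply] at this
      rw [this, Matrix.one_apply, Matrix.one_apply, apply_ite (algebraMap ℂ _), map_one, map_zero]
    | hmul x y hx hy =>
      rw [map_mul, mul_antipode_lTensor_mul hC hy, hx, map_mul, map_mul, Algebra.smul_def,
        Algebra.commutes]
    | hadd x y hx hy => rw [map_add, map_add, map_add, hx, hy, map_add, map_add]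

end HopfAlgebra
end OrientedKauffman

/-! ### Coactions in coordinates -/

namespace OrientedKauffman

section WordMatrix

variable {n : ℕ} {R S : Type*} [Semiring R] [Semiring S]

/-- Products of the entries of the matrices `T a`, along a word. -/
def wordCoef (T : Letter → Matrix (Fin n) (Fin n) R) :
    List Letter → List (Fin n) → List (Fin n) → R
  | a :: u, i :: I, j :: J => T a i j * wordCoef T u I J
  | _, _, _ => 1

/-- The tensor product of the matrices `T a` along a word. -/
def wordMatrix (T : Letter → Matrix (Fin n) (Fin n) R) (u : List Letter) :
    Matrix (Idx (Fin n) u) (Idx (Fin n) u) R :=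
  fun I J => wordCoef T u I.1 J.1

variable (T T' : Letter → Matrix (Fin n) (Fin n) R) {u v : List Letter}

theorem wordMatrix_nil (I J : Idx (Fin n) []) : wordMatrix T [] I J = 1 := by
  simp [wordMatrix, wordCoef]

theorem wordMatrix_cons (a : Letter) (i j : Fin n) (I J : Idx (Fin n) u) :
    wordMatrix T (a :: u) ((Idx.one i : Idx (Fin n) [a]).app I)
      ((Idx.one j : Idx (Fin n) [a]).app J) = T a i j * wordMatrix T u I J := rfl

theorem wordMatrix_one (a : Letter) (i j : Fin n) :
    wordMatrix T [a] (Idx.one i) (Idx.one j) = T a i j :=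
  mul_one _

theorem wordMatrix_two (a b : Letter) (i j k l : Fin n) :
    wordMatrix T [a, b] (Idx.two i k) (Idx.two j l) = T a i j * T b k l :=
  congrArg (T a i j * ·) (mul_one _)

theorem exists_cons {a : Letter} (K : Idx (Fin n) (a :: u)) :
    ∃ (i : Fin n) (I : Idx (Fin n) u), K = (Idx.one i : Idx (Fin n) [a]).app I := by
  obtain ⟨I₁, I, rfl⟩ := Idx.exists_app (u := [a]) K
  obtain ⟨i, rfl⟩ := I₁.exists_one
  exact ⟨i, I, rfl⟩

theorem wordMatrix_app : ∀ {u : List Letter} (I J : Idx (Fin n) u) (I' J' : Idx (Fin n) v),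
    wordMatrix T (u ++ v) (I.app I') (J.app J') = wordMatrix T u I J * wordMatrix T v I' J'
  | [], I, J, I', J' => by
    obtain rfl := I.eq_nil
    obtain rfl := J.eq_nil
    rw [wordMatrix_nil, one_mul]
    rfl
  | a :: u, I, J, I', J' => by
    obtain ⟨i, I, rfl⟩ := exists_cons I
    obtain ⟨j, J, rfl⟩ := exists_cons J
    rw [wordMatrix_cons, mul_assoc, ← wordMatrix_app I J]
    rfl

theorem map_wordMatrix (f : R →+* S) : ∀ {u : List Letter} (I J : Idx (Fin n) u),
    f (wordMatrix T u I J) = wordMatrix (fun a => (T a).map f) u I J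
  | [], I, J => by rw [wordMatrix_nil, wordMatrix_nil, map_one]
  | a :: u, I, J => by
    obtain ⟨i, I, rfl⟩ := exists_cons I
    obtain ⟨j, J, rfl⟩ := exists_cons J
    rw [wordMatrix_cons, wordMatrix_cons, map_mul, map_wordMatrix]
    rfl

theorem wordMatrix_unit : ∀ {u : List Letter} (I J : Idx (Fin n) u),
    wordMatrix (fun _ => (1 : Matrix (Fin n) (Fin n) R)) u I J =
      (1 : Matrix (Idx (Fin n) u) (Idx (Fin n) u) R) I J
  | [], I, J => by rw [wordMatrix_nil, Subsingleton.elim I J, Matrix.one_apply_eq]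
  | a :: u, I, J => by
    obtain ⟨i, I, rfl⟩ := exists_cons I
    obtain ⟨j, J, rfl⟩ := exists_cons J
    rw [wordMatrix_cons, wordMatrix_unit I J]
    simp only [Matrix.one_apply]
    by_cases h : i = j
    · by_cases h' : I = J
      · rw [if_pos h, if_pos h', if_pos (by rw [h, h']), mul_one]
      · rw [if_neg h', if_neg fun e => h' (Idx.app_inj.1 e).2, mul_zero]
    · rw [if_neg h, if_neg fun e => h (Idx.one_inj.1 (Idx.app_inj.1 e).1), zero_mul]

theorem commute_wordMatrix {x : R} (h : ∀ a i j, Commute x (T a i j)) :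
    ∀ {u : List Letter} (I J : Idx (Fin n) u), Commute x (wordMatrix T u I J)
  | [], I, J => by rw [wordMatrix_nil]; exact Commute.one_right x
  | a :: u, I, J => by
    obtain ⟨i, I, rfl⟩ := exists_cons I
    obtain ⟨j, J, rfl⟩ := exists_cons J
    rw [wordMatrix_cons]
    exact (h a i j).mul_right (commute_wordMatrix h I J)

theorem wordMatrix_mul (h : ∀ a a' i j k l, Commute (T a i j) (T' a' k l)) :
    ∀ {u : List Letter} (I J : Idx (Fin n) u), wordMatrix (fun a => T a * T' a) u I J =
      ∑ K, wordMatrix T u I K * wordMatrix T' u K J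
  | [], I, J => by
    rw [Idx.sum_nil, wordMatrix_nil, wordMatrix_nil, wordMatrix_nil, mul_one]
  | a :: u, I, J => by
    obtain ⟨i, I, rfl⟩ := exists_cons I
    obtain ⟨j, J, rfl⟩ := exists_cons J
    rw [wordMatrix_cons, wordMatrix_mul h I J, Matrix.mul_apply, Finset.sum_mul_sum]
    refine Eq.trans ?_ ((Idx.sum_app (u := [a]) _).trans (Idx.sum_one _)).symm
    refine Finset.sum_congr rfl fun k _ => Finset.sum_congr rfl fun K _ => ?_
    rw [wordMatrix_cons, wordMatrix_cons]
    exact (commute_wordMatrix T (fun a' i' j' => (h a' a i' j' k j).symm) I K).mul_mul_mul_comm _ _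

end WordMatrix

theorem sum_ins_two {ι : Type*} [Fintype ι] {M : Type*} [AddCommMonoid M] {p q : List Letter}
    {a : Letter} (F : Idx ι (p ++ a :: a.dual :: q) → M) :
    ∑ K, F K = ∑ P : Idx ι p, ∑ Q : Idx ι q, ∑ i, ∑ j, F (P.ins (Idx.two i j) Q) := by
  refine (Idx.sum_app (u := p) (v := [a, a.dual] ++ q) F).trans (Finset.sum_congr rfl fun P _ => ?_)
  refine (Idx.sum_app (u := [a, a.dual]) (v := q) _).trans (Finset.sum_comm.trans ?_)
  exact Finset.sum_congr rfl fun Q _ => Idx.sum_two _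

namespace FiberFunctor

section Natural

variable {d : ℂ} (Φ : FiberFunctor d) {n : ℕ}
  (b : ∀ a : Letter, Module.Basis (Fin n) ℂ (Φ.space (⟨[a]⟩ : Obj d)))
  {N : Type*} [AddCommGroup N] [Module ℂ N] {p q : List Letter} {a : Letter}

theorem sum_matrix_capD_left (P : Idx (Fin n) p) (Q : Idx (Fin n) q)
    (G : Idx (Fin n) (p ++ a :: a.dual :: q) → N) :
    ∑ J, Φ.matrix b ((capD a p q).hom : (⟨p ++ a :: a.dual :: q⟩ : Obj d) ⟶ ⟨p ++ q⟩)
      (P.app Q) J • G J = ∑ i, ∑ j, Φ.capMatrix b a i j • G (P.ins (Idx.two i j) Q) := by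
  refine (sum_ins_two _).trans ?_
  simp only [matrix_capD, Matrix.one_apply, ite_mul, mul_ite, one_mul, mul_one, zero_mul, mul_zero,
    ite_smul, zero_smul, Finset.sum_ite_irrel, Finset.sum_const_zero, Finset.sum_ite_eq,
    Finset.mem_univ, if_true]

theorem sum_matrix_capD_right (P : Idx (Fin n) p) (Q : Idx (Fin n) q) (i j : Fin n)
    (G : Idx (Fin n) (p ++ q) → N) :
    ∑ K, Φ.matrix b ((capD a p q).hom : (⟨p ++ a :: a.dual :: q⟩ : Obj d) ⟶ ⟨p ++ q⟩) K
      (P.ins (Idx.two i j) Q) • G K = Φ.capMatrix b a i j • G (P.app Q) := by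
  refine (Idx.sum_app (u := p) (v := q) _).trans ?_
  simp only [matrix_capD, Matrix.one_apply, ite_mul, mul_ite, one_mul, mul_one, zero_mul, mul_zero,
    ite_smul, zero_smul, Finset.sum_ite_eq', Finset.mem_univ, if_true]

theorem sum_matrix_cupD_left (P : Idx (Fin n) p) (Q : Idx (Fin n) q) (i j : Fin n)
    (G : Idx (Fin n) (p ++ q) → N) :
    ∑ J, Φ.matrix b ((cupD a p q).hom : (⟨p ++ q⟩ : Obj d) ⟶ ⟨p ++ a :: a.dual :: q⟩)
      (P.ins (Idx.two i j) Q) J • G J = Φ.cupMatrix b a i j • G (P.app Q) := by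
  refine (Idx.sum_app (u := p) (v := q) _).trans ?_
  simp only [matrix_cupD, Matrix.one_apply, ite_mul, mul_ite, one_mul, mul_one, zero_mul, mul_zero,
    ite_smul, zero_smul, Finset.sum_ite_eq, Finset.mem_univ, if_true]

theorem sum_matrix_cupD_right (P : Idx (Fin n) p) (Q : Idx (Fin n) q)
    (G : Idx (Fin n) (p ++ a :: a.dual :: q) → N) :
    ∑ K, Φ.matrix b ((cupD a p q).hom : (⟨p ++ q⟩ : Obj d) ⟶ ⟨p ++ a :: a.dual :: q⟩) K
      (P.app Q) • G K = ∑ i, ∑ j, Φ.cupMatrix b a i j • G (P.ins (Idx.two i j) Q) := by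
  refine (sum_ins_two _).trans ?_
  simp only [matrix_cupD, Matrix.one_apply, ite_mul, mul_ite, one_mul, mul_one, zero_mul, mul_zero,
    ite_smul, zero_smul, Finset.sum_ite_irrel, Finset.sum_const_zero, Finset.sum_ite_eq',
    Finset.mem_univ, if_true]

/-- Naturality of a family of maps `Φ(Y) → Φ(Y) ⊗ N`, in terms of matrices with entries in `N`. -/
def IsNaturalMatrix (M : ∀ u : List Letter, Matrix (Idx (Fin n) u) (Idx (Fin n) u) N) : Prop :=
  ∀ (Y Z : Obj d) (f : Y ⟶ Z) (K : Idx (Fin n) Z.word) (I : Idx (Fin n) Y.word),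
    ∑ J, Φ.matrix b f K J • M Y.word J I = ∑ J, Φ.matrix b f J I • M Z.word K J

/-- Tensor products of compatible matrices commute with the matrices of all morphisms. -/
theorem isNaturalMatrix_wordMatrix {R : Type*} [Ring R] [Algebra ℂ R]
    {T : Letter → Matrix (Fin n) (Fin n) R} (h : IsCompatible (Φ.capMatrix b) T) :
    Φ.IsNaturalMatrix b (wordMatrix T) := by
  intro Y Z f
  induction generated f with
  | zero => intro K I; simp only [matrix_zero, Matrix.zero_apply, zero_smul, Finset.sum_const_zero]
  | add _ _ ih ih' =>
    intro K I
    simp only [matrix_add, Matrix.add_apply, add_smul, Finset.sum_add_distrib, ih, ih']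
  | smul c _ ih =>
    intro K I
    simp only [matrix_smul, Matrix.smul_apply, smul_assoc, ← Finset.smul_sum, ih]
  | id =>
    intro K I
    simp only [matrix_id, Matrix.one_apply, ite_smul, one_smul, zero_smul, Finset.sum_ite_eq,
      Finset.sum_ite_eq', Finset.mem_univ, if_true]
  | comp _ _ ih ih' =>
    intro K I
    simp only [matrix_comp, Matrix.mul_apply, Finset.sum_smul, mul_smul]
    rw [Finset.sum_comm]
    simp only [← Finset.smul_sum, ih]
    simp only [Finset.smul_sum, smul_comm (Φ.matrix b _ K _)]
    rw [Finset.sum_comm]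
    simp only [← Finset.smul_sum, ih']
    simp only [Finset.smul_sum]
    rw [Finset.sum_comm]
    simp only [smul_comm (Φ.matrix b _ _ I)]
  | cap a p q =>
    intro K I
    obtain ⟨P', Q', rfl⟩ := Idx.exists_app (u := p) (v := q) K
    obtain ⟨P, J, rfl⟩ := Idx.exists_app (u := p) (v := [a, a.dual] ++ q) I
    obtain ⟨J, Q, rfl⟩ := Idx.exists_app (u := [a, a.dual]) (v := q) J
    obtain ⟨i, j, rfl⟩ := J.exists_two
    have e : ∀ k l, wordMatrix T (p ++ a :: a.dual :: q) (P'.ins (Idx.two k l) Q')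
        (P.app ((Idx.two i j).app Q)) =
        wordMatrix T p P' P * ((T a k i * T a.dual l j) * wordMatrix T q Q' Q) := by
      intro k l
      rw [← wordMatrix_two, ← wordMatrix_app, ← wordMatrix_app]
      rfl
    refine (Φ.sum_matrix_capD_left b P' Q' _).trans
      (Eq.trans ?_ (Φ.sum_matrix_capD_right b P Q i j _).symm)
    simp only [e]
    rw [wordMatrix_app]
    have := h.sum_cap a i j
    calc _ = wordMatrix T p P' P * ((∑ k, ∑ l, Φ.capMatrix b a k l • (T a k i * T a.dual l j)) *
            wordMatrix T q Q' Q) := by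
          simp only [Finset.sum_mul, Finset.mul_sum, smul_mul_assoc, mul_smul_comm]
      _ = _ := by rw [this, smul_mul_assoc, one_mul, mul_smul_comm]
  | cup a p q =>
    intro K I
    obtain ⟨P, Q, rfl⟩ := Idx.exists_app (u := p) (v := q) I
    obtain ⟨P', J, rfl⟩ := Idx.exists_app (u := p) (v := [a, a.dual] ++ q) K
    obtain ⟨J, Q', rfl⟩ := Idx.exists_app (u := [a, a.dual]) (v := q) J
    obtain ⟨k, l, rfl⟩ := J.exists_two
    have e : ∀ i j, wordMatrix T (p ++ a :: a.dual :: q) (P'.app ((Idx.two k l).app Q'))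
        (P.ins (Idx.two i j) Q) =
        wordMatrix T p P' P * ((T a k i * T a.dual l j) * wordMatrix T q Q' Q) := by
      intro i j
      rw [← wordMatrix_two, ← wordMatrix_app, ← wordMatrix_app]
      rfl
    refine (Φ.sum_matrix_cupD_left b P' Q' k l _).trans
      (Eq.trans ?_ (Φ.sum_matrix_cupD_right b P Q _).symm)
    simp only [e]
    rw [wordMatrix_app]
    have := h.sum_cup a k l
    rw [← cupMatrix_eq_inv] at this
    calc _ = wordMatrix T p P' P * ((∑ i, ∑ j, Φ.cupMatrix b a i j • (T a k i * T a.dual l j)) *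
            wordMatrix T q Q' Q) := by rw [this, smul_mul_assoc, one_mul, mul_smul_comm]
      _ = _ := by simp only [Finset.sum_mul, Finset.mul_sum, smul_mul_assoc, mul_smul_comm]

end Natural

section Coaction

variable {d : ℂ} (Φ : FiberFunctor d) {n : ℕ}
  (b : ∀ a : Letter, Module.Basis (Fin n) ℂ (Φ.space (⟨[a]⟩ : Obj d)))

theorem sum_tmul_inj {V ι N : Type*} [AddCommGroup V] [Module ℂ V] [Fintype ι]
    [AddCommGroup N] [Module ℂ N] (e : Module.Basis ι ℂ V) {m m' : ι → N}
    (h : ∑ i, e i ⊗ₜ[ℂ] m i = ∑ i, e i ⊗ₜ[ℂ] m' i) : m = m' := by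
  classical
  funext j
  have := congrArg (fun t => TensorProduct.lid ℂ N ((e.coord j).rTensor N t)) h
  simpa [Finsupp.single_apply, ite_smul] using this

theorem exists_sum_tmul {V ι N : Type*} [AddCommGroup V] [Module ℂ V] [Fintype ι]
    [AddCommGroup N] [Module ℂ N] (e : Module.Basis ι ℂ V) (t : V ⊗[ℂ] N) :
    ∃ m : ι → N, t = ∑ i, e i ⊗ₜ[ℂ] m i := by
  induction t using TensorProduct.induction_on with
  | zero => exact ⟨0, by simp⟩
  | add s t hs ht =>
    obtain ⟨m, rfl⟩ := hs
    obtain ⟨m', rfl⟩ := ht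
    exact ⟨m + m', by simp only [Pi.add_apply, TensorProduct.tmul_add, Finset.sum_add_distrib]⟩
  | tmul x y =>
    refine ⟨fun i => e.repr x i • y, ?_⟩
    simp only [TensorProduct.tmul_smul, TensorProduct.smul_tmul']
    rw [← TensorProduct.sum_tmul, e.sum_repr]

variable {N : Type} [AddCommGroup N] [Module ℂ N]

/-- The matrices, with entries in `N`, of a family of maps `Φ(Y) → Φ(Y) ⊗ N`. -/
def HasEntries (θ : ∀ Y, Φ.space Y →ₗ[ℂ] Φ.space Y ⊗[ℂ] N)
    (M : ∀ u : List Letter, Matrix (Idx (Fin n) u) (Idx (Fin n) u) N) : Prop :=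
  ∀ (Y : Obj d) (I : Idx (Fin n) Y.word), θ Y (Φ.wordBasis b Y.word I) =
    ∑ J, Φ.wordBasis b Y.word J ⊗ₜ[ℂ] M Y.word J I

theorem exists_entries (θ : ∀ Y, Φ.space Y →ₗ[ℂ] Φ.space Y ⊗[ℂ] N) :
    ∃ M, Φ.HasEntries b θ M := by
  choose m hm using fun (u : List Letter) (I : Idx (Fin n) u) =>
    exists_sum_tmul (Φ.wordBasis b u) (θ ⟨u⟩ (Φ.wordBasis b u I))
  exact ⟨fun u J I => m u I J, fun Y I => hm Y.word I⟩

variable {b} {Φ}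

theorem HasEntries.isNatural_iff {θ : ∀ Y, Φ.space Y →ₗ[ℂ] Φ.space Y ⊗[ℂ] N}
    {M : ∀ u : List Letter, Matrix (Idx (Fin n) u) (Idx (Fin n) u) N} (h : Φ.HasEntries b θ M) :
    Φ.IsNatural θ ↔ Φ.IsNaturalMatrix b M := by
  have h1 : ∀ (Y Z : Obj d) (f : Y ⟶ Z) (I : Idx (Fin n) Y.word),
      θ Z (Φ.lin f (Φ.wordBasis b Y.word I)) =
        ∑ K, Φ.wordBasis b Z.word K ⊗ₜ[ℂ] ∑ J, Φ.matrix b f J I • M Z.word K J := by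
    intro Y Z f I
    rw [lin_wordBasis, map_sum]
    simp only [map_smul, h Z, TensorProduct.tmul_sum, Finset.smul_sum, TensorProduct.tmul_smul]
    rw [Finset.sum_comm]
  have h2 : ∀ (Y Z : Obj d) (f : Y ⟶ Z) (I : Idx (Fin n) Y.word),
      (Φ.lin f).rTensor N (θ Y (Φ.wordBasis b Y.word I)) =
        ∑ K, Φ.wordBasis b Z.word K ⊗ₜ[ℂ] ∑ J, Φ.matrix b f K J • M Y.word J I := by
    intro Y Z f I
    rw [h Y, map_sum]
    simp only [LinearMap.rTensor_tmul, lin_wordBasis, TensorProduct.sum_tmul,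
      TensorProduct.smul_tmul, TensorProduct.tmul_sum]
    rw [Finset.sum_comm]
  constructor
  · intro hn Y Z f K I
    have := LinearMap.congr_fun (hn Y Z f) (Φ.wordBasis b Y.word I)
    rw [LinearMap.comp_apply, LinearMap.comp_apply, h1, h2] at this
    exact (congrFun (sum_tmul_inj _ this) K).symm
  · intro hn Y Z f
    refine (Φ.wordBasis b Y.word).ext fun I => ?_
    rw [LinearMap.comp_apply, LinearMap.comp_apply, h1, h2]
    exact Finset.sum_congr rfl fun K _ => congrArg _ (hn Y Z f K I).symm

variable (b) in
/-- The family of maps with given entries. -/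
noncomputable def ofEntries
    (M : ∀ u : List Letter, Matrix (Idx (Fin n) u) (Idx (Fin n) u) N) (Y : Obj d) :
    Φ.space Y →ₗ[ℂ] Φ.space Y ⊗[ℂ] N :=
  (Φ.wordBasis b Y.word).constr ℂ fun I => ∑ J, Φ.wordBasis b Y.word J ⊗ₜ[ℂ] M Y.word J I

theorem hasEntries_ofEntries (M : ∀ u : List Letter, Matrix (Idx (Fin n) u) (Idx (Fin n) u) N) :
    Φ.HasEntries b (ofEntries b M) M :=
  fun Y I => (Φ.wordBasis b Y.word).constr_basis ℂ _ I

theorem HasEntries.lTensor {θ : ∀ Y, Φ.space Y →ₗ[ℂ] Φ.space Y ⊗[ℂ] N}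
    {M : ∀ u : List Letter, Matrix (Idx (Fin n) u) (Idx (Fin n) u) N} (h : Φ.HasEntries b θ M)
    {N' : Type} [AddCommGroup N'] [Module ℂ N'] (f : N →ₗ[ℂ] N') :
    Φ.HasEntries b (fun Y => f.lTensor (Φ.space Y) ∘ₗ θ Y) (fun u => (M u).map f) := by
  intro Y I
  change f.lTensor (Φ.space Y) (θ Y (Φ.wordBasis b Y.word I)) = _
  rw [h Y, map_sum]
  simp only [LinearMap.lTensor_tmul, Matrix.map_apply]

theorem HasEntries.eq_iff {θ θ' : ∀ Y, Φ.space Y →ₗ[ℂ] Φ.space Y ⊗[ℂ] N}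
    {M M' : ∀ u : List Letter, Matrix (Idx (Fin n) u) (Idx (Fin n) u) N}
    (h : Φ.HasEntries b θ M) (h' : Φ.HasEntries b θ' M') :
    (∀ Y, θ Y = θ' Y) ↔ ∀ u I J, M u I J = M' u I J := by
  constructor
  · intro e u I J
    have := h ⟨u⟩ J
    rw [e, h' ⟨u⟩] at this
    exact (congrFun (sum_tmul_inj _ this) I).symm
  · intro e Y
    refine (Φ.wordBasis b Y.word).ext fun I => ?_
    rw [h Y, h' Y]
    simp only [e]

end Coaction

end FiberFunctor
end OrientedKauffman

/-! ### The universal coaction -/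

namespace OrientedKauffman

section FreeAlgebra

variable {n : ℕ}

/-- The letter whose coaction defines a generator. -/
def Gen.letter : Gen n → Letter
  | .v _ _ => .X
  | .w _ _ => .Xstar

/-- The row index of a generator. -/
def Gen.row : Gen n → Fin n
  | .v i _ => i
  | .w i _ => i

/-- The column index of a generator. -/
def Gen.col : Gen n → Fin n
  | .v _ j => j
  | .w _ j => j

theorem freeGen_letter_row_col (g : Gen n) :
    freeGen n g.letter g.row g.col = FreeAlgebra.ι ℂ g := by
  cases g <;> rfl

theorem exists_gen (a : Letter) (i j : Fin n) :
    ∃ g : Gen n, g.letter = a ∧ g.row = i ∧ g.col = j := by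
  cases a
  · exact ⟨.v i j, rfl, rfl, rfl⟩
  · exact ⟨.w i j, rfl, rfl, rfl⟩

theorem exists_gen_list : ∀ {u : List Letter} (I J : Idx (Fin n) u),
    ∃ m : List (Gen n), m.map Gen.letter = u ∧ m.map Gen.row = I.1 ∧ m.map Gen.col = J.1
  | [], I, J => ⟨[], rfl, by rw [I.eq_nil]; rfl, by rw [J.eq_nil]; rfl⟩
  | a :: u, I, J => by
    obtain ⟨i, I, rfl⟩ := exists_cons I
    obtain ⟨j, J, rfl⟩ := exists_cons J
    obtain ⟨g, rfl, rfl, rfl⟩ := exists_gen a i j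
    obtain ⟨m, h1, h2, h3⟩ := exists_gen_list I J
    exact ⟨g :: m, congrArg _ h1, congrArg _ h2, congrArg _ h3⟩

theorem wordCoef_freeGen (m : List (Gen n)) :
    wordCoef (freeGen n) (m.map Gen.letter) (m.map Gen.row) (m.map Gen.col) =
      FreeAlgebra.basisFreeMonoid ℂ (Gen n) (FreeMonoid.ofList m) := by
  have e : ∀ m : FreeMonoid (Gen n), FreeAlgebra.basisFreeMonoid ℂ (Gen n) m =
      FreeMonoid.lift (FreeAlgebra.ι ℂ) m := by
    intro m
    simp [FreeAlgebra.basisFreeMonoid, FreeAlgebra.equivMonoidAlgebraFreeMonoid]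
  induction m with
  | nil => rw [e]; exact (map_one _).symm
  | cons g m ih =>
    rw [e, FreeMonoid.ofList_cons, map_mul, ← e (FreeMonoid.ofList m), ← ih, FreeMonoid.lift_eval_of,
      ← freeGen_letter_row_col]
    rfl

/-- The entries of the tensor products of the matrices of generators form a basis of the free
algebra, so that they can be mapped to any given vectors. -/
theorem exists_linearMap_wordMatrix {N : Type*} [AddCommGroup N] [Module ℂ N]
    (M : ∀ u : List Letter, Matrix (Idx (Fin n) u) (Idx (Fin n) u) N) :
    ∃ g : FreeAlgebra ℂ (Gen n) →ₗ[ℂ] N,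
      ∀ u I J, g (wordMatrix (freeGen n) u I J) = M u I J := by
  let F (m : List (Gen n)) : N := M (m.map Gen.letter) ⟨m.map Gen.row, by simp⟩
    ⟨m.map Gen.col, by simp⟩
  refine ⟨(FreeAlgebra.basisFreeMonoid ℂ (Gen n)).constr ℂ fun m => F m.toList, ?_⟩
  rintro u ⟨I, hI⟩ ⟨J, hJ⟩
  obtain ⟨m, rfl, h2, h3⟩ := exists_gen_list (u := u) ⟨I, hI⟩ ⟨J, hJ⟩
  obtain rfl : _ = I := h2
  obtain rfl : _ = J := h3
  exact (congrArg _ (wordCoef_freeGen m)).trans (Module.Basis.constr_basis ..)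

theorem freeAlgebra_induction {P : FreeAlgebra ℂ (Gen n) → Prop}
    (h : ∀ u I J, P (wordMatrix (freeGen n) u I J)) (hadd : ∀ x y, P x → P y → P (x + y))
    (hsmul : ∀ (c : ℂ) x, P x → P (c • x)) (x : FreeAlgebra ℂ (Gen n)) : P x := by
  have hx : x ∈ Submodule.span ℂ (Set.range (FreeAlgebra.basisFreeMonoid ℂ (Gen n))) := by
    rw [Module.Basis.span_eq]
    trivial
  induction hx using Submodule.span_induction with
  | mem x hx =>
    obtain ⟨m, rfl⟩ := hx
    rw [← FreeMonoid.ofList_toList m, ← wordCoef_freeGen]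
    exact h _ ⟨m.toList.map Gen.row, by simp⟩ ⟨m.toList.map Gen.col, by simp⟩
  | zero => exact zero_smul ℂ (wordMatrix (freeGen n) [] Idx.nil Idx.nil) ▸ hsmul 0 _ (h _ _ _)
  | add x y _ _ hx hy => exact hadd x y hx hy
  | smul c x _ hx => exact hsmul c x hx

end FreeAlgebra

/-- A linear map on an algebra descends to the quotient by relations if it respects all two-sided
multiples of the relations. -/
theorem exists_linearMap_ringQuot {F N : Type*} [Ring F] [Algebra ℂ F] [AddCommGroup N]
    [Module ℂ N] {r : F → F → Prop} (g : F →ₗ[ℂ] N)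
    (hg : ∀ {x y}, r x y → ∀ c d, g (c * x * d) = g (c * y * d)) :
    ∃ f : RingQuot r →ₗ[ℂ] N, ∀ x, f (RingQuot.mkAlgHom ℂ r x) = g x := by
  have h1 : ∀ {x y}, RingQuot.Rel r x y → ∀ c d, g (c * x * d) = g (c * y * d) := by
    intro x y h
    induction h with
    | of h => exact hg h
    | add_left _ ih => intro c d; rw [mul_add, mul_add, add_mul, add_mul, map_add, map_add, ih]
    | mul_left _ ih =>
      intro c d
      rw [← mul_assoc, ← mul_assoc, mul_assoc _ _ d, mul_assoc _ _ d, ih]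
    | mul_right _ ih => intro c d; rw [← mul_assoc, ← mul_assoc, ih]
  have h2 : ∀ {x y}, Relation.EqvGen (RingQuot.Rel r) x y → g x = g y := by
    intro x y h
    induction h with
    | rel x y h => simpa using h1 h 1 1
    | refl => rfl
    | symm _ _ _ ih => exact ih.symm
    | trans _ _ _ _ _ ih ih' => exact ih.trans ih'
  have h3 : (RingQuot.mkAlgHom ℂ r).toLinearMap.ker ≤ g.ker := by
    intro x hx
    have hx : RingQuot.mkAlgHom ℂ r x = RingQuot.mkAlgHom ℂ r 0 := hx.trans (map_zero _).symm
    refine (h2 (Quot.eqvGen_exact ?_)).trans (map_zero g)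
    simpa only [RingQuot.mkAlgHom_def, RingQuot.mkRingHom_def, AlgHom.coe_mk, RingHom.coe_mk,
      MonoidHom.coe_mk, OneHom.coe_mk, RingQuot.mk.injEq] using hx
  refine ⟨(LinearMap.ker _).liftQ g h3 ∘ₗ
    ((RingQuot.mkAlgHom ℂ r).toLinearMap.quotKerEquivOfSurjective
      (RingQuot.mkAlgHom_surjective ℂ r)).symm.toLinearMap, fun x => ?_⟩
  have : ((RingQuot.mkAlgHom ℂ r).toLinearMap.quotKerEquivOfSurjective
      (RingQuot.mkAlgHom_surjective ℂ r)).symm (RingQuot.mkAlgHom ℂ r x) =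
        Submodule.Quotient.mk x := by
    rw [LinearEquiv.symm_apply_eq]
    rfl
  exact (congrArg ((LinearMap.ker _).liftQ g h3) this).trans (Submodule.liftQ_apply _ _ _)

namespace FiberFunctor

section Universal

variable {d : ℂ} {Φ : FiberFunctor d} {n : ℕ}
  {b : ∀ a : Letter, Module.Basis (Fin n) ℂ (Φ.space (⟨[a]⟩ : Obj d))}
  {A B : Matrix (Fin n) (Fin n) ℂ}

theorem isCompatible_of_isNaturalMatrix {R : Type*} [Ring R] [Algebra ℂ R]
    {T : Letter → Matrix (Fin n) (Fin n) R} (h : Φ.IsNaturalMatrix b (wordMatrix T)) :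
    IsCompatible (Φ.capMatrix b) T := by
  refine isCompatible_of_sum (fun a j l => ?_) fun a k l => ?_
  · have h1 := h ⟨[a, a.dual]⟩ ⟨[]⟩ (capD a [] []).hom Idx.nil (Idx.two j l)
    have h2 := Φ.sum_matrix_capD_left b (a := a) (p := []) (q := []) Idx.nil Idx.nil
      fun J => wordMatrix T [a, a.dual] J (Idx.two j l)
    have h3 := Φ.sum_matrix_capD_right b (a := a) (p := []) (q := []) Idx.nil Idx.nil j l
      fun J => wordMatrix T [] Idx.nil J
    rw [wordMatrix_nil] at h3
    refine Eq.trans ?_ ((h2.symm.trans h1).trans h3)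
    refine Finset.sum_congr rfl fun i _ => Finset.sum_congr rfl fun k _ => ?_
    rw [← wordMatrix_two]
    rfl
  · have h1 := h ⟨[]⟩ ⟨[a, a.dual]⟩ (cupD a [] []).hom (Idx.two k l) Idx.nil
    have h2 := Φ.sum_matrix_cupD_left b (a := a) (p := []) (q := []) Idx.nil Idx.nil k l
      fun J => wordMatrix T [] J Idx.nil
    have h3 := Φ.sum_matrix_cupD_right b (a := a) (p := []) (q := []) Idx.nil Idx.nil
      fun J => wordMatrix T [a, a.dual] (Idx.two k l) J
    rw [wordMatrix_nil] at h2
    rw [← cupMatrix_eq_inv]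
    refine Eq.trans ?_ ((h3.symm.trans h1.symm).trans h2)
    refine Finset.sum_congr rfl fun i _ => Finset.sum_congr rfl fun k _ => ?_
    rw [← wordMatrix_two]
    rfl

variable {N : Type} [AddCommGroup N] [Module ℂ N]
  {M : ∀ u : List Letter, Matrix (Idx (Fin n) u) (Idx (Fin n) u) N}
  {g : FreeAlgebra ℂ (Gen n) →ₗ[ℂ] N}

theorem map_wordMatrix_mul_two (hg : ∀ u I J, g (wordMatrix (freeGen n) u I J) = M u I J)
    {p q : List Letter} {a : Letter} (P P' : Idx (Fin n) p) (Q Q' : Idx (Fin n) q)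
    (i j k l : Fin n) :
    g (wordMatrix (freeGen n) p P P' * (freeGen n a i j * freeGen n a.dual k l) *
      wordMatrix (freeGen n) q Q Q') =
      M (p ++ a :: a.dual :: q) (P.ins (Idx.two i k) Q) (P'.ins (Idx.two j l) Q') := by
  rw [← wordMatrix_two, mul_assoc, ← wordMatrix_app, ← wordMatrix_app]
  exact hg _ _ _

/-- Naturality for an upper arc between vertical strings: the first and third relations, multiplied
by monomials on both sides, are killed. -/
theorem map_mul_cap_mul (hM : Φ.IsNaturalMatrix b M)
    (hg : ∀ u I J, g (wordMatrix (freeGen n) u I J) = M u I J) (a : Letter) (j l : Fin n)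
    (x y : FreeAlgebra ℂ (Gen n)) :
    g (x * (∑ i, ∑ k, Φ.capMatrix b a i k • (freeGen n a i j * freeGen n a.dual k l)) * y) =
      g (x * (Φ.capMatrix b a j l • 1) * y) := by
  induction x using freeAlgebra_induction with
  | hadd x x' h h' => simp only [add_mul, map_add, h, h']
  | hsmul c x h => simp only [smul_mul_assoc, map_smul] at h ⊢; rw [h]
  | h p P' P =>
  induction y using freeAlgebra_induction with
  | hadd x x' h h' => simp only [mul_add, map_add, h, h']
  | hsmul c x h => simp only [mul_smul_comm, map_smul] at h ⊢; rw [h]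
  | h q Q' Q =>
  simp only [Finset.mul_sum, Finset.sum_mul, mul_smul_comm, smul_mul_assoc, map_sum, map_smul,
    map_wordMatrix_mul_two hg, mul_one]
  rw [← wordMatrix_app, hg]
  exact (Φ.sum_matrix_capD_left b P' Q' fun J => M _ J (P.ins (Idx.two j l) Q)).symm.trans
    ((hM ⟨p ++ a :: a.dual :: q⟩ ⟨p ++ q⟩ (capD a p q).hom _ _).trans
      (Φ.sum_matrix_capD_right b P Q j l fun J => M _ (P'.app Q') J))

/-- Naturality for a lower arc between vertical strings: the second and fourth relations, multiplied
by monomials on both sides, are killed. -/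
theorem map_mul_cup_mul (hM : Φ.IsNaturalMatrix b M)
    (hg : ∀ u I J, g (wordMatrix (freeGen n) u I J) = M u I J) (a : Letter) (k l : Fin n)
    (x y : FreeAlgebra ℂ (Gen n)) :
    g (x * (∑ j, ∑ i, Φ.cupMatrix b a j i • (freeGen n a k j * freeGen n a.dual l i)) * y) =
      g (x * (Φ.cupMatrix b a k l • 1) * y) := by
  induction x using freeAlgebra_induction with
  | hadd x x' h h' => simp only [add_mul, map_add, h, h']
  | hsmul c x h => simp only [smul_mul_assoc, map_smul] at h ⊢; rw [h]
  | h p P' P =>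
  induction y using freeAlgebra_induction with
  | hadd x x' h h' => simp only [mul_add, map_add, h, h']
  | hsmul c x h => simp only [mul_smul_comm, map_smul] at h ⊢; rw [h]
  | h q Q' Q =>
  simp only [Finset.mul_sum, Finset.sum_mul, mul_smul_comm, smul_mul_assoc, map_sum, map_smul,
    map_wordMatrix_mul_two hg, mul_one]
  rw [← wordMatrix_app, hg]
  exact (Φ.sum_matrix_cupD_right b P Q fun J => M _ (P'.ins (Idx.two k l) Q') J).symm.trans
    ((hM ⟨p ++ q⟩ ⟨p ++ a :: a.dual :: q⟩ (cupD a p q).hom _ _).symm.trans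
      (Φ.sum_matrix_cupD_left b P' Q' k l fun J => M _ J (P.app Q)))

/-- Naturality kills the defining relations. -/
theorem exists_linearMap_relGen (hC : formFamily A B = Φ.capMatrix b)
    (hM : Φ.IsNaturalMatrix b M) : ∃ f : RingQuot (HopfRel A B) →ₗ[ℂ] N,
      ∀ u I J, f (wordMatrix (relGen A B) u I J) = M u I J := by
  obtain ⟨g, hg⟩ := exists_linearMap_wordMatrix M
  have eA : A = Φ.capMatrix b .X := congrFun hC .X
  have eB : B = Φ.capMatrix b .Xstar := congrFun hC .Xstar
  have iA : A⁻¹ = Φ.cupMatrix b .Xstar := by rw [eA, cupMatrix_eq_inv]; rfl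
  have iB : B⁻¹ = Φ.cupMatrix b .X := by rw [eB, cupMatrix_eq_inv]; rfl
  obtain ⟨f, hf⟩ := exists_linearMap_ringQuot (r := HopfRel A B) g (by
    rintro _ _ (⟨j, l⟩ | ⟨k, l⟩ | ⟨j, l⟩ | ⟨k, l⟩) c d
    · rw [eA]
      exact map_mul_cap_mul hM hg .X j l c d
    · rw [iA]
      exact map_mul_cup_mul hM hg .Xstar k l c d
    · rw [eB]
      exact map_mul_cap_mul hM hg .Xstar j l c d
    · rw [iB]
      exact map_mul_cup_mul hM hg .X k l c d)
  refine ⟨f, fun u I J => ?_⟩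
  rw [← hg, ← hf]
  exact congrArg f (map_wordMatrix (freeGen n)
    (RingQuot.mkAlgHom ℂ (HopfRel A B)).toRingHom I J).symm

theorem linearMap_ext_relGen {f f' : RingQuot (HopfRel A B) →ₗ[ℂ] N}
    (h : ∀ u I J, f (wordMatrix (relGen A B) u I J) = f' (wordMatrix (relGen A B) u I J)) :
    f = f' := by
  refine LinearMap.ext fun x => ?_
  obtain ⟨x, rfl⟩ := RingQuot.mkAlgHom_surjective ℂ _ x
  induction x using freeAlgebra_induction with
  | hadd x y hx hy => rw [map_add, map_add, map_add, hx, hy]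
  | hsmul c x hx => rw [map_smul, map_smul, map_smul, hx]
  | h u I J =>
    have e : RingQuot.mkAlgHom ℂ (HopfRel A B) (wordMatrix (freeGen n) u I J) =
      wordMatrix (relGen A B) u I J := map_wordMatrix (freeGen n)
        (RingQuot.mkAlgHom ℂ (HopfRel A B)).toRingHom I J
    rw [e, h]

theorem isUnit_formFamily (hC : formFamily A B = Φ.capMatrix b) (a : Letter) :
    IsUnit (formFamily A B a) := by
  rw [hC]
  exact isUnit_capMatrix b a

/-- The coaction of the algebra with relations `HopfRel A B`. -/
noncomputable def relCoact (Φ : FiberFunctor d)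
    (b : ∀ a : Letter, Module.Basis (Fin n) ℂ (Φ.space (⟨[a]⟩ : Obj d)))
    (A B : Matrix (Fin n) (Fin n) ℂ) (Y : Obj d) :
    Φ.space Y →ₗ[ℂ] Φ.space Y ⊗[ℂ] RingQuot (HopfRel A B) :=
  ofEntries b (wordMatrix (relGen A B)) Y

theorem hasEntries_relCoact :
    Φ.HasEntries b (relCoact Φ b A B) (wordMatrix (relGen A B)) := hasEntries_ofEntries _

theorem isNatural_relCoact (hC : formFamily A B = Φ.capMatrix b) :
    Φ.IsNatural (relCoact Φ b A B) :=
  hasEntries_relCoact.isNatural_iff.2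
    (Φ.isNaturalMatrix_wordMatrix b (hC ▸ isCompatible_relGen A B))

theorem relComul_wordMatrix {u : List Letter} (I J : Idx (Fin n) u) :
    relComul A B (wordMatrix (relGen A B) u I J) =
      ∑ K, wordMatrix (relGen A B) u I K ⊗ₜ[ℂ] wordMatrix (relGen A B) u K J := by
  refine (map_wordMatrix (relGen A B) (relComul A B).toRingHom I J).trans ?_
  have e : (fun a => (relGen A B a).map (relComul A B)) = fun a =>
      (relGen A B a).map (Algebra.TensorProduct.includeLeft :
        RingQuot (HopfRel A B) →ₐ[ℂ] RingQuot (HopfRel A B) ⊗[ℂ] RingQuot (HopfRel A B)) *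
      (relGen A B a).map (Algebra.TensorProduct.includeRight :
        RingQuot (HopfRel A B) →ₐ[ℂ] RingQuot (HopfRel A B) ⊗[ℂ] RingQuot (HopfRel A B)) := by
    funext a
    ext i j
    exact relLift_relGen _ a i j
  refine (congrArg (fun T => wordMatrix T u I J) e).trans ((wordMatrix_mul _ _ ?_ I J).trans ?_)
  · exact fun a a' i j k l => commute_includeLeft_includeRight _ _
  · refine Finset.sum_congr rfl fun K _ => ?_
    have h1 := map_wordMatrix (relGen A B) (Algebra.TensorProduct.includeLeft :
      RingQuot (HopfRel A B) →ₐ[ℂ] RingQuot (HopfRel A B) ⊗[ℂ] RingQuot (HopfRel A B)).toRingHom I K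
    have h2 := map_wordMatrix (relGen A B) (Algebra.TensorProduct.includeRight :
      RingQuot (HopfRel A B) →ₐ[ℂ] RingQuot (HopfRel A B) ⊗[ℂ] RingQuot (HopfRel A B)).toRingHom K J
    refine (congrArg₂ _ h1 h2).symm.trans ?_
    change (_ ⊗ₜ[ℂ] 1) * (1 ⊗ₜ[ℂ] _) = _
    rw [Algebra.TensorProduct.tmul_mul_tmul, one_mul, mul_one]

theorem relCounit_wordMatrix {u : List Letter} (I J : Idx (Fin n) u) :
    relCounit A B (wordMatrix (relGen A B) u I J) =
      (1 : Matrix (Idx (Fin n) u) (Idx (Fin n) u) ℂ) I J := by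
  refine (map_wordMatrix (relGen A B) (relCounit A B).toRingHom I J).trans ?_
  rw [← wordMatrix_unit]
  refine congrArg (fun T => wordMatrix T u I J) ?_
  funext a
  ext i j
  exact relLift_relGen _ a i j

/-- The defining property of the coend of `Φ`. -/
theorem relCoact_universal (hC : formFamily A B = Φ.capMatrix b)
    (θ : ∀ Y, Φ.space Y →ₗ[ℂ] Φ.space Y ⊗[ℂ] N) (hθ : Φ.IsNatural θ) :
    ∃! f : RingQuot (HopfRel A B) →ₗ[ℂ] N,
      ∀ Y, θ Y = f.lTensor (Φ.space Y) ∘ₗ relCoact Φ b A B Y := by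
  obtain ⟨M, hM⟩ := Φ.exists_entries b θ
  obtain ⟨f, hf⟩ := exists_linearMap_relGen hC (hM.isNatural_iff.1 hθ)
  refine ⟨f, ?_, fun f' h => ?_⟩
  · exact (hM.eq_iff (hasEntries_relCoact.lTensor f)).2 fun u I J => (hf u I J).symm
  · refine linearMap_ext_relGen fun u I J => ?_
    rw [hf]
    exact ((hM.eq_iff (hasEntries_relCoact.lTensor f')).1 h u I J).symm

/-- The Hopf algebra of a fiber functor, by generators and relations. -/
noncomputable def relTannaka (hC : formFamily A B = Φ.capMatrix b) : Φ.TannakaHopfAlgebra where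
  H := RingQuot (HopfRel A B)
  hopf := relHopfAlgebra (isUnit_formFamily hC)
  coact := relCoact Φ b A B
  natural := isNatural_relCoact hC
  coassoc Y := by
    refine (Φ.wordBasis b Y.word).ext fun I => ?_
    change TensorProduct.assoc ℂ _ _ _ ((relCoact Φ b A B Y).rTensor _
      (relCoact Φ b A B Y (Φ.wordBasis b Y.word I))) =
      (relComul A B).toLinearMap.lTensor _ (relCoact Φ b A B Y (Φ.wordBasis b Y.word I))
    rw [hasEntries_relCoact Y]
    simp only [map_sum, LinearMap.rTensor_tmul, LinearMap.lTensor_tmul, hasEntries_relCoact Y,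
      AlgHom.toLinearMap_apply, relComul_wordMatrix, TensorProduct.sum_tmul,
      TensorProduct.tmul_sum, TensorProduct.assoc_tmul]
    exact Finset.sum_comm
  counit_coact Y := by
    refine (Φ.wordBasis b Y.word).ext fun I => ?_
    change (relCounit A B).toLinearMap.lTensor _ (relCoact Φ b A B Y (Φ.wordBasis b Y.word I)) =
      Φ.wordBasis b Y.word I ⊗ₜ[ℂ] 1
    rw [hasEntries_relCoact Y]
    simp only [map_sum, LinearMap.lTensor_tmul, AlgHom.toLinearMap_apply, relCounit_wordMatrix,
      Matrix.one_apply]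
    rw [Finset.sum_eq_single I (fun J _ hJ => by rw [if_neg hJ, TensorProduct.tmul_zero])
      (by simp), if_pos rfl]
  coact_unit := by
    have := hasEntries_relCoact (A := A) (B := B) (b := b) (⟨[]⟩ : Obj d) Idx.nil
    rw [Idx.sum_nil, wordMatrix_nil, wordBasis_nil] at this
    exact this
  coact_tensor Y Z := by
    refine ((Φ.wordBasis b Y.word).tensorProduct (Φ.wordBasis b Z.word)).ext fun ⟨I, J⟩ => ?_
    rw [Module.Basis.tensorProduct_apply]
    have h := hasEntries_relCoact (A := A) (B := B) (b := b) (Y ⊗ Z) (I.app J)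
    change relCoact Φ b A B (Y ⊗ Z) (Φ.mu Y Z (_ ⊗ₜ _)) = TensorProduct.map _ _
      (TensorProduct.tensorTensorTensorComm ℂ _ _ _ _
        (relCoact Φ b A B Y (Φ.wordBasis b Y.word I) ⊗ₜ[ℂ]
          relCoact Φ b A B Z (Φ.wordBasis b Z.word J)))
    rw [hasEntries_relCoact Y, hasEntries_relCoact Z]
    refine (congrArg _ (Φ.wordBasis_app b I J).symm).trans (h.trans ?_)
    refine (Idx.sum_app (u := Y.word) (v := Z.word) _).trans ?_
    simp only [TensorProduct.sum_tmul, TensorProduct.tmul_sum, map_sum,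
      TensorProduct.tensorTensorTensorComm_tmul, TensorProduct.map_tmul, LinearMap.mul'_apply]
    rw [Finset.sum_comm]
    refine Finset.sum_congr rfl fun L _ => Finset.sum_congr rfl fun K _ => ?_
    rw [← wordMatrix_app]
    exact congrArg (· ⊗ₜ[ℂ] _) (Φ.wordBasis_app b K L)
  universal N _ _ θ hθ := relCoact_universal hC θ hθ

end Universal

end FiberFunctor
end OrientedKauffman

/-! ### The presentation of the Tannaka Hopf algebra -/

namespace OrientedKauffman
namespace FiberFunctor

section Tannaka

variable {d : ℂ} {Φ : FiberFunctor d} {n : ℕ}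
  {b : ∀ a : Letter, Module.Basis (Fin n) ℂ (Φ.space (⟨[a]⟩ : Obj d))}
  {A B : Matrix (Fin n) (Fin n) ℂ} (T : Φ.TannakaHopfAlgebra)

theorem HasEntries.single {N : Type} [AddCommGroup N] [Module ℂ N]
    {θ : ∀ Y, Φ.space Y →ₗ[ℂ] Φ.space Y ⊗[ℂ] N}
    {M : ∀ u : List Letter, Matrix (Idx (Fin n) u) (Idx (Fin n) u) N} (h : Φ.HasEntries b θ M)
    (a : Letter) (j : Fin n) :
    θ ⟨[a]⟩ (b a j) = ∑ i, b a i ⊗ₜ[ℂ] M [a] (Idx.one i) (Idx.one j) := by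
  have := h ⟨[a]⟩ (Idx.one j)
  rw [wordBasis_one] at this
  refine this.trans ((Idx.sum_one _).trans ?_)
  simp only [wordBasis_one]

/-- A coaction that is compatible with tensor products is determined by the coactions on the
letters. -/
theorem exists_entries_coact : ∃ t : Letter → Matrix (Fin n) (Fin n) T.H,
    Φ.HasEntries b T.coact (wordMatrix t) := by
  obtain ⟨M, hM⟩ := Φ.exists_entries b T.coact
  have h0 : ∀ I J, M [] I J = 1 := by
    intro I J
    have h := hM ⟨[]⟩ J
    rw [wordBasis_nil] at h
    have h' := h.symm.trans T.coact_unit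
    have h2 : Φ.unit 1 ⊗ₜ[ℂ] (1 : T.H) =
        ∑ K : Idx (Fin n) [], Φ.wordBasis b [] K ⊗ₜ[ℂ] (1 : T.H) := by
      rw [Idx.sum_nil, wordBasis_nil]
    exact congrFun (sum_tmul_inj _ (h'.trans h2)) I
  have h1 : ∀ (a : Letter) (u : List Letter) (i j : Fin n) (I J : Idx (Fin n) u),
      M (a :: u) ((Idx.one i : Idx (Fin n) [a]).app I) ((Idx.one j : Idx (Fin n) [a]).app J) =
        M [a] (Idx.one i) (Idx.one j) * M u I J := by
    intro a u i j I J
    have h := LinearMap.congr_fun (T.coact_tensor ⟨[a]⟩ ⟨u⟩) (b a j ⊗ₜ Φ.wordBasis b u J)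
    have h2 := hM ⟨a :: u⟩ ((Idx.one j : Idx (Fin n) [a]).app J)
    have h3 := (congrArg (T.coact ⟨a :: u⟩) (Φ.wordBasis_cons b (u := u) j J)).symm.trans h2
    have h4 := h3.symm.trans h
    have h5 : (TensorProduct.map (Φ.mu ⟨[a]⟩ ⟨u⟩) (LinearMap.mul' ℂ T.H) ∘ₗ
        TensorProduct.tensorTensorTensorComm ℂ (Φ.space ⟨[a]⟩) T.H (Φ.space ⟨u⟩) T.H ∘ₗ
          TensorProduct.map (T.coact ⟨[a]⟩) (T.coact ⟨u⟩)) (b a j ⊗ₜ Φ.wordBasis b u J) =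
        ∑ K : Idx (Fin n) (a :: u), Φ.wordBasis b (a :: u) K ⊗ₜ[ℂ]
          (M [a] (Idx.one K.head) (Idx.one j) * M u K.tail J) := by
      change TensorProduct.map _ _ (TensorProduct.tensorTensorTensorComm ℂ _ _ _ _
        (T.coact ⟨[a]⟩ (b a j) ⊗ₜ[ℂ] T.coact ⟨u⟩ (Φ.wordBasis b u J))) = _
      rw [hM.single, hM ⟨u⟩]
      simp only [TensorProduct.sum_tmul, TensorProduct.tmul_sum, map_sum,
        TensorProduct.tensorTensorTensorComm_tmul, TensorProduct.map_tmul, LinearMap.mul'_apply]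
      refine Eq.trans ?_ ((Idx.sum_app (u := [a]) (v := u) _).trans (Idx.sum_one _)).symm
      rw [Finset.sum_comm]
      refine Finset.sum_congr rfl fun k _ => Finset.sum_congr rfl fun K _ => ?_
      rw [← wordBasis_cons]
      rfl
    exact congrFun (sum_tmul_inj _ (h4.trans h5)) ((Idx.one i : Idx (Fin n) [a]).app I)
  let t (a : Letter) : Matrix (Fin n) (Fin n) T.H :=
    Matrix.of fun i j => M [a] (Idx.one i) (Idx.one j)
  refine ⟨t, ?_⟩
  have h2 : ∀ (u : List Letter) (I J : Idx (Fin n) u),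
      wordMatrix t u I J = M u I J := by
    intro u
    induction u with
    | nil => intro I J; rw [wordMatrix_nil, h0]
    | cons a u ih =>
      intro I J
      obtain ⟨i, I, rfl⟩ := exists_cons I
      obtain ⟨j, J, rfl⟩ := exists_cons J
      rw [wordMatrix_cons, h1, ih]
      rfl
  intro Y I
  simp only [h2]
  exact hM Y I

/-- Two universal coactions are isomorphic, so every Tannaka Hopf algebra has the presentation by
generators and relations. -/
theorem exists_algEquiv (hC : formFamily A B = Φ.capMatrix b)
    {t : Letter → Matrix (Fin n) (Fin n) T.H} (ht : Φ.HasEntries b T.coact (wordMatrix t)) :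
    ∃ e : RingQuot (HopfRel A B) ≃ₐ[ℂ] T.H, ∀ a i j, e (relGen A B a i j) = t a i j := by
  have hc : IsCompatible (formFamily A B) t :=
    hC ▸ isCompatible_of_isNaturalMatrix (ht.isNatural_iff.1 T.natural)
  let f := relLift hc
  have hf : ∀ Y, T.coact Y = f.toLinearMap.lTensor (Φ.space Y) ∘ₗ relCoact Φ b A B Y := by
    refine (ht.eq_iff (hasEntries_relCoact.lTensor f.toLinearMap)).2 fun u I J => ?_
    refine Eq.trans ?_ (map_wordMatrix (relGen A B) f.toRingHom I J).symm
    refine congrArg (fun t => wordMatrix t u I J) ?_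
    funext a
    ext i j
    exact (relLift_relGen hc a i j).symm
  obtain ⟨g, hg, -⟩ := T.universal _ (relCoact Φ b A B) (isNatural_relCoact hC)
  have h1 : g ∘ₗ f.toLinearMap = LinearMap.id := by
    refine (relCoact_universal hC _ (isNatural_relCoact hC)).unique (fun Y => ?_) fun Y => ?_
    · rw [LinearMap.lTensor_comp, LinearMap.comp_assoc, ← hf, ← hg]
    · rw [LinearMap.lTensor_id, LinearMap.id_comp]
  have h2 : f.toLinearMap ∘ₗ g = LinearMap.id := by
    refine (T.universal _ T.coact T.natural).unique (fun Y => ?_) fun Y => ?_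
    · rw [LinearMap.lTensor_comp, LinearMap.comp_assoc, ← hg, ← hf]
    · rw [LinearMap.lTensor_id, LinearMap.id_comp]
  exact ⟨AlgEquiv.ofBijective f ⟨Function.LeftInverse.injective (LinearMap.congr_fun h1),
    Function.RightInverse.surjective (LinearMap.congr_fun h2)⟩, relLift_relGen hc⟩

theorem comul_entry {t : Letter → Matrix (Fin n) (Fin n) T.H}
    (ht : Φ.HasEntries b T.coact (wordMatrix t)) (a : Letter) (i j : Fin n) :
    Coalgebra.comul (R := ℂ) (t a i j) = ∑ k, t a i k ⊗ₜ[ℂ] t a k j := by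
  have h0 : ∀ j, T.coact ⟨[a]⟩ (b a j) = ∑ i, b a i ⊗ₜ[ℂ] t a i j := by
    intro j
    rw [ht.single]
    simp only [wordMatrix_one]
  have h := LinearMap.congr_fun (T.coassoc ⟨[a]⟩) (b a j)
  simp only [LinearMap.comp_apply, h0, map_sum, LinearMap.rTensor_tmul, LinearMap.lTensor_tmul,
    TensorProduct.sum_tmul, LinearEquiv.coe_coe, TensorProduct.assoc_tmul] at h
  rw [Finset.sum_comm] at h
  simp only [← TensorProduct.tmul_sum] at h
  exact (congrFun (sum_tmul_inj _ h) i).symm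

end Tannaka

end FiberFunctor
end OrientedKauffman

open OrientedKauffman in
theorem theorem5p1 (d : ℂ) (hd : d ≠ 0) :
    (∃ e : Quotient (FiberFunctor.setoid d) ≃ Σ n : ℕ, SimilarityOrbit n d,
      ∀ (Φ : FiberFunctor d) (n : ℕ) (B : TraceMatrix n d),
        e ⟦Φ⟧ = ⟨n, ⟦B⟧⟩ ↔ Φ.HasMatrix (B.1 : Matrix (Fin n) (Fin n) ℂ)) ∧
    (∀ (Φ : FiberFunctor d) (n : ℕ)
      (v : Module.Basis (Fin n) ℂ (Φ.space (Obj.X d)))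
      (w : Module.Basis (Fin n) ℂ (Φ.space (Obj.Xstar d)))
      (A B : Matrix (Fin n) (Fin n) ℂ),
      (∀ i j, A i j = Φ.formX (v i) (w j)) → (∀ j i, B j i = Φ.formXstar (w j) (v i)) →
      IsUnit A ∧ IsUnit B ∧ Nonempty Φ.TannakaHopfAlgebra ∧
      ∀ T : Φ.TannakaHopfAlgebra, ∃ x y : Fin n → Fin n → T.H,
        (∀ j, T.coact _ (v j) = ∑ i, v i ⊗ₜ[ℂ] x i j) ∧
        (∀ l, T.coact _ (w l) = ∑ k, w k ⊗ₜ[ℂ] y k l) ∧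
        (∃ e : RingQuot (HopfRel A B) ≃ₐ[ℂ] T.H,
          (∀ i j, e (RingQuot.mkAlgHom ℂ (HopfRel A B) (genV i j)) = x i j) ∧
          (∀ k l, e (RingQuot.mkAlgHom ℂ (HopfRel A B) (genW k l)) = y k l)) ∧
        (∀ i j, Coalgebra.comul (R := ℂ) (x i j) = ∑ k, x i k ⊗ₜ[ℂ] x k j) ∧
        (∀ k l, Coalgebra.comul (R := ℂ) (y k l) = ∑ i, y k i ⊗ₜ[ℂ] y i l)) := by
  refine ⟨FiberFunctor.exists_classification hd, fun Φ n v w A B hA hB => ?_⟩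
  let b := FiberFunctor.basisFamily v w
  have hC : formFamily A B = Φ.capMatrix b := by
    funext a
    ext i j
    cases a
    · exact (hA i j).trans (Φ.capMatrix_X b i j).symm
    · exact (hB i j).trans (Φ.capMatrix_Xstar b i j).symm
  refine ⟨FiberFunctor.isUnit_formFamily hC .X, FiberFunctor.isUnit_formFamily hC .Xstar,
    ⟨FiberFunctor.relTannaka hC⟩, fun T => ?_⟩
  obtain ⟨t, ht⟩ := FiberFunctor.exists_entries_coact (b := b) T
  obtain ⟨e, he⟩ := FiberFunctor.exists_algEquiv T hC ht
  have hs : ∀ (a : Letter) (j : Fin n), T.coact ⟨[a]⟩ (b a j) = ∑ i, b a i ⊗ₜ[ℂ] t a i j := by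
    intro a j
    rw [ht.single]
    simp only [wordMatrix_one]
  exact ⟨t .X, t .Xstar, hs .X, hs .Xstar, ⟨e, he .X, he .Xstar⟩,
    FiberFunctor.comul_entry T ht .X, FiberFunctor.comul_entry T ht .Xstar⟩
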